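/- **Calculus.** Fix a set of unitary operators $\mathbf U$, each on some $\mathbb C^{2^n}$ with $n\ge 1$ (the arity of its symbol $U$). Types are $A::=\mathbb B\mid A\multimap A\mid A\otimes A$, and $\mathbb B^n$ is the $n$-fold tensor power. Terms, up to renaming of bound variables, are $M,N::=x\mid |b\rangle_l\mid U\mid M\otimes N\mid MN\mid \lambda x.M\mid\lambda\langle x,y\rangle.M$ with $b\in\{0,1\}$ and labels $l\in\mathbb N$; the labels of the bits occurring in a term are pairwise distinct. A linear environment $\Gamma$ is a finite set of assignments $x:A$ to distinct variables; $\Gamma,\Delta$ denotes a disjoint union. The typing rules are: $x:A\vdash x:A$; $\cdot\vdash|b\rangle_l:\mathbb B$; $\cdot\vdash U:\mathbb B^n\multimap\mathbb B^n$; from $\Gamma,x:A\vdash M:B$ infer $\Gamma\vdash\lambda x.M:A\multimap B$; from $\Gamma,x:A,y:B\vdash M:C$ infer $\Gamma\vdash\lambda\langle x,y\rangle.M:A\otimes B\multimap C$; from $\Gamma\vdash M:A\multimap B$ and $\Delta\vdash N:A$ infer $\Gamma,\Delta\vdash MN:B$; from $\Gamma\vdash M:A$ and $\Delta\vdash N:B$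 infer $\Gamma,\Delta\vdash M\otimes N:A\otimes B$. **Equational theory.** A superposed term $\mathcal T$ of type $(\Gamma,A)$ is a formal linear combination $\sum_i\kappa_iM_i$ of terms, $\kappa_i\in\mathbb C$, with $\Gamma\vdash M_i:A$ for all $i$; term constructs extend to superposed terms linearly. The judgements $\Gamma\vdash\mathcal T\approx\mathcal S:A$ between superposed terms of type $(\Gamma,A)$ are generated by the axioms $(\lambda x.M)N\approx M\{N/x\}$, $(\lambda\langle x,y\rangle.M)(N\otimes L)\approx M\{N,L/x,y\}$ (for well-typed left-hand sides) and, in the empty environment, $U|b_1\dots b_k\rangle\approx\mathbf U|b_1\dots b_k\rangle$ at type $\mathbb B^k$ (the right-hand side being the vector $\mathbf U|b_1\dots b_k\rangle$ read as a formal combination of the terms $|c_1\rangle\otimes\dots\otimes|c_k\rangle$, with the same labels as on the left); by closure under application to a typed term on either side, under tensoring with a typed term on either side, and under both abstractions; by the rule that $\mathcal T\approx\mathcal S$ implies $\alpha\mathcal T+\mathcal V\approx\alpha\mathcal S+\mathcal V$ for $\alpha\in\mathbb C$ and $\mathcal V$ of the same type; and by reflexivity, symmetry and transitivity. **Machine.**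 Let $\pi$ be a type derivation of $\Gamma\vdash M:A$. An occurrence of $\mathbb B$ inside a type is positive or negative as usual (the polarity flips to the left of $\multimap$). A state consists of a sequence of $n$ occurrences of $\mathbb B$ in the types written in $\pi$ (tokens) and a vector in $\mathbb C^{2^n}$ (register, one qubit per token). A token may move, at each rule instance other than the axioms for bits and gates, between the corresponding occurrences of $\mathbb B$ in its premises and conclusion: positive occurrences in the type of the subject move from premise to conclusion and negative ones from conclusion to premise; in environments positive occurrences move from conclusion to premise and negative ones from premise to conclusion; positive (resp. negative) occurrences in $x:A\vdash x:A$ move from left to right (resp. right to left). In an application, positive (resp. negative) occurrences move from the type $A$ of the argument to the $A$ in the type $A\multimap B$ of the function (resp. back). In an abstraction, positive (resp. negative) occurrences of the abstracted type move from the argument position of the function type in the conclusion to the assignment of the bound variable in the premise (resp. back). At an axiom $\cdot\vdash U:\mathbb B^m\multimap\mathbb B^m$, when tokens stand at all $m$ argument occurrences, they move simultaneously to the corresponding result occurrences and $\mathbf U$ is applied to their qubits. The inputs of $\Gamma\vdash A$ are the occurrences positive in $\Gamma$ or negative in $A$; the outputs are those negative in $\Gamma$ or positive in $A$; let $n$ and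 $m$ be their numbers. The initial state for $\mathbf Q\in\mathbb C^{2^n}$ has tokens at the inputs and at the bit axioms of $\pi$ (ordered by label), and register $\mathbf Q\otimes|b_1\dots b_k\rangle$, where $b_1,\dots,b_k$ are the bits of $\pi$ in that order. A state is final with result $\mathbf R\in\mathbb C^{2^m}$ if its tokens stand at the outputs, one at each, and $\mathbf R$ is its register with the qubits rearranged into the order of the outputs. The function $[\![\pi]\!]$ maps $\mathbf Q$ to $\mathbf R$ if the initial state for $\mathbf Q$ rewrites to a final state with result $\mathbf R$. For $\mathcal T=\sum_i\kappa_iM_i$ of type $(\Gamma,A)$, $[\![\mathcal T]\!](x)=\sum_i\kappa_i[\![\pi_i]\!](x)$, where $\pi_i$ is any derivation of $\Gamma\vdash M_i:A$. **Theorem (Soundness).** If $\Gamma\vdash\mathcal T\approx\mathcal S:A$, then $[\![\mathcal T]\!]=[\![\mathcal S]\!]$; that is, every derivation of every summand of $\mathcal T$ and of $\mathcal S$ computes a single-valued total function $\mathbb C^{2^n}\to\mathbb C^{2^m}$ depending only on that summand (and on $\Gamma,A$), and the resulting functions $[\![\mathcal T]\!]$ and $[\![\mathcal S]\!]$ are equal.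 -/

import Mathlib

namespace QLam

/-! ### Types, gates, terms -/

/-- Types: `A ::= 𝔹 | A ⊸ B | A ⊗ B`. -/
inductive Ty : Type
  | bit : Ty
  | lolli : Ty → Ty → Ty
  | tensor : Ty → Ty → Ty

/-- `Ty.pow k` is the tensor power `𝔹^(k+1) = 𝔹 ⊗ (𝔹 ⊗ (⋯ ⊗ 𝔹))`.  There is no unit type, so the
exponent is always positive. -/
def Ty.pow : ℕ → Ty
  | 0 => .bit
  | k + 1 => .tensor .bit (Ty.pow k)

/-- A family of unitary operators: the symbol `U` stands for the unitary `op U` on `ℂ^(2^n)`,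
where `n = rank U + 1` is the arity of `U`.  The standard basis of `ℂ^(2^n)` is indexed by the
bit strings `Fin n → Bool`.  The arity is positive, because `U` is to have type `𝔹^n ⊸ 𝔹^n`. -/
structure GateSet where
  Sym : Type
  rank : Sym → ℕ
  op : (U : Sym) → Matrix.unitaryGroup (Fin (rank U + 1) → Bool) ℂ

/-- The arity of a gate symbol. -/
abbrev GateSet.arity (G : GateSet) (U : G.Sym) : ℕ := G.rank U + 1

variable {G : GateSet}

/-- Terms up to renaming of bound variables, in de Bruijn form.  `bit b l` is the bit constant
`|b⟩` with label `l`; `lam M` is `λx.M` (`x` has index `0` in `M`); `lamPair M` is `λ⟨x,y⟩.M`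
(`y` has index `0` and `x` has index `1` in `M`). -/
inductive Tm (G : GateSet) : Type
  | var (i : ℕ) : Tm G
  | bit (b : Bool) (l : ℕ) : Tm G
  | gate (U : G.Sym) : Tm G
  | pair (M N : Tm G) : Tm G
  | app (M N : Tm G) : Tm G
  | lam (M : Tm G) : Tm G
  | lamPair (M : Tm G) : Tm G

namespace Tm

/-- The labels of the bit constants of a term, with repetitions. -/
def labels : Tm G → List ℕ
  | var _ => []
  | bit _ l => [l]
  | gate _ => []
  | pair M N => M.labels ++ N.labels
  | app M N => M.labels ++ N.labels
  | lam M => M.labels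
  | lamPair M => M.labels

/-- Extension of a renaming under one binder. -/
def upRen (r : ℕ → ℕ) : ℕ → ℕ
  | 0 => 0
  | i + 1 => r i + 1

/-- Renaming of the free variables. -/
def rename : (ℕ → ℕ) → Tm G → Tm G
  | r, var i => var (r i)
  | _, bit b l => bit b l
  | _, gate U => gate U
  | r, pair M N => pair (rename r M) (rename r N)
  | r, app M N => app (rename r M) (rename r N)
  | r, lam M => lam (rename (upRen r) M)
  | r, lamPair M => lamPair (rename (upRen (upRen r)) M)

/-- Extension of a substitution under one binder. -/
def upSub (s : ℕ → Tm G) : ℕ → Tm G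
  | 0 => var 0
  | i + 1 => rename Nat.succ (s i)

/-- Simultaneous capture-avoiding substitution. -/
def subst : (ℕ → Tm G) → Tm G → Tm G
  | s, var i => s i
  | _, bit b l => bit b l
  | _, gate U => gate U
  | s, pair M N => pair (subst s M) (subst s N)
  | s, app M N => app (subst s M) (subst s N)
  | s, lam M => lam (subst (upSub s) M)
  | s, lamPair M => lamPair (subst (upSub (upSub s)) M)

/-- `M{N/x}`, where `x` is the variable with index `0` of `M`. -/
def subst1 (M N : Tm G) : Tm G :=
  subst (fun i => match i with
    | 0 => N
    | i + 1 => var i) M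

/-- `M{N,L/x,y}`, where `x` has index `1` and `y` has index `0` in `M`. -/
def subst2 (M N L : Tm G) : Tm G :=
  subst (fun i => match i with
    | 0 => L
    | 1 => N
    | i + 2 => var i) M

/-- The term `|b₀ b₁ … b_k⟩ = |b₀⟩ ⊗ (|b₁⟩ ⊗ (⋯ ⊗ |b_k⟩))` with labels `l₀, …, l_k`. -/
def ket : (k : ℕ) → (Fin (k + 1) → Bool) → (Fin (k + 1) → ℕ) → Tm G
  | 0, b, l => bit (b 0) (l 0)
  | k + 1, b, l => pair (bit (b 0) (l 0)) (ket k (Fin.tail b) (Fin.tail l))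

end Tm

/-! ### Linear environments and type derivations -/

/-- A linear environment: entry `i` is `some A` if the environment contains the assignment
`x : A` for the variable `x` with index `i`, and `none` if it does not mention that variable. -/
abbrev Ctx : Type := List (Option Ty)

/-- The environment contains no assignment at all. -/
def Ctx.Void (Γ : Ctx) : Prop := ∀ o ∈ Γ, o = none

/-- `Ctx.Single Γ i A`: the environment `Γ` is the singleton `x : A`, where `x` has index `i`. -/
inductive Ctx.Single : Ctx → ℕ → Ty → Type
  | zero {Γ : Ctx} {A : Ty} (h : Ctx.Void Γ) : Ctx.Single (some A :: Γ) 0 A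
  | succ {Γ : Ctx} {i : ℕ} {A : Ty} (h : Ctx.Single Γ i A) : Ctx.Single (none :: Γ) (i + 1) A

/-- `Ctx.Split Γ Γ₁ Γ₂`: the environments `Γ₁` and `Γ₂` assign types to disjoint sets of variables
and `Γ` is their union `Γ₁, Γ₂`. -/
inductive Ctx.Split : Ctx → Ctx → Ctx → Type
  | nil : Ctx.Split [] [] []
  | skip {Γ Γ₁ Γ₂ : Ctx} : Ctx.Split Γ Γ₁ Γ₂ → Ctx.Split (none :: Γ) (none :: Γ₁) (none :: Γ₂)
  | left {Γ Γ₁ Γ₂ : Ctx} {A : Ty} :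
      Ctx.Split Γ Γ₁ Γ₂ → Ctx.Split (some A :: Γ) (some A :: Γ₁) (none :: Γ₂)
  | right {Γ Γ₁ Γ₂ : Ctx} {A : Ty} :
      Ctx.Split Γ Γ₁ Γ₂ → Ctx.Split (some A :: Γ) (none :: Γ₁) (some A :: Γ₂)

/-- Type derivations `π ▷ Γ ⊢ M : A`. -/
inductive Deriv (G : GateSet) : Ctx → Tm G → Ty → Type
  | var {Γ : Ctx} {i : ℕ} {A : Ty} (h : Ctx.Single Γ i A) : Deriv G Γ (.var i) A
  | bit {Γ : Ctx} {b : Bool} {l : ℕ} (h : Ctx.Void Γ) : Deriv G Γ (.bit b l) .bit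
  | gate {Γ : Ctx} {U : G.Sym} (h : Ctx.Void Γ) :
      Deriv G Γ (.gate U) (.lolli (.pow (G.rank U)) (.pow (G.rank U)))
  | lam {Γ : Ctx} {M : Tm G} {A B : Ty} (π : Deriv G (some A :: Γ) M B) :
      Deriv G Γ (.lam M) (.lolli A B)
  | lamPair {Γ : Ctx} {M : Tm G} {A B C : Ty} (π : Deriv G (some B :: some A :: Γ) M C) :
      Deriv G Γ (.lamPair M) (.lolli (.tensor A B) C)
  | app {Γ Γ₁ Γ₂ : Ctx} {M N : Tm G} {A B : Ty} (h : Ctx.Split Γ Γ₁ Γ₂)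
      (π₁ : Deriv G Γ₁ M (.lolli A B)) (π₂ : Deriv G Γ₂ N A) : Deriv G Γ (.app M N) B
  | pair {Γ Γ₁ Γ₂ : Ctx} {M N : Tm G} {A B : Ty} (h : Ctx.Split Γ Γ₁ Γ₂)
      (π₁ : Deriv G Γ₁ M A) (π₂ : Deriv G Γ₂ N B) : Deriv G Γ (.pair M N) (.tensor A B)

/-- The judgement `Γ ⊢ M : A`: the labels of the bits in `M` are pairwise distinct, and there is a
type derivation. -/
def HasType (Γ : Ctx) (M : Tm G) (A : Ty) : Prop := M.labels.Nodup ∧ Nonempty (Deriv G Γ M A)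

/-! ### Superposed terms and the equational theory -/

/-- Formal sums `∑ κᵢ Mᵢ` of terms with complex coefficients. -/
abbrev Sup (G : GateSet) : Type := Tm G →₀ ℂ

/-- `Γ ⊢ 𝒯 : A`: the formal sum `𝒯` is a superposed term of type `(Γ, A)`. -/
def SupHasType (Γ : Ctx) (T : Sup G) (A : Ty) : Prop := ∀ M ∈ T.support, HasType Γ M A

/-- The linear extension of a term construct to formal sums: `∑ κᵢ Mᵢ ↦ ∑ κᵢ (c Mᵢ)`. -/
noncomputable def Sup.map (c : Tm G → Tm G) (T : Sup G) : Sup G := Finsupp.mapDomain c T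

/-- A term seen as a formal sum. -/
noncomputable def Sup.ofTm (M : Tm G) : Sup G := Finsupp.single M 1

/-- The vector `𝐔|b₀ … b_k⟩`, seen as a formal sum of the terms `|c₀ … c_k⟩` (with the labels of
the bits of the argument). -/
noncomputable def Sup.gateKet (U : G.Sym) (b : Fin (G.arity U) → Bool)
    (l : Fin (G.arity U) → ℕ) : Sup G :=
  ∑ c : Fin (G.arity U) → Bool,
    Finsupp.single (Tm.ket (G.rank U) c l) ((G.op U : Matrix _ _ ℂ) c b)

/-- The equational theory: `EqTh Γ A T S` is the judgement `Γ ⊢ T ≈ S : A`.  In the rules whose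
conclusion is built from two terms, that conclusion has to be an equation between superposed terms
(so the labels of the bits in the two parts must not clash). -/
inductive EqTh : Ctx → Ty → Sup G → Sup G → Prop
  | betaPair {Γ : Ctx} {A : Ty} {M N L : Tm G}
      (h : HasType Γ (.app (.lamPair M) (.pair N L)) A) :
      EqTh Γ A (.ofTm (.app (.lamPair M) (.pair N L))) (.ofTm (M.subst2 N L))
  | beta {Γ : Ctx} {A : Ty} {M N : Tm G} (h : HasType Γ (.app (.lam M) N) A) :
      EqTh Γ A (.ofTm (.app (.lam M) N)) (.ofTm (M.subst1 N))
  | quant {Γ : Ctx} (hΓ : Ctx.Void Γ) {U : G.Sym} {b : Fin (G.arity U) → Bool}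
      {l : Fin (G.arity U) → ℕ}
      (h : HasType Γ (.app (.gate U) (.ket (G.rank U) b l)) (.pow (G.rank U))) :
      EqTh Γ (.pow (G.rank U)) (.ofTm (.app (.gate U) (.ket (G.rank U) b l))) (.gateKet U b l)
  | appLeft {Γ Γ₁ Γ₂ : Ctx} {A B : Ty} {T S : Sup G} {M : Tm G} (s : Ctx.Split Γ Γ₁ Γ₂)
      (h : EqTh Γ₁ (.lolli A B) T S) (hM : HasType Γ₂ M A)
      (hT : SupHasType Γ (T.map (fun X => .app X M)) B)
      (hS : SupHasType Γ (S.map (fun X => .app X M)) B) :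
      EqTh Γ B (T.map (fun X => .app X M)) (S.map (fun X => .app X M))
  | appRight {Γ Γ₁ Γ₂ : Ctx} {A B : Ty} {T S : Sup G} {M : Tm G} (s : Ctx.Split Γ Γ₁ Γ₂)
      (hM : HasType Γ₁ M (.lolli A B)) (h : EqTh Γ₂ A T S)
      (hT : SupHasType Γ (T.map (fun X => .app M X)) B)
      (hS : SupHasType Γ (S.map (fun X => .app M X)) B) :
      EqTh Γ B (T.map (fun X => .app M X)) (S.map (fun X => .app M X))
  | lam {Γ : Ctx} {A B : Ty} {T S : Sup G} (h : EqTh (some A :: Γ) B T S) :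
      EqTh Γ (.lolli A B) (T.map .lam) (S.map .lam)
  | lamPair {Γ : Ctx} {A B C : Ty} {T S : Sup G} (h : EqTh (some B :: some A :: Γ) C T S) :
      EqTh Γ (.lolli (.tensor A B) C) (T.map .lamPair) (S.map .lamPair)
  | pairLeft {Γ Γ₁ Γ₂ : Ctx} {A B : Ty} {T S : Sup G} {M : Tm G} (s : Ctx.Split Γ Γ₁ Γ₂)
      (h : EqTh Γ₁ A T S) (hM : HasType Γ₂ M B)
      (hT : SupHasType Γ (T.map (fun X => .pair X M)) (.tensor A B))
      (hS : SupHasType Γ (S.map (fun X => .pair X M)) (.tensor A B)) :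
      EqTh Γ (.tensor A B) (T.map (fun X => .pair X M)) (S.map (fun X => .pair X M))
  | pairRight {Γ Γ₁ Γ₂ : Ctx} {A B : Ty} {T S : Sup G} {M : Tm G} (s : Ctx.Split Γ Γ₁ Γ₂)
      (hM : HasType Γ₁ M A) (h : EqTh Γ₂ B T S)
      (hT : SupHasType Γ (T.map (fun X => .pair M X)) (.tensor A B))
      (hS : SupHasType Γ (S.map (fun X => .pair M X)) (.tensor A B)) :
      EqTh Γ (.tensor A B) (T.map (fun X => .pair M X)) (S.map (fun X => .pair M X))
  | sum {Γ : Ctx} {A : Ty} {T S V : Sup G} (α : ℂ) (h : EqTh Γ A T S)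
      (hV : SupHasType Γ V A) : EqTh Γ A (α • T + V) (α • S + V)
  | refl {Γ : Ctx} {A : Ty} {T : Sup G} (h : SupHasType Γ T A) : EqTh Γ A T T
  | symm {Γ : Ctx} {A : Ty} {T S : Sup G} (h : EqTh Γ A T S) : EqTh Γ A S T
  | trans {Γ : Ctx} {A : Ty} {T S V : Sup G} (h₁ : EqTh Γ A T S) (h₂ : EqTh Γ A S V) :
      EqTh Γ A T V

/-! ### Occurrences of the type of bits -/

/-- `Occ s A`: the positive (`s = true`) or negative (`s = false`) occurrences of `𝔹` in the type
`A`, that is, the contexts `C` of that polarity with `C[𝔹] = A`. -/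
inductive Occ : Bool → Ty → Type
  | hole : Occ true .bit
  | fst {s : Bool} {A B : Ty} (o : Occ s A) : Occ s (.tensor A B)
  | snd {s : Bool} {A B : Ty} (o : Occ s B) : Occ s (.tensor A B)
  | arg {s : Bool} {A B : Ty} (o : Occ (!s) A) : Occ s (.lolli A B)
  | res {s : Bool} {A B : Ty} (o : Occ s B) : Occ s (.lolli A B)

/-- The sequence of positive (`s = true`) or negative (`s = false`) occurrences in a type. -/
def occs : (s : Bool) → (A : Ty) → List (Occ s A)
  | true, .bit => [.hole]
  | false, .bit => []
  | s, .tensor A B => (occs s A).map .fst ++ (occs s B).map .snd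
  | s, .lolli A B => (occs (!s) A).map .arg ++ (occs s B).map .res

/-- Occurrences of `𝔹` in the types of an environment; `s` is the polarity inside the type. -/
inductive CtxOcc (s : Bool) : Ctx → Type
  | here {A : Ty} {Γ : Ctx} (o : Occ s A) : CtxOcc s (some A :: Γ)
  | there {a : Option Ty} {Γ : Ctx} (v : CtxOcc s Γ) : CtxOcc s (a :: Γ)

/-- The sequence of occurrences of polarity `s` in the types of an environment. -/
def ctxOccs (s : Bool) : (Γ : Ctx) → List (CtxOcc s Γ)
  | [] => []
  | none :: Γ => (ctxOccs s Γ).map .there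
  | some A :: Γ => (occs s A).map .here ++ (ctxOccs s Γ).map .there

/-- Occurrences of `𝔹` in a judgement `Γ ⊢ A`. -/
inductive JudgOcc (Γ : Ctx) (A : Ty) : Type
  | ctx {s : Bool} (v : CtxOcc s Γ) : JudgOcc Γ A
  | concl {s : Bool} (o : Occ s A) : JudgOcc Γ A

/-- The negative occurrences of `Γ ⊢ A` (those positive in `Γ` or negative in `A`), where tokens
enter. -/
def inputs (Γ : Ctx) (A : Ty) : List (JudgOcc Γ A) :=
  (ctxOccs true Γ).map .ctx ++ (occs false A).map .concl

/-- The positive occurrences of `Γ ⊢ A` (those negative in `Γ` or positive in `A`), where tokens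
leave. -/
def outputs (Γ : Ctx) (A : Ty) : List (JudgOcc Γ A) :=
  (ctxOccs false Γ).map .ctx ++ (occs true A).map .concl

/-- The input arity of a derivation of `Γ ⊢ M : A`. -/
def inArity (Γ : Ctx) (A : Ty) : ℕ := (inputs Γ A).length

/-- The output arity of a derivation of `Γ ⊢ M : A`. -/
def outArity (Γ : Ctx) (A : Ty) : ℕ := (outputs Γ A).length

/-- The occurrence in a singleton environment `x : A` given by an occurrence in `A`. -/
def Ctx.Single.occ {s : Bool} : {Γ : Ctx} → {i : ℕ} → {A : Ty} →
    Ctx.Single Γ i A → Occ s A → CtxOcc s Γ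
  | _, _, _, .zero _, o => .here o
  | _, _, _, .succ h, o => .there (h.occ o)

/-- An occurrence in `Γ₁` seen in the union `Γ₁, Γ₂`. -/
def Ctx.Split.inl {s : Bool} : {Γ Γ₁ Γ₂ : Ctx} →
    Ctx.Split Γ Γ₁ Γ₂ → CtxOcc s Γ₁ → CtxOcc s Γ
  | _, _, _, .skip h, .there v => .there (h.inl v)
  | _, _, _, .left _, .here o => .here o
  | _, _, _, .left h, .there v => .there (h.inl v)
  | _, _, _, .right h, .there v => .there (h.inl v)

/-- An occurrence in `Γ₂` seen in the union `Γ₁, Γ₂`. -/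
def Ctx.Split.inr {s : Bool} : {Γ Γ₁ Γ₂ : Ctx} →
    Ctx.Split Γ Γ₁ Γ₂ → CtxOcc s Γ₂ → CtxOcc s Γ
  | _, _, _, .skip h, .there v => .there (h.inr v)
  | _, _, _, .left h, .there v => .there (h.inr v)
  | _, _, _, .right _, .here o => .here o
  | _, _, _, .right h, .there v => .there (h.inr v)

/-- The `k`-th occurrence of `𝔹` in a tensor power of `𝔹`. -/
def powOcc : (n : ℕ) → Fin (n + 1) → Occ true (Ty.pow n)
  | 0, _ => .hole
  | n + 1, k => Fin.cases (.fst .hole) (fun j => .snd (powOcc n j)) k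

/-- Occurrences of `𝔹` in a type derivation: an occurrence in the concluding judgement, or an
occurrence in one of the subderivations. -/
inductive Place : {Γ : Ctx} → {M : Tm G} → {A : Ty} → Deriv G Γ M A → Type
  | root {Γ : Ctx} {M : Tm G} {A : Ty} {π : Deriv G Γ M A} (o : JudgOcc Γ A) : Place π
  | lam {Γ : Ctx} {M : Tm G} {A B : Ty} {π : Deriv G (some A :: Γ) M B} (p : Place π) :
      Place (Deriv.lam π)
  | lamPair {Γ : Ctx} {M : Tm G} {A B C : Ty} {π : Deriv G (some B :: some A :: Γ) M C}
      (p : Place π) : Place (Deriv.lamPair π)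
  | appL {Γ Γ₁ Γ₂ : Ctx} {M N : Tm G} {A B : Ty} {h : Ctx.Split Γ Γ₁ Γ₂}
      {π₁ : Deriv G Γ₁ M (.lolli A B)} {π₂ : Deriv G Γ₂ N A} (p : Place π₁) :
      Place (Deriv.app h π₁ π₂)
  | appR {Γ Γ₁ Γ₂ : Ctx} {M N : Tm G} {A B : Ty} {h : Ctx.Split Γ Γ₁ Γ₂}
      {π₁ : Deriv G Γ₁ M (.lolli A B)} {π₂ : Deriv G Γ₂ N A} (p : Place π₂) :
      Place (Deriv.app h π₁ π₂)
  | pairL {Γ Γ₁ Γ₂ : Ctx} {M N : Tm G} {A B : Ty} {h : Ctx.Split Γ Γ₁ Γ₂}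
      {π₁ : Deriv G Γ₁ M A} {π₂ : Deriv G Γ₂ N B} (p : Place π₁) :
      Place (Deriv.pair h π₁ π₂)
  | pairR {Γ Γ₁ Γ₂ : Ctx} {M N : Tm G} {A B : Ty} {h : Ctx.Split Γ Γ₁ Γ₂}
      {π₁ : Deriv G Γ₁ M A} {π₂ : Deriv G Γ₂ N B} (p : Place π₂) :
      Place (Deriv.pair h π₁ π₂)

/-- The concluding judgement of a derivation: occurrences in its environment. -/
abbrev Place.atCtx {Γ : Ctx} {M : Tm G} {A : Ty} {π : Deriv G Γ M A} {s : Bool}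
    (v : CtxOcc s Γ) : Place π := .root (.ctx v)

/-- The concluding judgement of a derivation: occurrences in its type. -/
abbrev Place.atType {Γ : Ctx} {M : Tm G} {A : Ty} {π : Deriv G Γ M A} (s : Bool)
    (o : Occ s A) : Place π := .root (.concl o)

/-! ### The multi-token machine -/

/-- The moves of a single token in a derivation (all transition rules except that of gates). -/
inductive Move : {Γ : Ctx} → {M : Tm G} → {A : Ty} → {π : Deriv G Γ M A} →
    Place π → Place π → Prop
  -- axiom for variables
  | varPos {Γ : Ctx} {i : ℕ} {A : Ty} {h : Ctx.Single Γ i A} (o : Occ true A) :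
      Move (π := .var h) (.atCtx (h.occ o)) (.atType true o)
  | varNeg {Γ : Ctx} {i : ℕ} {A : Ty} {h : Ctx.Single Γ i A} (o : Occ false A) :
      Move (π := .var h) (.atType false o) (.atCtx (h.occ o))
  -- abstraction over a variable
  | lamArgNeg {Γ : Ctx} {M : Tm G} {A B : Ty} {π : Deriv G (some A :: Γ) M B}
      (o : Occ false A) :
      Move (π := .lam π) (.lam (.atCtx (.here o))) (.atType true (.arg o))
  | lamArgPos {Γ : Ctx} {M : Tm G} {A B : Ty} {π : Deriv G (some A :: Γ) M B}
      (o : Occ true A) :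
      Move (π := .lam π) (.atType false (.arg o)) (.lam (.atCtx (.here o)))
  | lamResPos {Γ : Ctx} {M : Tm G} {A B : Ty} {π : Deriv G (some A :: Γ) M B}
      (o : Occ true B) :
      Move (π := .lam π) (.lam (.atType true o)) (.atType true (.res o))
  | lamResNeg {Γ : Ctx} {M : Tm G} {A B : Ty} {π : Deriv G (some A :: Γ) M B}
      (o : Occ false B) :
      Move (π := .lam π) (.atType false (.res o)) (.lam (.atType false o))
  | lamCtxPos {Γ : Ctx} {M : Tm G} {A B : Ty} {π : Deriv G (some A :: Γ) M B}
      (v : CtxOcc true Γ) :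
      Move (π := .lam π) (.atCtx v) (.lam (.atCtx (.there v)))
  | lamCtxNeg {Γ : Ctx} {M : Tm G} {A B : Ty} {π : Deriv G (some A :: Γ) M B}
      (v : CtxOcc false Γ) :
      Move (π := .lam π) (.lam (.atCtx (.there v))) (.atCtx v)
  -- abstraction over a pair; in the premise, the second component comes first in the environment
  | lamPairFstNeg {Γ : Ctx} {M : Tm G} {A B C : Ty} {π : Deriv G (some B :: some A :: Γ) M C}
      (o : Occ false A) :
      Move (π := .lamPair π) (.lamPair (.atCtx (.there (.here o))))
        (.atType true (.arg (.fst o)))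
  | lamPairFstPos {Γ : Ctx} {M : Tm G} {A B C : Ty} {π : Deriv G (some B :: some A :: Γ) M C}
      (o : Occ true A) :
      Move (π := .lamPair π) (.atType false (.arg (.fst o)))
        (.lamPair (.atCtx (.there (.here o))))
  | lamPairSndNeg {Γ : Ctx} {M : Tm G} {A B C : Ty} {π : Deriv G (some B :: some A :: Γ) M C}
      (o : Occ false B) :
      Move (π := .lamPair π) (.lamPair (.atCtx (.here o))) (.atType true (.arg (.snd o)))
  | lamPairSndPos {Γ : Ctx} {M : Tm G} {A B C : Ty} {π : Deriv G (some B :: some A :: Γ) M C}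
      (o : Occ true B) :
      Move (π := .lamPair π) (.atType false (.arg (.snd o))) (.lamPair (.atCtx (.here o)))
  | lamPairResPos {Γ : Ctx} {M : Tm G} {A B C : Ty} {π : Deriv G (some B :: some A :: Γ) M C}
      (o : Occ true C) :
      Move (π := .lamPair π) (.lamPair (.atType true o)) (.atType true (.res o))
  | lamPairResNeg {Γ : Ctx} {M : Tm G} {A B C : Ty} {π : Deriv G (some B :: some A :: Γ) M C}
      (o : Occ false C) :
      Move (π := .lamPair π) (.atType false (.res o)) (.lamPair (.atType false o))
  | lamPairCtxPos {Γ : Ctx} {M : Tm G} {A B C : Ty} {π : Deriv G (some B :: some A :: Γ) M C}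
      (v : CtxOcc true Γ) :
      Move (π := .lamPair π) (.atCtx v) (.lamPair (.atCtx (.there (.there v))))
  | lamPairCtxNeg {Γ : Ctx} {M : Tm G} {A B C : Ty} {π : Deriv G (some B :: some A :: Γ) M C}
      (v : CtxOcc false Γ) :
      Move (π := .lamPair π) (.lamPair (.atCtx (.there (.there v)))) (.atCtx v)
  -- application
  | appArgPos {Γ Γ₁ Γ₂ : Ctx} {M N : Tm G} {A B : Ty} {h : Ctx.Split Γ Γ₁ Γ₂}
      {π₁ : Deriv G Γ₁ M (.lolli A B)} {π₂ : Deriv G Γ₂ N A} (o : Occ true A) :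
      Move (π := .app h π₁ π₂) (.appR (.atType true o)) (.appL (.atType false (.arg o)))
  | appArgNeg {Γ Γ₁ Γ₂ : Ctx} {M N : Tm G} {A B : Ty} {h : Ctx.Split Γ Γ₁ Γ₂}
      {π₁ : Deriv G Γ₁ M (.lolli A B)} {π₂ : Deriv G Γ₂ N A} (o : Occ false A) :
      Move (π := .app h π₁ π₂) (.appL (.atType true (.arg o))) (.appR (.atType false o))
  | appResPos {Γ Γ₁ Γ₂ : Ctx} {M N : Tm G} {A B : Ty} {h : Ctx.Split Γ Γ₁ Γ₂}
      {π₁ : Deriv G Γ₁ M (.lolli A B)} {π₂ : Deriv G Γ₂ N A} (o : Occ true B) :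
      Move (π := .app h π₁ π₂) (.appL (.atType true (.res o))) (.atType true o)
  | appResNeg {Γ Γ₁ Γ₂ : Ctx} {M N : Tm G} {A B : Ty} {h : Ctx.Split Γ Γ₁ Γ₂}
      {π₁ : Deriv G Γ₁ M (.lolli A B)} {π₂ : Deriv G Γ₂ N A} (o : Occ false B) :
      Move (π := .app h π₁ π₂) (.atType false o) (.appL (.atType false (.res o)))
  | appCtxLPos {Γ Γ₁ Γ₂ : Ctx} {M N : Tm G} {A B : Ty} {h : Ctx.Split Γ Γ₁ Γ₂}
      {π₁ : Deriv G Γ₁ M (.lolli A B)} {π₂ : Deriv G Γ₂ N A} (v : CtxOcc true Γ₁) :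
      Move (π := .app h π₁ π₂) (.atCtx (h.inl v)) (.appL (.atCtx v))
  | appCtxLNeg {Γ Γ₁ Γ₂ : Ctx} {M N : Tm G} {A B : Ty} {h : Ctx.Split Γ Γ₁ Γ₂}
      {π₁ : Deriv G Γ₁ M (.lolli A B)} {π₂ : Deriv G Γ₂ N A} (v : CtxOcc false Γ₁) :
      Move (π := .app h π₁ π₂) (.appL (.atCtx v)) (.atCtx (h.inl v))
  | appCtxRPos {Γ Γ₁ Γ₂ : Ctx} {M N : Tm G} {A B : Ty} {h : Ctx.Split Γ Γ₁ Γ₂}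
      {π₁ : Deriv G Γ₁ M (.lolli A B)} {π₂ : Deriv G Γ₂ N A} (v : CtxOcc true Γ₂) :
      Move (π := .app h π₁ π₂) (.atCtx (h.inr v)) (.appR (.atCtx v))
  | appCtxRNeg {Γ Γ₁ Γ₂ : Ctx} {M N : Tm G} {A B : Ty} {h : Ctx.Split Γ Γ₁ Γ₂}
      {π₁ : Deriv G Γ₁ M (.lolli A B)} {π₂ : Deriv G Γ₂ N A} (v : CtxOcc false Γ₂) :
      Move (π := .app h π₁ π₂) (.appR (.atCtx v)) (.atCtx (h.inr v))
  -- pairs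
  | pairFstNeg {Γ Γ₁ Γ₂ : Ctx} {M N : Tm G} {A B : Ty} {h : Ctx.Split Γ Γ₁ Γ₂}
      {π₁ : Deriv G Γ₁ M A} {π₂ : Deriv G Γ₂ N B} (o : Occ false A) :
      Move (π := .pair h π₁ π₂) (.atType false (.fst o)) (.pairL (.atType false o))
  | pairFstPos {Γ Γ₁ Γ₂ : Ctx} {M N : Tm G} {A B : Ty} {h : Ctx.Split Γ Γ₁ Γ₂}
      {π₁ : Deriv G Γ₁ M A} {π₂ : Deriv G Γ₂ N B} (o : Occ true A) :
      Move (π := .pair h π₁ π₂) (.pairL (.atType true o)) (.atType true (.fst o))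
  | pairSndNeg {Γ Γ₁ Γ₂ : Ctx} {M N : Tm G} {A B : Ty} {h : Ctx.Split Γ Γ₁ Γ₂}
      {π₁ : Deriv G Γ₁ M A} {π₂ : Deriv G Γ₂ N B} (o : Occ false B) :
      Move (π := .pair h π₁ π₂) (.atType false (.snd o)) (.pairR (.atType false o))
  | pairSndPos {Γ Γ₁ Γ₂ : Ctx} {M N : Tm G} {A B : Ty} {h : Ctx.Split Γ Γ₁ Γ₂}
      {π₁ : Deriv G Γ₁ M A} {π₂ : Deriv G Γ₂ N B} (o : Occ true B) :
      Move (π := .pair h π₁ π₂) (.pairR (.atType true o)) (.atType true (.snd o))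
  | pairCtxLPos {Γ Γ₁ Γ₂ : Ctx} {M N : Tm G} {A B : Ty} {h : Ctx.Split Γ Γ₁ Γ₂}
      {π₁ : Deriv G Γ₁ M A} {π₂ : Deriv G Γ₂ N B} (v : CtxOcc true Γ₁) :
      Move (π := .pair h π₁ π₂) (.atCtx (h.inl v)) (.pairL (.atCtx v))
  | pairCtxLNeg {Γ Γ₁ Γ₂ : Ctx} {M N : Tm G} {A B : Ty} {h : Ctx.Split Γ Γ₁ Γ₂}
      {π₁ : Deriv G Γ₁ M A} {π₂ : Deriv G Γ₂ N B} (v : CtxOcc false Γ₁) :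
      Move (π := .pair h π₁ π₂) (.pairL (.atCtx v)) (.atCtx (h.inl v))
  | pairCtxRPos {Γ Γ₁ Γ₂ : Ctx} {M N : Tm G} {A B : Ty} {h : Ctx.Split Γ Γ₁ Γ₂}
      {π₁ : Deriv G Γ₁ M A} {π₂ : Deriv G Γ₂ N B} (v : CtxOcc true Γ₂) :
      Move (π := .pair h π₁ π₂) (.atCtx (h.inr v)) (.pairR (.atCtx v))
  | pairCtxRNeg {Γ Γ₁ Γ₂ : Ctx} {M N : Tm G} {A B : Ty} {h : Ctx.Split Γ Γ₁ Γ₂}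
      {π₁ : Deriv G Γ₁ M A} {π₂ : Deriv G Γ₂ N B} (v : CtxOcc false Γ₂) :
      Move (π := .pair h π₁ π₂) (.pairR (.atCtx v)) (.atCtx (h.inr v))
  -- moves inside the subderivations
  | inLam {Γ : Ctx} {M : Tm G} {A B : Ty} {π : Deriv G (some A :: Γ) M B} {p q : Place π}
      (h : Move p q) : Move (π := .lam π) (.lam p) (.lam q)
  | inLamPair {Γ : Ctx} {M : Tm G} {A B C : Ty} {π : Deriv G (some B :: some A :: Γ) M C}
      {p q : Place π} (h : Move p q) : Move (π := .lamPair π) (.lamPair p) (.lamPair q)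
  | inAppL {Γ Γ₁ Γ₂ : Ctx} {M N : Tm G} {A B : Ty} {s : Ctx.Split Γ Γ₁ Γ₂}
      {π₁ : Deriv G Γ₁ M (.lolli A B)} {π₂ : Deriv G Γ₂ N A} {p q : Place π₁}
      (h : Move p q) : Move (π := .app s π₁ π₂) (.appL p) (.appL q)
  | inAppR {Γ Γ₁ Γ₂ : Ctx} {M N : Tm G} {A B : Ty} {s : Ctx.Split Γ Γ₁ Γ₂}
      {π₁ : Deriv G Γ₁ M (.lolli A B)} {π₂ : Deriv G Γ₂ N A} {p q : Place π₂}
      (h : Move p q) : Move (π := .app s π₁ π₂) (.appR p) (.appR q)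
  | inPairL {Γ Γ₁ Γ₂ : Ctx} {M N : Tm G} {A B : Ty} {s : Ctx.Split Γ Γ₁ Γ₂}
      {π₁ : Deriv G Γ₁ M A} {π₂ : Deriv G Γ₂ N B} {p q : Place π₁}
      (h : Move p q) : Move (π := .pair s π₁ π₂) (.pairL p) (.pairL q)
  | inPairR {Γ Γ₁ Γ₂ : Ctx} {M N : Tm G} {A B : Ty} {s : Ctx.Split Γ Γ₁ Γ₂}
      {π₁ : Deriv G Γ₁ M A} {π₂ : Deriv G Γ₂ N B} {p q : Place π₂}
      (h : Move p q) : Move (π := .pair s π₁ π₂) (.pairR p) (.pairR q)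

/-- `GateAt U p q`: the derivation contains an axiom for the gate symbol `U`, in the type
`𝔹₁ ⊗ ⋯ ⊗ 𝔹ₘ ⊸ 𝔹ₘ₊₁ ⊗ ⋯ ⊗ 𝔹₂ₘ` of which `p` lists the argument occurrences `𝔹₁, …, 𝔹ₘ`
and `q` lists the result occurrences `𝔹ₘ₊₁, …, 𝔹₂ₘ`. -/
inductive GateAt : {Γ : Ctx} → {M : Tm G} → {A : Ty} → {π : Deriv G Γ M A} → (U : G.Sym) →
    (Fin (G.arity U) → Place π) → (Fin (G.arity U) → Place π) → Prop
  | axiomAt {Γ : Ctx} {U : G.Sym} {h : Ctx.Void Γ} :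
      GateAt (π := .gate h) U (fun k => .atType false (.arg (powOcc (G.rank U) k)))
        (fun k => .atType true (.res (powOcc (G.rank U) k)))
  | inLam {Γ : Ctx} {M : Tm G} {A B : Ty} {π : Deriv G (some A :: Γ) M B} {U : G.Sym}
      {p q : Fin (G.arity U) → Place π} (h : GateAt U p q) :
      GateAt (π := .lam π) U (fun k => .lam (p k)) (fun k => .lam (q k))
  | inLamPair {Γ : Ctx} {M : Tm G} {A B C : Ty} {π : Deriv G (some B :: some A :: Γ) M C}
      {U : G.Sym} {p q : Fin (G.arity U) → Place π} (h : GateAt U p q) :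
      GateAt (π := .lamPair π) U (fun k => .lamPair (p k)) (fun k => .lamPair (q k))
  | inAppL {Γ Γ₁ Γ₂ : Ctx} {M N : Tm G} {A B : Ty} {s : Ctx.Split Γ Γ₁ Γ₂}
      {π₁ : Deriv G Γ₁ M (.lolli A B)} {π₂ : Deriv G Γ₂ N A} {U : G.Sym}
      {p q : Fin (G.arity U) → Place π₁} (h : GateAt U p q) :
      GateAt (π := .app s π₁ π₂) U (fun k => .appL (p k)) (fun k => .appL (q k))
  | inAppR {Γ Γ₁ Γ₂ : Ctx} {M N : Tm G} {A B : Ty} {s : Ctx.Split Γ Γ₁ Γ₂}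
      {π₁ : Deriv G Γ₁ M (.lolli A B)} {π₂ : Deriv G Γ₂ N A} {U : G.Sym}
      {p q : Fin (G.arity U) → Place π₂} (h : GateAt U p q) :
      GateAt (π := .app s π₁ π₂) U (fun k => .appR (p k)) (fun k => .appR (q k))
  | inPairL {Γ Γ₁ Γ₂ : Ctx} {M N : Tm G} {A B : Ty} {s : Ctx.Split Γ Γ₁ Γ₂}
      {π₁ : Deriv G Γ₁ M A} {π₂ : Deriv G Γ₂ N B} {U : G.Sym}
      {p q : Fin (G.arity U) → Place π₁} (h : GateAt U p q) :
      GateAt (π := .pair s π₁ π₂) U (fun k => .pairL (p k)) (fun k => .pairL (q k))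
  | inPairR {Γ Γ₁ Γ₂ : Ctx} {M N : Tm G} {A B : Ty} {s : Ctx.Split Γ Γ₁ Γ₂}
      {π₁ : Deriv G Γ₁ M A} {π₂ : Deriv G Γ₂ N B} {U : G.Sym}
      {p q : Fin (G.arity U) → Place π₂} (h : GateAt U p q) :
      GateAt (π := .pair s π₁ π₂) U (fun k => .pairR (p k)) (fun k => .pairR (q k))

/-- Vectors in `ℂ^(2^n)`, with basis indexed by bit strings of length `n`.  The registers of the
machine range over all vectors and not just over unit vectors, since the function computed by a
derivation has domain `ℂ^(2^n)`; every step acts on the register by a unitary operator. -/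
abbrev Reg (n : ℕ) : Type := (Fin n → Bool) → ℂ

/-- The operator on `n` qubits which acts like `U` on the (pairwise distinct) qubits
`i 0, i 1, …` and leaves the others unchanged. -/
noncomputable def applyAt {m n : ℕ} (U : Matrix (Fin m → Bool) (Fin m → Bool) ℂ)
    (i : Fin m → Fin n) (Q : Reg n) : Reg n :=
  fun b => ∑ c : Fin m → Bool, U (fun k => b (i k)) c * Q (Function.extend i c b)

/-- The states with `n` tokens of the machine of `π`: a sequence of `n` occurrences of `𝔹` in `π`
and a register on `n` qubits. -/
structure State {Γ : Ctx} {M : Tm G} {A : Ty} (π : Deriv G Γ M A) (n : ℕ) where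
  tok : Fin n → Place π
  reg : Reg n

/-- The transition relation of the machine of `π`: either one token moves, or the tokens with the
positions `i 0, i 1, …` in the sequence, which stand at the argument occurrences of a gate, move
together to its result occurrences. -/
inductive Step {Γ : Ctx} {M : Tm G} {A : Ty} (π : Deriv G Γ M A) {n : ℕ} :
    State π n → State π n → Prop
  | move (φ : Fin n → Place π) (Q : Reg n) (j : Fin n) (q : Place π) (h : Move (φ j) q) :
      Step π ⟨φ, Q⟩ ⟨Function.update φ j q, Q⟩
  | gate (φ : Fin n → Place π) (Q : Reg n) (U : G.Sym) (p q : Fin (G.arity U) → Place π)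
      (h : GateAt U p q) (i : Fin (G.arity U) → Fin n) (hi : Function.Injective i)
      (hp : ∀ k, φ (i k) = p k) :
      Step π ⟨φ, Q⟩ ⟨Function.extend i q φ, applyAt (G.op U : Matrix _ _ ℂ) i Q⟩

/-- The bit axioms in a derivation, from left to right: label, value and occurrence of `𝔹`. -/
def bitAxioms : {Γ : Ctx} → {M : Tm G} → {A : Ty} → (π : Deriv G Γ M A) →
    List (ℕ × Bool × Place π)
  | _, _, _, .var _ => []
  | _, _, _, .bit (b := b) (l := l) _ => [(l, b, .atType true .hole)]
  | _, _, _, .gate _ => []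
  | _, _, _, .lam π => (bitAxioms π).map (fun x => (x.1, x.2.1, .lam x.2.2))
  | _, _, _, .lamPair π => (bitAxioms π).map (fun x => (x.1, x.2.1, .lamPair x.2.2))
  | _, _, _, .app _ π₁ π₂ =>
      (bitAxioms π₁).map (fun x => (x.1, x.2.1, .appL x.2.2)) ++
        (bitAxioms π₂).map (fun x => (x.1, x.2.1, .appR x.2.2))
  | _, _, _, .pair _ π₁ π₂ =>
      (bitAxioms π₁).map (fun x => (x.1, x.2.1, .pairL x.2.2)) ++
        (bitAxioms π₂).map (fun x => (x.1, x.2.1, .pairR x.2.2))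

section Computed

variable {Γ : Ctx} {M : Tm G} {A : Ty}

/-- The bit axioms in a derivation, in the order of their labels. -/
def sortedBits (π : Deriv G Γ M A) : List (ℕ × Bool × Place π) :=
  (bitAxioms π).insertionSort (fun x y => x.1 ≤ y.1)

/-- The sequence of the occurrences of `𝔹` introduced by the bit axioms. -/
def bitOcc (π : Deriv G Γ M A) (j : Fin (sortedBits π).length) : Place π :=
  ((sortedBits π).get j).2.2

/-- The corresponding sequence of binary digits. -/
def bitVal (π : Deriv G Γ M A) (j : Fin (sortedBits π).length) : Bool :=
  ((sortedBits π).get j).2.1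

/-- The initial state for `Q`: the tokens stand at the inputs and at the bit axioms, and the
register is the tensor product of `Q` with the basis vector given by the values of the bits. -/
noncomputable def initial (π : Deriv G Γ M A) (Q : Reg (inArity Γ A)) :
    State π (inArity Γ A + (sortedBits π).length) where
  tok := Fin.append (fun j => Place.root ((inputs Γ A).get j)) (bitOcc π)
  reg := fun b => Q (fun j => b (Fin.castAdd _ j)) *
    if (fun j => b (Fin.natAdd _ j)) = bitVal π then 1 else 0

/-- `IsFinal s R`: the tokens of `s` stand at the outputs, each output holding exactly one token,
and `R` is the register of `s` with its qubits rearranged in the order of the outputs. -/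
def IsFinal {π : Deriv G Γ M A} {n : ℕ} (s : State π n) (R : Reg (outArity Γ A)) : Prop :=
  ∃ σ : Fin n ≃ Fin (outArity Γ A),
    (∀ j, s.tok j = Place.root ((outputs Γ A).get (σ j))) ∧
      ∀ c : Fin (outArity Γ A) → Bool, R c = s.reg (fun j => c (σ j))

/-- The graph of the partial function computed by `π`: the initial state for `Q` rewrites into a
final state with result `R`. -/
def Computes (π : Deriv G Γ M A) (Q : Reg (inArity Γ A)) (R : Reg (outArity Γ A)) : Prop :=
  ∃ s, Relation.ReflTransGen (Step π) (initial π Q) s ∧ IsFinal s R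

/-- The partial function computed by `π` is single-valued and total, and it equals `f`. -/
def IsFunctionOf (π : Deriv G Γ M A) (f : Reg (inArity Γ A) → Reg (outArity Γ A)) : Prop :=
  ∀ Q R, Computes π Q R ↔ R = f Q

end Computed

/-- `F` is the function `⟦𝒯⟧` computed by the superposed term `𝒯 = ∑ κᵢ Mᵢ` of type `(Γ, A)`:
each summand `Mᵢ` has a derivation of `Γ ⊢ Mᵢ : A`, every such derivation computes the same
total function `f Mᵢ`, and `F x = ∑ κᵢ f Mᵢ x`. -/
def IsSupFunction (Γ : Ctx) (A : Ty) (T : Sup G)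
    (F : Reg (inArity Γ A) → Reg (outArity Γ A)) : Prop :=
  ∃ f : Tm G → Reg (inArity Γ A) → Reg (outArity Γ A),
    (∀ M ∈ T.support, HasType Γ M A ∧ ∀ π : Deriv G Γ M A, IsFunctionOf π (f M)) ∧
      ∀ x, F x = ∑ M ∈ T.support, T M • f M x

/-- A superposed term computes at most one function. -/
theorem IsSupFunction.unique {Γ : Ctx} {A : Ty} {T : Sup G}
    {F F' : Reg (inArity Γ A) → Reg (outArity Γ A)} (h : IsSupFunction Γ A T F)
    (h' : IsSupFunction Γ A T F') : F = F' := by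
  obtain ⟨f, hf, hF⟩ := h
  obtain ⟨f', hf', hF'⟩ := h'
  funext x
  rw [hF, hF']
  refine Finset.sum_congr rfl fun M hM => ?_
  obtain ⟨π⟩ := (hf M hM).1.2
  rw [((hf' M hM).2 π x (f M x)).1 (((hf M hM).2 π x (f M x)).2 rfl)]

end QLam

/-! To each derivation is attached a tensor, `Deriv.den`, whose indices are bits at the occurrences
of 𝔹 in its concluding judgement: a variable is an identity, a bit is a basis vector, a gate is its
matrix, and an application contracts the indices of the argument type. Soundness splits into three
facts: all derivations of a judgement have the same tensor, the equations preserve tensors, and the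
machine computes the linear map given by the tensor.

The first fact (`Deriv.den_eq`) is not a plain induction, because an application hides the type of
its argument and two derivations may choose it differently. A logical relation between vectors at
possibly different types, defined by agreement on related tests, handles this; on a single type it
reduces to equality. For the second fact (`EqTh.sound`), substitution is composition of tensors
(`Deriv.subst`), which gives both β-rules, and every term construct acts linearly on tensors. Linear
substitution only permutes labels, so they remain distinct.

For the machine, a one-token move is viewed as a gate of arity one with the identity matrix. The
derivation becomes a network in which every place is left, and reached, in exactly one way
(`Deriv.exact`), so tokens never compete. If moreover the network has no cycle, every run can be
completed, and whatever the order of firing, the register is a sum over assignments of bits to the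
places reached (`Net.Inv`, `Net.Good.run_eq`). Summing over the inner places, by induction on the
derivation, yields the tensor (`Deriv.total_eq`).

Gates wait for all their arguments, so a cycle would be a deadlock. An application joins two
networks along an interface crossed in both directions, and acyclicity of the two parts does not
suffice. The required time stamps (`Deriv.exists_ranked`) come from a second orthogonality argument:
types are interpreted by sets of timings of their occurrences, and every derivation meets every test
(`Deriv.exists_realized`). -/

namespace QLam

variable {G : GateSet}

/-! ### Assignments to occurrences and the tensor semantics -/

/-- Assignments of elements of `D` to the occurrences of `𝔹` in a type. -/
def V (D : Type) : Ty → Type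
  | .bit => D
  | .lolli A B => V D A × V D B
  | .tensor A B => V D A × V D B

/-- Assignments of elements of `D` to the occurrences of `𝔹` in an environment. -/
def VC (D : Type) : Ctx → Type
  | [] => Unit
  | none :: Γ => VC D Γ
  | some A :: Γ => V D A × VC D Γ

instance V.fintype (D : Type) [Fintype D] : (A : Ty) → Fintype (V D A)
  | .bit => inferInstanceAs (Fintype D)
  | .lolli A B => @instFintypeProd _ _ (V.fintype D A) (V.fintype D B)
  | .tensor A B => @instFintypeProd _ _ (V.fintype D A) (V.fintype D B)

instance VC.fintype (D : Type) [Fintype D] : (Γ : Ctx) → Fintype (VC D Γ)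
  | [] => inferInstanceAs (Fintype Unit)
  | none :: Γ => VC.fintype D Γ
  | some A :: Γ => @instFintypeProd _ _ (V.fintype D A) (VC.fintype D Γ)

open Classical in
/-- The truth value of a proposition as a complex number. -/
noncomputable def ind (p : Prop) : ℂ := if p then 1 else 0

theorem ind_true {p : Prop} (h : p) : ind p = 1 := if_pos h

theorem ind_false {p : Prop} (h : ¬ p) : ind p = 0 := if_neg h

theorem ind_and (p q : Prop) : ind (p ∧ q) = ind p * ind q := by
  by_cases hp : p <;> by_cases hq : q <;> simp [ind, hp, hq]

theorem sum_ind_mul {X : Type} [Fintype X] (a : X) (f : X → ℂ) :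
    ∑ x, ind (a = x) * f x = f a := by
  classical
  simp [ind]

theorem sum_mul_ind {X : Type} [Fintype X] (a : X) (f : X → ℂ) :
    ∑ x, f x * ind (x = a) = f a := by
  classical
  simp [ind]

section Val

variable {D : Type}

def Ctx.Single.val : {Γ : Ctx} → {i : ℕ} → {A : Ty} → Ctx.Single Γ i A → VC D Γ → V D A
  | _, _, _, .zero _, g => g.1
  | _, _, _, .succ h, g => h.val g

def Ctx.Split.fst : {Γ Γ₁ Γ₂ : Ctx} → Ctx.Split Γ Γ₁ Γ₂ → VC D Γ → VC D Γ₁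
  | _, _, _, .nil, _ => ()
  | _, _, _, .skip h, g => h.fst g
  | _, _, _, .left h, g => (g.1, h.fst g.2)
  | _, _, _, .right h, g => h.fst g.2

def Ctx.Split.snd : {Γ Γ₁ Γ₂ : Ctx} → Ctx.Split Γ Γ₁ Γ₂ → VC D Γ → VC D Γ₂
  | _, _, _, .nil, _ => ()
  | _, _, _, .skip h, g => h.snd g
  | _, _, _, .left h, g => h.snd g.2
  | _, _, _, .right h, g => (g.1, h.snd g.2)

def Ctx.Split.join : {Γ Γ₁ Γ₂ : Ctx} → Ctx.Split Γ Γ₁ Γ₂ → VC D Γ₁ → VC D Γ₂ → VC D Γ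
  | _, _, _, .nil, _, _ => ()
  | _, _, _, .skip h, g, g' => h.join g g'
  | _, _, _, .left h, g, g' => (g.1, h.join g.2 g')
  | _, _, _, .right h, g, g' => (g'.1, h.join g g'.2)

theorem Ctx.Split.fst_join {Γ Γ₁ Γ₂ : Ctx} (s : Ctx.Split Γ Γ₁ Γ₂) :
    ∀ (g : VC D Γ₁) (g' : VC D Γ₂), s.fst (s.join g g') = g := by
  induction s with
  | nil => intro g g'; rfl
  | skip h ih => intro g g'; exact ih g g'
  | left h ih => intro g g'; exact Prod.ext rfl (ih g.2 g')
  | right h ih => intro g g'; exact ih g g'.2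

theorem Ctx.Split.snd_join {Γ Γ₁ Γ₂ : Ctx} (s : Ctx.Split Γ Γ₁ Γ₂) :
    ∀ (g : VC D Γ₁) (g' : VC D Γ₂), s.snd (s.join g g') = g' := by
  induction s with
  | nil => intro g g'; rfl
  | skip h ih => intro g g'; exact ih g g'
  | left h ih => intro g g'; exact ih g.2 g'
  | right h ih => intro g g'; exact Prod.ext rfl (ih g g'.2)

theorem Ctx.Split.join_fst_snd {Γ Γ₁ Γ₂ : Ctx} (s : Ctx.Split Γ Γ₁ Γ₂) :
    ∀ g : VC D Γ, s.join (s.fst g) (s.snd g) = g := by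
  induction s with
  | nil => intro g; rfl
  | skip h ih => intro g; exact ih g
  | left h ih => intro g; exact Prod.ext rfl (ih g.2)
  | right h ih => intro g; exact Prod.ext rfl (ih g.2)

def Ctx.Split.equiv {Γ Γ₁ Γ₂ : Ctx} (s : Ctx.Split Γ Γ₁ Γ₂) : VC D Γ ≃ VC D Γ₁ × VC D Γ₂ where
  toFun g := (s.fst g, s.snd g)
  invFun p := s.join p.1 p.2
  left_inv g := s.join_fst_snd g
  right_inv _ := Prod.ext (s.fst_join _ _) (s.snd_join _ _)

/-- The components of an assignment to a tensor power of `𝔹`. -/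
def powV : {n : ℕ} → V D (Ty.pow n) → Fin (n + 1) → D
  | 0, x => fun _ => x
  | _ + 1, x => Fin.cons x.1 (powV x.2)

def unpowV : {n : ℕ} → (Fin (n + 1) → D) → V D (Ty.pow n)
  | 0, b => b 0
  | _ + 1, b => (b 0, unpowV (Fin.tail b))

theorem powV_unpowV : ∀ {n : ℕ} (b : Fin (n + 1) → D), powV (unpowV b) = b
  | 0, b => by
      funext i
      obtain rfl : i = 0 := Fin.fin_one_eq_zero i
      rfl
  | n + 1, b => by
      show Fin.cons (b 0) (powV (unpowV (Fin.tail b))) = b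
      rw [powV_unpowV, Fin.cons_self_tail]

theorem unpowV_powV : ∀ {n : ℕ} (x : V D (Ty.pow n)), unpowV (powV x) = x
  | 0, _ => rfl
  | n + 1, x => by
      exact Prod.ext rfl (unpowV_powV (n := n) x.2)

def powEquiv (D : Type) (n : ℕ) : V D (Ty.pow n) ≃ (Fin (n + 1) → D) where
  toFun := powV
  invFun := unpowV
  left_inv := unpowV_powV
  right_inv := powV_unpowV

end Val

theorem Ctx.Split.sum_eq {Γ Γ₁ Γ₂ : Ctx} (s : Ctx.Split Γ Γ₁ Γ₂)
    (f : VC Bool Γ₁ → VC Bool Γ₂ → ℂ) :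
    ∑ g, f (s.fst g) (s.snd g) = ∑ g₁, ∑ g₂, f g₁ g₂ := by
  rw [← Fintype.sum_prod_type' f]
  exact Fintype.sum_equiv s.equiv _ _ fun g => rfl

theorem Ctx.Split.sum_mul {Γ Γ₁ Γ₂ : Ctx} (s : Ctx.Split Γ Γ₁ Γ₂)
    (e₁ f₁ : VC Bool Γ₁ → ℂ) (e₂ f₂ : VC Bool Γ₂ → ℂ) :
    ∑ g, (e₁ (s.fst g) * e₂ (s.snd g)) * (f₁ (s.fst g) * f₂ (s.snd g)) =
      (∑ g, e₁ g * f₁ g) * ∑ g, e₂ g * f₂ g := by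
  rw [s.sum_eq fun g₁ g₂ => (e₁ g₁ * e₂ g₂) * (f₁ g₁ * f₂ g₂), Finset.sum_mul_sum]
  exact Finset.sum_congr rfl fun g₁ _ => Finset.sum_congr rfl fun g₂ _ => by ring

theorem V.sum_lolli {A B : Ty} (f : V Bool (.lolli A B) → ℂ) :
    ∑ x, f x = ∑ a : V Bool A, ∑ b : V Bool B, f (a, b) :=
  Fintype.sum_prod_type (α₁ := V Bool A) (α₂ := V Bool B) f

theorem V.sum_tensor {A B : Ty} (f : V Bool (.tensor A B) → ℂ) :
    ∑ x, f x = ∑ a : V Bool A, ∑ b : V Bool B, f (a, b) :=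
  Fintype.sum_prod_type (α₁ := V Bool A) (α₂ := V Bool B) f

theorem VC.sum_cons {A : Ty} {Γ : Ctx} (f : VC Bool (some A :: Γ) → ℂ) :
    ∑ x, f x = ∑ a : V Bool A, ∑ g : VC Bool Γ, f (a, g) :=
  Fintype.sum_prod_type (α₁ := V Bool A) (α₂ := VC Bool Γ) f

/-- The tensor computed by a derivation. -/
noncomputable def Deriv.den : {Γ : Ctx} → {M : Tm G} → {A : Ty} → Deriv G Γ M A →
    VC Bool Γ → V Bool A → ℂ
  | _, _, _, .var h, g, x => ind (h.val g = x)
  | _, _, _, .bit (b := b) _, _, x => ind (b = x)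
  -- Rows are indexed by the result `x.2` and columns by the argument `x.1`.
  | _, _, _, .gate (U := U) _, _, x => (G.op U : Matrix _ _ ℂ) (powV x.2) (powV x.1)
  | _, _, _, .lam π, g, x => π.den (x.1, g) x.2
  -- The second component of the pair has index 0, so its value heads the environment.
  | _, _, _, .lamPair π, g, x => π.den (x.1.2, (x.1.1, g)) x.2
  | _, _, _, .app (A := A) s π₁ π₂, g, b =>
      ∑ x : V Bool A, π₁.den (s.fst g) (x, b) * π₂.den (s.snd g) x
  | _, _, _, .pair s π₁ π₂, g, x => π₁.den (s.fst g) x.1 * π₂.den (s.snd g) x.2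

/-! ### Independence of the derivation -/

/-- The contraction of a vector with a covector. -/
noncomputable def pairing {X : Type} [Fintype X] (s t : X → ℂ) : ℂ := ∑ a, s a * t a

/-- Pairs of vectors which a relation between covectors cannot tell apart. -/
def Orth {X X' : Type} [Fintype X] [Fintype X'] (T : (X → ℂ) → (X' → ℂ) → Prop)
    (s : X → ℂ) (s' : X' → ℂ) : Prop :=
  ∀ t t', T t t' → pairing s t = pairing s' t'

/-- Related tests at two types.  Types with different heads have no related tests, hence all
vectors on them are related. -/
def TestRel : (A A' : Ty) → (V Bool A → ℂ) → (V Bool A' → ℂ) → Prop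
  | .bit, .bit => fun t t' => t = t'
  | .lolli A B, .lolli A' B' => fun t t' => ∃ s s' u u',
      Orth (TestRel A A') s s' ∧ TestRel B B' u u' ∧
        t = (fun x => s x.1 * u x.2) ∧ t' = (fun x => s' x.1 * u' x.2)
  | .tensor A B, .tensor A' B' => fun t t' => ∀ s s' u u',
      Orth (TestRel A A') s s' → Orth (TestRel B B') u u' →
        pairing (fun x : V Bool (.tensor A B) => s x.1 * u x.2) t =
          pairing (fun x : V Bool (.tensor A' B') => s' x.1 * u' x.2) t'
  | _, _ => fun _ _ => False

/-- Related product vectors on environments of the same shape. -/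
def EnvRel : (Γ Γ' : Ctx) → (VC Bool Γ → ℂ) → (VC Bool Γ' → ℂ) → Prop
  | [], [] => fun e e' => e = (fun _ => 1) ∧ e' = fun _ => 1
  | none :: Γ, none :: Γ' => fun e e' => EnvRel Γ Γ' e e'
  | some A :: Γ, some A' :: Γ' => fun e e' => ∃ s s' u u',
      Orth (TestRel A A') s s' ∧ EnvRel Γ Γ' u u' ∧
        e = (fun x => s x.1 * u x.2) ∧ e' = (fun x => s' x.1 * u' x.2)
  | _, _ => fun _ _ => False

theorem pairing_ind {X : Type} [Fintype X] (s : X → ℂ) (a : X) :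
    pairing s (fun x => ind (x = a)) = s a := sum_mul_ind a s

theorem ind_prod {X Y : Type} (x p : X × Y) :
    ind (x = p) = ind (x.1 = p.1) * ind (x.2 = p.2) := by
  rw [← ind_and, Prod.ext_iff]

/-- On a single type the relation lies between the diagonal on basis covectors and the full
diagonal. The lower bound forces related vectors to be equal entrywise; the upper bound relates each
vector to itself. Each bound at a compound type uses both kinds of consequences at the components,
hence the simultaneous induction. -/
theorem TestRel.refl_aux (A : Ty) :
    (∀ a, TestRel A A (fun x => ind (x = a)) (fun x => ind (x = a))) ∧
      ∀ t t', TestRel A A t t' → t = t' := by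
  have orth : ∀ A : Ty, (∀ t t', TestRel A A t t' → t = t') → ∀ s, Orth (TestRel A A) s s :=
    fun A h s t t' ht => by rw [h t t' ht]
  have orth_eq : ∀ A : Ty, (∀ a, TestRel A A (fun x => ind (x = a)) (fun x => ind (x = a))) →
      ∀ s s', Orth (TestRel A A) s s' → s = s' := fun A h s s' hs => by
    funext a
    rw [← pairing_ind s, ← pairing_ind s', hs _ _ (h a)]
  induction A with
  | bit => exact ⟨fun _ => rfl, fun _ _ h => h⟩
  | lolli A B ihA ihB =>
    refine ⟨fun a => ⟨fun x => ind (x = a.1), _, fun x => ind (x = a.2), _,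
      orth A ihA.2 _, ihB.1 a.2, ?_, ?_⟩, ?_⟩
    · exact funext fun x => ind_prod (X := V Bool A) (Y := V Bool B) x a
    · exact funext fun x => ind_prod (X := V Bool A) (Y := V Bool B) x a
    · rintro t t' ⟨s, s', u, u', hs, hu, rfl, rfl⟩
      rw [orth_eq A ihA.1 s s' hs, ihB.2 _ _ hu]
  | tensor A B ihA ihB =>
    refine ⟨fun a s s' u u' hs hu => ?_, fun t t' h => ?_⟩
    · rw [orth_eq A ihA.1 s s' hs, orth_eq B ihB.1 u u' hu]
    · funext a
      -- Products of basis vectors are related to themselves, and pairing with one of them reads off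
      -- an entry of the test.
      have := h _ _ _ _ (orth A ihA.2 (fun x => ind (x = a.1)))
        (orth B ihB.2 (fun x => ind (x = a.2)))
      have comm : ∀ t : V Bool (.tensor A B) → ℂ,
          pairing (fun x : V Bool (.tensor A B) => ind (x.1 = a.1) * ind (x.2 = a.2)) t = t a :=
          fun t => by
        rw [← pairing_ind t a]
        refine Finset.sum_congr rfl fun x _ => ?_
        exact (mul_comm _ _).trans
          (congrArg (t x * ·) (ind_prod (X := V Bool A) (Y := V Bool B) x a).symm)
      rwa [comm, comm] at this

theorem orth_refl {A : Ty} (s : V Bool A → ℂ) : Orth (TestRel A A) s s :=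
  fun t t' h => by rw [(TestRel.refl_aux A).2 t t' h]

/-- The variables which occur free in a term. -/
def Tm.Free : Tm G → ℕ → Prop
  | .var i, j => i = j
  | .bit _ _, _ => False
  | .gate _, _ => False
  | .pair M N, j => M.Free j ∨ N.Free j
  | .app M N, j => M.Free j ∨ N.Free j
  | .lam M, j => M.Free (j + 1)
  | .lamPair M, j => M.Free (j + 2)

/-- The variable with index `i` is assigned a type. -/
def Ctx.Has (Γ : Ctx) (i : ℕ) : Prop := ∃ A, Γ[i]? = some (some A)

theorem Ctx.Void.not_has {Γ : Ctx} (h : Ctx.Void Γ) (i : ℕ) : ¬ Γ.Has i := by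
  rintro ⟨A, hA⟩
  have := h _ (List.mem_of_getElem? hA)
  simp at this

theorem Ctx.Single.has_iff {Γ : Ctx} {i : ℕ} {A : Ty} (h : Ctx.Single Γ i A) (j : ℕ) :
    Γ.Has j ↔ i = j := by
  induction h generalizing j with
  | zero h =>
    cases j with
    | zero => simp [Ctx.Has]
    | succ j => simpa [Ctx.Has] using h.not_has j
  | succ h ih =>
    cases j with
    | zero => simp [Ctx.Has]
    | succ j => simpa [Ctx.Has] using ih j

theorem Ctx.Split.has_iff {Γ Γ₁ Γ₂ : Ctx} (s : Ctx.Split Γ Γ₁ Γ₂) (j : ℕ) :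
    Γ.Has j ↔ Γ₁.Has j ∨ Γ₂.Has j := by
  induction s generalizing j with
  | nil => simp [Ctx.Has]
  | skip s ih | left s ih | right s ih =>
    cases j with
    | zero => simp [Ctx.Has]
    | succ j => simpa [Ctx.Has] using ih j

theorem Ctx.Split.length_eq {Γ Γ₁ Γ₂ : Ctx} (s : Ctx.Split Γ Γ₁ Γ₂) :
    Γ₁.length = Γ.length ∧ Γ₂.length = Γ.length := by
  induction s with
  | nil => simp
  | skip s ih | left s ih | right s ih => simpa using ih

/-- Linearity: an environment assigns types exactly to the free variables. Hence the term alone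
determines how the environment is divided between the premises, and two derivations of it divide in
the same way. -/
theorem Deriv.has_iff {Γ : Ctx} {M : Tm G} {A : Ty} (π : Deriv G Γ M A) (j : ℕ) :
    Γ.Has j ↔ M.Free j := by
  induction π generalizing j with
  | var h => exact h.has_iff j
  | bit h => simpa [Tm.Free] using h.not_has j
  | gate h => simpa [Tm.Free] using h.not_has j
  | lam π ih => simpa [Tm.Free, Ctx.Has] using ih (j + 1)
  | lamPair π ih => simpa [Tm.Free, Ctx.Has] using ih (j + 2)
  | app s π₁ π₂ ih₁ ih₂ => rw [s.has_iff, ih₁, ih₂]; rfl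
  | pair s π₁ π₂ ih₁ ih₂ => rw [s.has_iff, ih₁, ih₂]; rfl

/-- Environments assigning types to the same variables. -/
def Ctx.SameShape (Γ Γ' : Ctx) : Prop := Γ.length = Γ'.length ∧ ∀ j, Γ.Has j ↔ Γ'.Has j

theorem Ctx.SameShape.tail {o o' : Option Ty} {Γ Γ' : Ctx}
    (h : Ctx.SameShape (o :: Γ) (o' :: Γ')) : Ctx.SameShape Γ Γ' :=
  ⟨by simpa using h.1, fun j => by simpa [Ctx.Has] using h.2 (j + 1)⟩

theorem Ctx.SameShape.head {o o' : Option Ty} {Γ Γ' : Ctx}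
    (h : Ctx.SameShape (o :: Γ) (o' :: Γ')) : (∃ A, o = some A) ↔ ∃ A, o' = some A := by
  simpa [Ctx.Has] using h.2 0

theorem EnvRel.length_eq : ∀ {Γ Γ' : Ctx} {e e'}, EnvRel Γ Γ' e e' → Γ.length = Γ'.length
  | [], [], _, _, _ => rfl
  | none :: _, none :: _, _, _, h => congrArg (· + 1) (EnvRel.length_eq (e := _) (e' := _) h)
  | some _ :: _, some _ :: _, _, _, ⟨_, _, _, _, _, h, _⟩ =>
      congrArg (· + 1) (EnvRel.length_eq h)

/-- A product vector factors along any splitting. The shape hypotheses rule out that a variable goes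
to the left in one splitting and to the right in the other. -/
theorem EnvRel.split {Γ Γ₁ Γ₂ : Ctx} (s : Ctx.Split Γ Γ₁ Γ₂) :
    ∀ {Γ' Γ₁' Γ₂' : Ctx} (s' : Ctx.Split Γ' Γ₁' Γ₂'), Ctx.SameShape Γ₁ Γ₁' →
      Ctx.SameShape Γ₂ Γ₂' → ∀ {e e'}, EnvRel Γ Γ' e e' → ∃ e₁ e₁' e₂ e₂',
        EnvRel Γ₁ Γ₁' e₁ e₁' ∧ EnvRel Γ₂ Γ₂' e₂ e₂' ∧
          e = (fun g => e₁ (s.fst g) * e₂ (s.snd g)) ∧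
          e' = (fun g => e₁' (s'.fst g) * e₂' (s'.snd g)) := by
  induction s with
  | nil =>
    intro _ _ _ s' h₁ h₂ e e' he
    cases s' <;> simp [EnvRel] at he
    exact ⟨_, _, _, _, ⟨rfl, rfl⟩, ⟨rfl, rfl⟩, by simp [he.1], by simp [he.2]⟩
  | skip s ih =>
    intro _ _ _ s' h₁ h₂ e e' he
    cases s' with
    | nil => simp [EnvRel] at he
    | skip s' => exact ih s' h₁.tail h₂.tail he
    | left s' => simp [EnvRel] at he
    | right s' => simp [EnvRel] at he
  | left s ih =>
    intro _ _ _ s' h₁ h₂ e e' he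
    cases s' with
    | nil => simp [EnvRel] at he
    | skip s' => simp [EnvRel] at he
    | right s' => simpa using h₁.head
    | left s' =>
      obtain ⟨v, v', u, u', hv, hu, rfl, rfl⟩ := he
      obtain ⟨e₁, e₁', e₂, e₂', h1, h2, rfl, rfl⟩ := ih s' h₁.tail h₂.tail hu
      exact ⟨_, _, _, _, ⟨v, v', _, _, hv, h1, rfl, rfl⟩, h2,
        funext fun g => (mul_assoc _ _ _).symm, funext fun g => (mul_assoc _ _ _).symm⟩
  | right s ih =>
    intro _ _ _ s' h₁ h₂ e e' he
    cases s' with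
    | nil => simp [EnvRel] at he
    | skip s' => simp [EnvRel] at he
    | left s' => simpa using h₁.head
    | right s' =>
      obtain ⟨v, v', u, u', hv, hu, rfl, rfl⟩ := he
      obtain ⟨e₁, e₁', e₂, e₂', h1, h2, rfl, rfl⟩ := ih s' h₁.tail h₂.tail hu
      exact ⟨_, _, _, _, h1, ⟨v, v', _, _, hv, h2, rfl, rfl⟩,
        funext fun g => mul_left_comm _ _ _, funext fun g => mul_left_comm _ _ _⟩

theorem VC.sum_of_void {Γ : Ctx} (h : Ctx.Void Γ) : ∃ g₀ : VC Bool Γ,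
    (∀ g, g = g₀) ∧ ∀ f : VC Bool Γ → ℂ, ∑ g, f g = f g₀ := by
  induction Γ with
  | nil =>
    refine ⟨(), fun _ => rfl, fun f => ?_⟩
    exact Fintype.sum_unique (ι := Unit) f
  | cons o Γ ih =>
    obtain rfl : o = none := h o (by simp)
    exact ih fun o ho => h o (by simp [ho])

theorem EnvRel.void {Γ : Ctx} : ∀ {Γ' : Ctx}, Ctx.Void Γ → ∀ {e e'}, EnvRel Γ Γ' e e' →
    ∀ g g', e g = 1 ∧ e' g' = 1 := by
  induction Γ with
  | nil =>
    intro Γ' _ e e' he g g'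
    cases Γ' with
    | nil => rw [he.1, he.2]; simp
    | cons o Γ' => simp [EnvRel] at he
  | cons o Γ ih =>
    intro Γ' h e e' he g g'
    obtain rfl : o = none := h o (by simp)
    cases Γ' with
    | nil => simp [EnvRel] at he
    | cons o' Γ' =>
      cases o' with
      | none => exact ih (fun o ho => h o (by simp [ho])) he g g'
      | some A => simp [EnvRel] at he

/-- The environment has one assigned variable, so the remaining factors of the product vector
contribute the scalar 1. -/
theorem EnvRel.single {Γ : Ctx} {i : ℕ} {A : Ty} (h : Ctx.Single Γ i A) :
    ∀ {Γ' : Ctx} {A' : Ty} (h' : Ctx.Single Γ' i A') {e e'}, EnvRel Γ Γ' e e' →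
      ∃ s s', Orth (TestRel A A') s s' ∧
        (∀ t : V Bool A → ℂ, ∑ g, e g * t (h.val g) = pairing s t) ∧
        (∀ t : V Bool A' → ℂ, ∑ g, e' g * t (h'.val g) = pairing s' t) := by
  induction h with
  | zero hv =>
    intro Γ' A' h' e e' he
    cases h' with
    | zero hv' =>
      obtain ⟨s, s', u, u', hs, hu, rfl, rfl⟩ := he
      refine ⟨s, s', hs, fun t => ?_, fun t => ?_⟩
      · obtain ⟨g₀, -, hg⟩ := VC.sum_of_void hv
        obtain ⟨g₁, -, -⟩ := VC.sum_of_void hv'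
        refine (VC.sum_cons _).trans (Finset.sum_congr rfl fun a _ => ?_)
        rw [hg]
        simp [(EnvRel.void hv hu g₀ g₁).1, Ctx.Single.val]
      · obtain ⟨g₀, -, -⟩ := VC.sum_of_void hv
        obtain ⟨g₁, -, hg⟩ := VC.sum_of_void hv'
        refine (VC.sum_cons _).trans (Finset.sum_congr rfl fun a _ => ?_)
        rw [hg]
        simp [(EnvRel.void hv hu g₀ g₁).2, Ctx.Single.val]
  | succ h ih =>
    intro Γ' A' h' e e' he
    cases h' with
    | succ h' => exact ih h' he

/-- Two derivations for the same term cannot be told apart by related environments and tests. -/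
theorem Deriv.den_related {Γ : Ctx} {M : Tm G} {A : Ty} (π : Deriv G Γ M A) :
    ∀ {Γ' : Ctx} {A' : Ty} (π' : Deriv G Γ' M A') {e e'}, EnvRel Γ Γ' e e' →
      Orth (TestRel A A') (fun x => ∑ g, e g * π.den g x)
        (fun x => ∑ g, e' g * π'.den g x) := by
  have swap : ∀ {Γ : Ctx} {A : Ty} (e : VC Bool Γ → ℂ) (d : VC Bool Γ → V Bool A → ℂ)
      (t : V Bool A → ℂ), pairing (fun x => ∑ g, e g * d g x) t =
        ∑ g, e g * ∑ x, d g x * t x := fun e d t => by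
    simp only [pairing, Finset.sum_mul, Finset.mul_sum, mul_assoc]
    exact Finset.sum_comm
  induction π with
  | var h =>
    intro Γ' A' π' e e' he t t' ht
    cases π' with
    | var h' =>
      obtain ⟨s, s', hs, h1, h2⟩ := EnvRel.single h h' he
      have := hs t t' ht
      rw [← h1, ← h2] at this
      rw [swap, swap]
      simpa only [Deriv.den, sum_ind_mul] using this
  | bit hv =>
    intro Γ' A' π' e e' he t t' ht
    cases π' with
    | bit hv' =>
      obtain rfl : t = t' := ht
      obtain ⟨g₀, -, hg⟩ := VC.sum_of_void hv
      obtain ⟨g₁, -, hg'⟩ := VC.sum_of_void hv'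
      simp [pairing, hg, hg', (EnvRel.void hv he g₀ g₁).1, (EnvRel.void hv he g₀ g₁).2,
        Deriv.den]
  | gate hv =>
    intro Γ' A' π' e e' he t t' ht
    cases π' with
    | gate hv' =>
      obtain rfl := (TestRel.refl_aux _).2 t t' ht
      obtain ⟨g₀, -, hg⟩ := VC.sum_of_void hv
      obtain ⟨g₁, -, hg'⟩ := VC.sum_of_void hv'
      simp [pairing, hg, hg', (EnvRel.void hv he g₀ g₁).1, (EnvRel.void hv he g₀ g₁).2,
        Deriv.den]
  | lam π ih =>
    intro Γ' A' π' e e' he t t' ht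
    cases π' with
    | lam π' =>
      obtain ⟨s, s', u, u', hs, hu, rfl, rfl⟩ := ht
      -- A related test at a function type is a vector for the argument together with a test for the
      -- result; the vector extends the environment of the body.
      have := ih π' ⟨s, s', e, e', hs, he, rfl, rfl⟩ u u' hu
      have key : ∀ {Γ : Ctx} {M : Tm G} {A B : Ty} (π : Deriv G (some A :: Γ) M B)
          (e : VC Bool Γ → ℂ) (s : V Bool A → ℂ) (u : V Bool B → ℂ),
          pairing (fun x => ∑ g, e g * π.lam.den g x) (fun x => s x.1 * u x.2) =
            pairing (fun x => ∑ g, (s g.1 * e g.2) * π.den g x) u := fun {Γ M A B} π e s u => by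
        rw [swap, swap, VC.sum_cons, Finset.sum_comm]
        refine Finset.sum_congr rfl fun g _ => ?_
        rw [V.sum_lolli, Finset.mul_sum]
        refine Finset.sum_congr rfl fun a _ => ?_
        simp only [Deriv.den, Finset.mul_sum]
        refine Finset.sum_congr rfl fun b _ => ?_
        ring
      rw [key, key]
      exact this
  | lamPair π ih =>
    intro Γ' A' π' e e' he t t' ht
    cases π' with
    | lamPair π' =>
      obtain ⟨s, s', u, u', hs, hu, rfl, rfl⟩ := ht
      have key : ∀ {Γ : Ctx} {M : Tm G} {A B C : Ty} (π : Deriv G (some B :: some A :: Γ) M C)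
          (e : VC Bool Γ → ℂ) (s : V Bool (.tensor A B) → ℂ) (u : V Bool C → ℂ),
          pairing (fun x => ∑ g, e g * π.lamPair.den g x) (fun x => s x.1 * u x.2) =
            pairing s fun x => ∑ g, e g * ∑ c, π.den (x.2, (x.1, g)) c * u c :=
          fun {Γ M A B C} π e s u => by
        have h : ∀ g, ∑ x, π.lamPair.den g x * (s x.1 * u x.2) =
            ∑ p, ∑ c, π.den (p.2, (p.1, g)) c * (s p * u c) := fun g => V.sum_lolli _
        refine (swap _ _ _).trans ((Finset.sum_congr rfl fun g _ =>
          congrArg (e g * ·) (h g)).trans ?_)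
        simp only [pairing, Finset.mul_sum]
        refine Finset.sum_comm.trans (Finset.sum_congr rfl fun p _ =>
          Finset.sum_congr rfl fun g _ => Finset.sum_congr rfl fun c _ => ?_)
        ring
      have key' : ∀ {Γ : Ctx} {M : Tm G} {A B C : Ty} (π : Deriv G (some B :: some A :: Γ) M C)
          (e : VC Bool Γ → ℂ) (s : V Bool A → ℂ) (v : V Bool B → ℂ) (u : V Bool C → ℂ),
          pairing (fun x : V Bool (.tensor A B) => s x.1 * v x.2)
            (fun x => ∑ g, e g * ∑ c, π.den (x.2, (x.1, g)) c * u c) =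
          pairing (fun x => ∑ g, (v g.1 * (s g.2.1 * e g.2.2)) * π.den g x) u :=
          fun {Γ M A B C} π e s v u => by
        rw [swap, VC.sum_cons, Finset.sum_congr rfl fun b _ => VC.sum_cons _, pairing,
          V.sum_tensor, Finset.sum_comm]
        refine Finset.sum_congr rfl fun b _ => Finset.sum_congr rfl fun a _ => ?_
        rw [Finset.mul_sum]
        refine Finset.sum_congr rfl fun g _ => ?_
        ring
      rw [key, key]
      -- The vector `s` need not be a product, so it cannot be placed in the environment of the
      -- body. Instead the body, contracted with `e` and `u`, is shown to be a related test on the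
      -- tensor type, and this only involves product vectors.
      refine hs _ _ fun s₁ s₁' s₂ s₂' h₁ h₂ => ?_
      rw [key', key']
      exact ih π' ⟨s₂, s₂', _, _, h₂, ⟨s₁, s₁', e, e', h₁, he, rfl, rfl⟩, rfl, rfl⟩ u u' hu
  | app s π₁ π₂ ih₁ ih₂ =>
    intro Γ' A' π' e e' he t t' ht
    cases π' with
    | app s' π₁' π₂' =>
      obtain ⟨e₁, e₁', e₂, e₂', h₁, h₂, rfl, rfl⟩ := EnvRel.split s s'
        ⟨by rw [s.length_eq.1, s'.length_eq.1]; exact he.length_eq,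
          fun j => by rw [π₁.has_iff, π₁'.has_iff]⟩
        ⟨by rw [s.length_eq.2, s'.length_eq.2]; exact he.length_eq,
          fun j => by rw [π₂.has_iff, π₂'.has_iff]⟩ he
      have key : ∀ {Γ Γ₁ Γ₂ : Ctx} {M N : Tm G} {A B : Ty} (s : Ctx.Split Γ Γ₁ Γ₂)
          (π₁ : Deriv G Γ₁ M (.lolli A B)) (π₂ : Deriv G Γ₂ N A)
          (e₁ : VC Bool Γ₁ → ℂ) (e₂ : VC Bool Γ₂ → ℂ) (u : V Bool B → ℂ),
          pairing (fun x => ∑ g, (e₁ (s.fst g) * e₂ (s.snd g)) * (Deriv.app s π₁ π₂).den g x) u =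
          pairing (fun x => ∑ g, e₁ g * π₁.den g x)
            (fun x => (∑ g, e₂ g * π₂.den g x.1) * u x.2) :=
          fun {Γ Γ₁ Γ₂ M N A B} s π₁ π₂ e₁ e₂ u => by
        rw [swap, swap]
        refine (s.sum_eq fun g₁ g₂ => (e₁ g₁ * e₂ g₂) * ∑ b, (∑ x, π₁.den g₁ (x, b) *
          π₂.den g₂ x) * u b).trans ?_
        refine Finset.sum_congr rfl fun g₁ _ => ?_
        rw [V.sum_lolli]
        simp only [Finset.mul_sum, Finset.sum_mul]
        refine (Finset.sum_congr rfl fun g₂ _ => Finset.sum_comm).trans (Finset.sum_comm.trans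
          (Finset.sum_congr rfl fun a _ => Finset.sum_comm.trans
            (Finset.sum_congr rfl fun b _ => Finset.sum_congr rfl fun g₂ _ => ?_)))
        ring
      rw [key, key]
      -- The contracted argument and the given test form a related test for the function. The
      -- argument types on the two sides may differ here.
      exact ih₁ π₁' h₁ _ _ ⟨_, _, t, t', ih₂ π₂' h₂, ht, rfl, rfl⟩
  | pair s π₁ π₂ ih₁ ih₂ =>
    intro Γ' A' π' e e' he t t' ht
    cases π' with
    | pair s' π₁' π₂' =>
      obtain ⟨e₁, e₁', e₂, e₂', h₁, h₂, rfl, rfl⟩ := EnvRel.split s s'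
        ⟨by rw [s.length_eq.1, s'.length_eq.1]; exact he.length_eq,
          fun j => by rw [π₁.has_iff, π₁'.has_iff]⟩
        ⟨by rw [s.length_eq.2, s'.length_eq.2]; exact he.length_eq,
          fun j => by rw [π₂.has_iff, π₂'.has_iff]⟩ he
      have key : ∀ {Γ Γ₁ Γ₂ : Ctx} {M N : Tm G} {A B : Ty} (s : Ctx.Split Γ Γ₁ Γ₂)
          (π₁ : Deriv G Γ₁ M A) (π₂ : Deriv G Γ₂ N B)
          (e₁ : VC Bool Γ₁ → ℂ) (e₂ : VC Bool Γ₂ → ℂ),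
          (fun x => ∑ g, (e₁ (s.fst g) * e₂ (s.snd g)) * (Deriv.pair s π₁ π₂).den g x) =
            fun x => (∑ g, e₁ g * π₁.den g x.1) * (∑ g, e₂ g * π₂.den g x.2) :=
          fun {Γ Γ₁ Γ₂ M N A B} s π₁ π₂ e₁ e₂ => by
        exact funext fun x => s.sum_mul e₁ (π₁.den · x.1) e₂ (π₂.den · x.2)
      exact (congrArg (pairing · t) (key s π₁ π₂ e₁ e₂)).trans
        ((ht _ _ _ _ (ih₁ π₁' h₁) (ih₂ π₂' h₂)).trans
          (congrArg (pairing · t') (key s' π₁' π₂' e₁' e₂')).symm)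

/-- Separation of an environment by product vectors. -/
theorem EnvRel.single_refl : ∀ {Γ : Ctx} (g : VC Bool Γ),
    EnvRel Γ Γ (fun x => ind (x = g)) (fun x => ind (x = g))
  | [], _ => ⟨funext fun _ => ind_true rfl, funext fun _ => ind_true rfl⟩
  | none :: Γ, g => EnvRel.single_refl (Γ := Γ) g
  | some A :: Γ, g => ⟨fun x => ind (x = g.1), _, fun x => ind (x = g.2), _, orth_refl _,
      EnvRel.single_refl g.2, funext fun x => ind_prod (X := V Bool A) (Y := VC Bool Γ) x g,
      funext fun x => ind_prod (X := V Bool A) (Y := VC Bool Γ) x g⟩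

/-- Basis vectors of the environment and basis covectors of the type are self-related, and together
they isolate one entry of the tensor. -/
theorem Deriv.den_eq {Γ : Ctx} {M : Tm G} {A : Ty} (π π' : Deriv G Γ M A) : π.den = π'.den := by
  funext g x
  have := π.den_related π' (EnvRel.single_refl g) _ _ ((TestRel.refl_aux A).1 x)
  simp only [pairing_ind, mul_comm (ind _), sum_mul_ind] at this
  exact this

end QLam
namespace QLam

variable {G : GateSet}

/-! ### Substitution -/

/-- `Ctx.Ins Γ Γ' r`: `Γ'` is `Γ` with an unassigned variable inserted, and `r` is the corresponding
renaming of variables. -/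
inductive Ctx.Ins : Ctx → Ctx → (ℕ → ℕ) → Type
  | zero (Γ : Ctx) : Ctx.Ins Γ (none :: Γ) Nat.succ
  | cons {Γ Γ' : Ctx} {r : ℕ → ℕ} (o : Option Ty) (h : Ctx.Ins Γ Γ' r) :
      Ctx.Ins (o :: Γ) (o :: Γ') (Tm.upRen r)

def Ctx.Ins.val {D : Type} : {Γ Γ' : Ctx} → {r : ℕ → ℕ} → Ctx.Ins Γ Γ' r → VC D Γ' → VC D Γ
  | _, _, _, .zero _, g => g
  | _, _, _, .cons none h, g => h.val g
  | _, _, _, .cons (some _) h, g => (g.1, h.val g.2)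

theorem Ctx.Ins.void {Γ Γ' : Ctx} {r : ℕ → ℕ} (h : Ctx.Ins Γ Γ' r) : Ctx.Void Γ → Ctx.Void Γ' := by
  induction h with
  | zero Γ => intro h; simpa [Ctx.Void] using h
  | cons o h ih =>
    intro h
    simp only [Ctx.Void, List.mem_cons, forall_eq_or_imp] at h ⊢
    exact ⟨h.1, ih h.2⟩

theorem Ctx.Ins.single {Γ Γ' : Ctx} {r : ℕ → ℕ} (h : Ctx.Ins Γ Γ' r) :
    ∀ {i : ℕ} {A : Ty} (s : Ctx.Single Γ i A), ∃ s' : Ctx.Single Γ' (r i) A,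
      ∀ g : VC Bool Γ', s'.val g = s.val (h.val g) := by
  induction h with
  | zero Γ => intro i A s; exact ⟨.succ s, fun g => rfl⟩
  | cons o h ih =>
    intro i A s
    cases s with
    | zero hv => exact ⟨.zero (h.void hv), fun g => rfl⟩
    | succ s =>
      obtain ⟨s', hs'⟩ := ih s
      exact ⟨.succ s', fun g => hs' g⟩

theorem Ctx.Ins.split {Γ Γ' : Ctx} {r : ℕ → ℕ} (h : Ctx.Ins Γ Γ' r) :
    ∀ {Γ₁ Γ₂ : Ctx} (s : Ctx.Split Γ Γ₁ Γ₂), ∃ (Γ₁' Γ₂' : Ctx) (h₁ : Ctx.Ins Γ₁ Γ₁' r)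
      (h₂ : Ctx.Ins Γ₂ Γ₂' r) (s' : Ctx.Split Γ' Γ₁' Γ₂'), ∀ g : VC Bool Γ',
        h₁.val (s'.fst g) = s.fst (h.val g) ∧ h₂.val (s'.snd g) = s.snd (h.val g) := by
  induction h with
  | zero Γ => intro Γ₁ Γ₂ s; exact ⟨_, _, .zero _, .zero _, .skip s, fun g => ⟨rfl, rfl⟩⟩
  | cons o h ih =>
    intro Γ₁ Γ₂ s
    cases s with
    | skip s =>
      obtain ⟨_, _, h₁, h₂, s', hs⟩ := ih s
      exact ⟨_, _, .cons none h₁, .cons none h₂, .skip s', fun g => hs g⟩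
    | left s =>
      obtain ⟨_, _, h₁, h₂, s', hs⟩ := ih s
      exact ⟨_, _, .cons (some _) h₁, .cons none h₂, .left s',
        fun g => ⟨Prod.ext rfl (hs g.2).1, (hs g.2).2⟩⟩
    | right s =>
      obtain ⟨_, _, h₁, h₂, s', hs⟩ := ih s
      exact ⟨_, _, .cons none h₁, .cons (some _) h₂, .right s',
        fun g => ⟨(hs g.2).1, Prod.ext rfl (hs g.2).2⟩⟩

theorem Tm.labels_rename (M : Tm G) : ∀ r, (M.rename r).labels = M.labels := by
  induction M with
  | var | bit | gate => intro r; rfl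
  | pair M N ih₁ ih₂ | app M N ih₁ ih₂ => intro r; simp [Tm.rename, Tm.labels, ih₁, ih₂]
  | lam M ih | lamPair M ih => intro r; simp [Tm.rename, Tm.labels, ih]

theorem Deriv.rename {Γ : Ctx} {M : Tm G} {A : Ty} (π : Deriv G Γ M A) :
    ∀ {Γ' : Ctx} {r : ℕ → ℕ} (h : Ctx.Ins Γ Γ' r), ∃ π' : Deriv G Γ' (M.rename r) A,
      ∀ g x, π'.den g x = π.den (h.val g) x := by
  induction π with
  | var s =>
    intro Γ' r h
    obtain ⟨s', hs'⟩ := h.single s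
    exact ⟨.var s', fun g x => by simp [Deriv.den, hs']⟩
  | bit hv => intro Γ' r h; exact ⟨.bit (h.void hv), fun g x => rfl⟩
  | gate hv => intro Γ' r h; exact ⟨.gate (h.void hv), fun g x => rfl⟩
  | lam π ih =>
    intro Γ' r h
    obtain ⟨π', hπ⟩ := ih (h.cons _)
    exact ⟨.lam π', fun g x => hπ _ _⟩
  | lamPair π ih =>
    intro Γ' r h
    obtain ⟨π', hπ⟩ := ih ((h.cons _).cons _)
    exact ⟨.lamPair π', fun g x => hπ _ _⟩
  | app s π₁ π₂ ih₁ ih₂ =>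
    intro Γ' r h
    obtain ⟨_, _, h₁, h₂, s', hs⟩ := h.split s
    obtain ⟨π₁', hπ₁⟩ := ih₁ h₁
    obtain ⟨π₂', hπ₂⟩ := ih₂ h₂
    exact ⟨.app s' π₁' π₂', fun g x => Finset.sum_congr rfl fun a _ => congrArg₂ (· * ·)
      ((hπ₁ _ _).trans (congrArg (π₁.den · _) (hs g).1))
      ((hπ₂ _ _).trans (congrArg (π₂.den · _) (hs g).2))⟩
  | pair s π₁ π₂ ih₁ ih₂ =>
    intro Γ' r h
    obtain ⟨_, _, h₁, h₂, s', hs⟩ := h.split s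
    obtain ⟨π₁', hπ₁⟩ := ih₁ h₁
    obtain ⟨π₂', hπ₂⟩ := ih₂ h₂
    exact ⟨.pair s' π₁' π₂', fun g x => by simp [Deriv.den, hπ₁, hπ₂, hs]⟩

/-- `TSub G Γ s Δ`: the terms `s i` are typed in disjoint environments with union `Δ`, with the types
assigned by `Γ` to the variables with index `i`. -/
inductive TSub (G : GateSet) : Ctx → (ℕ → Tm G) → Ctx → Type
  | nil {s : ℕ → Tm G} {Δ : Ctx} (h : Ctx.Void Δ) : TSub G [] s Δ
  | none {Γ : Ctx} {s : ℕ → Tm G} {Δ : Ctx} (σ : TSub G Γ (fun i => s (i + 1)) Δ) :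
      TSub G (none :: Γ) s Δ
  | some {Γ : Ctx} {s : ℕ → Tm G} {Δ Δ₁ Δ₂ : Ctx} {A : Ty} (p : Ctx.Split Δ Δ₁ Δ₂)
      (π : Deriv G Δ₁ (s 0) A) (σ : TSub G Γ (fun i => s (i + 1)) Δ₂) :
      TSub G (some A :: Γ) s Δ

noncomputable def TSub.den : {Γ : Ctx} → {s : ℕ → Tm G} → {Δ : Ctx} → TSub G Γ s Δ →
    VC Bool Δ → VC Bool Γ → ℂ
  | _, _, _, .nil _, _, _ => 1
  | _, _, _, .none σ, d, g => σ.den d g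
  | _, _, _, .some p π σ, d, g => π.den (p.fst d) g.1 * σ.den (p.snd d) g.2

def TSub.labels : {Γ : Ctx} → {s : ℕ → Tm G} → {Δ : Ctx} → TSub G Γ s Δ → List ℕ
  | _, _, _, .nil _ => []
  | _, _, _, .none σ => σ.labels
  | _, s, _, .some _ _ σ => (s 0).labels ++ σ.labels

theorem Ctx.Void.split_self {Γ : Ctx} (h : Ctx.Void Γ) : Nonempty (Ctx.Split Γ Γ Γ) := by
  induction Γ with
  | nil => exact ⟨.nil⟩
  | cons o Γ ih =>
    obtain rfl : o = none := h o (by simp)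
    exact (ih fun o ho => h o (by simp [ho])).map .skip

/-- Used to separate a bound variable from the rest: the void part, extended by that variable, types
the variable alone. -/
theorem Ctx.exists_void_split (Γ : Ctx) : ∃ Δ : Ctx, Ctx.Void Δ ∧ ∃ s : Ctx.Split Γ Δ Γ,
    ∀ g : VC Bool Γ, s.snd g = g := by
  induction Γ with
  | nil => exact ⟨[], by simp [Ctx.Void], .nil, fun g => rfl⟩
  | cons o Γ ih =>
    obtain ⟨Δ, hΔ, s, hs⟩ := ih
    cases o with
    | none => exact ⟨none :: Δ, by simpa [Ctx.Void] using hΔ, .skip s, fun g => hs g⟩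
    | some A =>
      exact ⟨none :: Δ, by simpa [Ctx.Void] using hΔ, .right s, fun g => Prod.ext rfl (hs g.2)⟩

theorem Ctx.Split.void {Γ Γ₁ Γ₂ : Ctx} (s : Ctx.Split Γ Γ₁ Γ₂) :
    Ctx.Void Γ → Ctx.Void Γ₁ ∧ Ctx.Void Γ₂ := by
  induction s with
  | nil => exact fun h => ⟨h, h⟩
  | skip s ih => simpa [Ctx.Void] using ih
  | left s ih => simp [Ctx.Void]
  | right s ih => simp [Ctx.Void]

theorem Ctx.Split.eq_of_void_right {Γ Γ₁ Γ₂ : Ctx} (s : Ctx.Split Γ Γ₁ Γ₂) (h : Ctx.Void Γ₂) :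
    ∃ e : Γ₁ = Γ, ∀ g : VC Bool Γ, e ▸ s.fst g = g := by
  induction s with
  | nil => exact ⟨rfl, fun g => rfl⟩
  | skip s ih =>
    obtain ⟨rfl, hs⟩ := ih fun o ho => h o (by simp [ho])
    exact ⟨rfl, fun g => hs g⟩
  | left s ih =>
    obtain ⟨rfl, hs⟩ := ih fun o ho => h o (by simp [ho])
    exact ⟨rfl, fun g => Prod.ext rfl (hs g.2)⟩
  | right s ih => simp [Ctx.Void] at h

/-- Associativity of disjoint union, recorded through the restrictions of assignments. It regroups
the environments of the substituted terms when a substitution is divided between two premises. -/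
theorem Ctx.Split.assoc_left {Δ Δ' : Ctx} : ∀ {Δ₀ Δ₁ Δ₂ : Ctx} (p : Ctx.Split Δ Δ₀ Δ')
    (q : Ctx.Split Δ' Δ₁ Δ₂), ∃ (Δ'' : Ctx) (p' : Ctx.Split Δ Δ'' Δ₂)
      (q' : Ctx.Split Δ'' Δ₀ Δ₁), ∀ d : VC Bool Δ, q'.fst (p'.fst d) = p.fst d ∧
        q'.snd (p'.fst d) = q.fst (p.snd d) ∧ p'.snd d = q.snd (p.snd d) := by
  intro Δ₀ Δ₁ Δ₂ p
  induction p generalizing Δ₁ Δ₂ with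
  | nil => intro q; cases q; exact ⟨_, .nil, .nil, fun d => ⟨rfl, rfl, rfl⟩⟩
  | skip p ih =>
    intro q
    cases q with
    | skip q =>
      obtain ⟨_, p', q', h⟩ := ih q
      exact ⟨_, .skip p', .skip q', fun d => h d⟩
  | left p ih =>
    intro q
    cases q with
    | skip q =>
      obtain ⟨_, p', q', h⟩ := ih q
      exact ⟨_, .left p', .left q',
        fun d => ⟨Prod.ext rfl (h d.2).1, (h d.2).2.1, (h d.2).2.2⟩⟩
  | right p ih =>
    intro q
    cases q with
    | left q =>
      obtain ⟨_, p', q', h⟩ := ih q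
      exact ⟨_, .left p', .right q',
        fun d => ⟨(h d.2).1, Prod.ext rfl (h d.2).2.1, (h d.2).2.2⟩⟩
    | right q =>
      obtain ⟨_, p', q', h⟩ := ih q
      exact ⟨_, .right p', .skip q',
        fun d => ⟨(h d.2).1, (h d.2).2.1, Prod.ext rfl (h d.2).2.2⟩⟩

theorem Ctx.Split.exists_symm {Γ Γ₁ Γ₂ : Ctx} (s : Ctx.Split Γ Γ₁ Γ₂) :
    ∃ s' : Ctx.Split Γ Γ₂ Γ₁, ∀ g : VC Bool Γ, s'.fst g = s.snd g ∧ s'.snd g = s.fst g := by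
  induction s with
  | nil => exact ⟨.nil, fun g => ⟨rfl, rfl⟩⟩
  | skip s ih => obtain ⟨s', h⟩ := ih; exact ⟨.skip s', fun g => h g⟩
  | left s ih =>
    obtain ⟨s', h⟩ := ih
    exact ⟨.right s', fun g => ⟨(h g.2).1, Prod.ext rfl (h g.2).2⟩⟩
  | right s ih =>
    obtain ⟨s', h⟩ := ih
    exact ⟨.left s', fun g => ⟨Prod.ext rfl (h g.2).1, (h g.2).2⟩⟩

theorem Ctx.Split.assoc_right {Δ Δ' Δ₀ Δ₁ Δ₂ : Ctx} (p : Ctx.Split Δ Δ₀ Δ')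
    (q : Ctx.Split Δ' Δ₁ Δ₂) : ∃ (Δ'' : Ctx) (p' : Ctx.Split Δ Δ₁ Δ'')
      (q' : Ctx.Split Δ'' Δ₀ Δ₂), ∀ d : VC Bool Δ, q'.fst (p'.snd d) = p.fst d ∧
        q'.snd (p'.snd d) = q.snd (p.snd d) ∧ p'.fst d = q.fst (p.snd d) := by
  obtain ⟨q₁, hq⟩ := q.exists_symm
  obtain ⟨Δ'', p', q', h⟩ := p.assoc_left q₁
  obtain ⟨p'', hp⟩ := p'.exists_symm
  exact ⟨Δ'', p'', q', fun d => by simp [hp, hq, h]⟩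

/-- Each variable belongs to one side of the splitting, so each substituted term is used on one side
only. Its labels move with it, and the tensor of the substitution factors. -/
theorem TSub.split {Γ Γ₁ Γ₂ : Ctx} (p : Ctx.Split Γ Γ₁ Γ₂) : ∀ {s : ℕ → Tm G} {Δ : Ctx}
    (σ : TSub G Γ s Δ), ∃ (Δ₁ Δ₂ : Ctx) (q : Ctx.Split Δ Δ₁ Δ₂) (σ₁ : TSub G Γ₁ s Δ₁)
      (σ₂ : TSub G Γ₂ s Δ₂), σ.labels.Perm (σ₁.labels ++ σ₂.labels) ∧
        ∀ d g, σ.den d g = σ₁.den (q.fst d) (p.fst g) * σ₂.den (q.snd d) (p.snd g) := by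
  induction p with
  | nil =>
    intro s Δ σ
    cases σ with
    | nil h =>
      obtain ⟨q⟩ := h.split_self
      exact ⟨_, _, q, .nil h, .nil h, by simp [TSub.labels], fun d g => by simp [TSub.den]⟩
  | skip p ih =>
    intro s Δ σ
    cases σ with
    | none σ =>
      obtain ⟨Δ₁, Δ₂, q, σ₁, σ₂, hl, h⟩ := ih σ
      exact ⟨Δ₁, Δ₂, q, .none σ₁, .none σ₂, hl, fun d g => h d g⟩
  | left p ih =>
    intro s Δ σ
    cases σ with
    | some t π σ =>
      obtain ⟨Δ₁, Δ₂, q, σ₁, σ₂, hl, h⟩ := ih σ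
      obtain ⟨Δ'', p', q', hd⟩ := t.assoc_left q
      refine ⟨_, _, p', .some q' π σ₁, .none σ₂, ?_, fun d g => ?_⟩
      · simpa only [TSub.labels, List.append_assoc] using hl.append_left _
      · simp only [TSub.den, h, hd, Ctx.Split.fst, Ctx.Split.snd]
        ring
  | right p ih =>
    intro s Δ σ
    cases σ with
    | some t π σ =>
      obtain ⟨Δ₁, Δ₂, q, σ₁, σ₂, hl, h⟩ := ih σ
      obtain ⟨Δ'', p', q', hd⟩ := t.assoc_right q
      refine ⟨_, _, p', .none σ₁, .some q' π σ₂, ?_, fun d g => ?_⟩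
      · simp only [TSub.labels]
        refine (hl.append_left _).trans ?_
        simpa using (List.perm_append_comm (l₁ := (s 0).labels)).append_right σ₂.labels
      · simp only [TSub.den, h, hd, Ctx.Split.fst, Ctx.Split.snd]
        ring

theorem TSub.void {Γ : Ctx} {s : ℕ → Tm G} {Δ : Ctx} (σ : TSub G Γ s Δ) :
    Ctx.Void Γ → Ctx.Void Δ ∧ σ.labels = [] ∧ ∀ d g, σ.den d g = 1 := by
  induction σ with
  | nil h => exact fun _ => ⟨h, rfl, fun d g => rfl⟩
  | none σ ih =>
    intro h
    obtain ⟨hΔ, hl, hd⟩ := ih fun o ho => h o (by simp [ho])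
    exact ⟨hΔ, hl, fun d g => hd d g⟩
  | some p π σ ih => simp [Ctx.Void]

theorem TSub.single {Γ : Ctx} {i : ℕ} {A : Ty} (h : Ctx.Single Γ i A) :
    ∀ {s : ℕ → Tm G} {Δ : Ctx} (σ : TSub G Γ s Δ), σ.labels = (s i).labels ∧
      ∃ π : Deriv G Δ (s i) A, ∀ d x, π.den d x = ∑ g, σ.den d g * ind (h.val g = x) := by
  induction h with
  | zero hv =>
    intro s Δ σ
    cases σ with
    | some p π σ =>
      obtain ⟨h₂, hl, hσ⟩ := σ.void hv
      refine ⟨by simp [TSub.labels, hl], ?_⟩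
      obtain ⟨rfl, hd⟩ := p.eq_of_void_right h₂
      refine ⟨π, fun d x => ?_⟩
      obtain ⟨g₀, -, hg⟩ := VC.sum_of_void hv
      rw [VC.sum_cons]
      simp only [hg, TSub.den, hσ, Ctx.Single.val, mul_one, sum_mul_ind]
      rw [show p.fst d = d from hd d]
  | succ h ih =>
    intro s Δ σ
    cases σ with
    | none σ => exact ih σ

theorem TSub.weaken {Γ : Ctx} {s : ℕ → Tm G} {Δ : Ctx} (σ : TSub G Γ s Δ) :
    ∃ σ' : TSub G Γ (fun i => (s i).rename Nat.succ) (Option.none :: Δ), σ'.labels = σ.labels ∧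
      ∀ (d : VC Bool Δ) g, σ'.den d g = σ.den d g := by
  induction σ with
  | nil h => exact ⟨.nil (by simpa [Ctx.Void] using h), rfl, fun d g => rfl⟩
  | none σ ih =>
    obtain ⟨σ', hl, h⟩ := ih
    exact ⟨.none σ', hl, fun d g => h d g⟩
  | some p π σ ih =>
    obtain ⟨σ', hl, h⟩ := ih
    obtain ⟨π', hπ⟩ := π.rename (.zero _)
    refine ⟨.some (.skip p) π' σ', by simp [TSub.labels, hl, Tm.labels_rename], fun d g => ?_⟩
    exact congrArg₂ (· * ·) (hπ _ _) (h _ _)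

/-- Under a binder the bound variable is replaced by itself, which adds an identity factor to the
tensor. -/
theorem TSub.up {Γ : Ctx} {s : ℕ → Tm G} {Δ : Ctx} (σ : TSub G Γ s Δ) (A : Ty) :
    ∃ σ' : TSub G (Option.some A :: Γ) (Tm.upSub s) (Option.some A :: Δ), σ'.labels = σ.labels ∧
      ∀ (x y : V Bool A) (d : VC Bool Δ) (g : VC Bool Γ),
        σ'.den (x, d) (y, g) = ind (x = y) * σ.den d g := by
  obtain ⟨σ', hl, h⟩ := σ.weaken
  obtain ⟨Δ₀, hv, p, hp⟩ := Ctx.exists_void_split Δ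
  refine ⟨.some (.left p) (.var (.zero hv)) σ', ?_, fun x y d g => ?_⟩
  · simpa [TSub.labels, Tm.upSub, Tm.labels] using hl
  · exact congrArg₂ (· * ·) rfl ((congrArg (fun d => σ'.den d g) (hp d)).trans (h d g))

theorem TSub.sum_up {Γ : Ctx} {s : ℕ → Tm G} {Δ : Ctx} {σ : TSub G Γ s Δ} {A : Ty}
    {σ' : TSub G (Option.some A :: Γ) (Tm.upSub s) (Option.some A :: Δ)}
    (h : ∀ (x y : V Bool A) (d : VC Bool Δ) (g : VC Bool Γ),
      σ'.den (x, d) (y, g) = ind (x = y) * σ.den d g) (x : V Bool A) (d : VC Bool Δ)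
    (f : VC Bool (Option.some A :: Γ) → ℂ) :
    ∑ g, σ'.den (x, d) g * f g = ∑ g, σ.den d g * f (x, g) := by
  rw [VC.sum_cons]
  simp only [h, mul_assoc, ← Finset.mul_sum, sum_ind_mul]

/-- In a β-step the variables that are not consumed by the redex are substituted by themselves. -/
theorem TSub.exists_id (Γ : Ctx) : ∃ σ : TSub G Γ Tm.var Γ, σ.labels = [] ∧
    ∀ d g, σ.den d g = ind (d = g) := by
  have up : Tm.upSub (Tm.var (G := G)) = Tm.var := by
    funext i
    cases i <;> rfl
  induction Γ with
  | nil => exact ⟨.nil (by simp [Ctx.Void]), rfl, fun d g => by rw [show d = g from rfl, ind_true rfl]; rfl⟩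
  | cons o Γ ih =>
    obtain ⟨σ, hl, h⟩ := ih
    cases o with
    | none =>
      obtain ⟨σ', hl', h'⟩ := σ.weaken
      exact ⟨.none σ', hl'.trans hl, fun d g => (h' d g).trans (h d g)⟩
    | some A =>
      have := σ.up A
      rw [up] at this
      obtain ⟨σ', hl', h'⟩ := this
      refine ⟨σ', hl'.trans hl, fun d g => (h' d.1 g.1 d.2 g.2).trans ?_⟩
      rw [h, ← ind_and]
      exact congrArg ind (propext (Prod.ext_iff (α := V Bool A) (β := VC Bool Γ)).symm)

/-- Substitution preserves typing, and it is computed by composition of tensors. -/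
theorem Deriv.subst {Γ : Ctx} {M : Tm G} {B : Ty} (π : Deriv G Γ M B) :
    ∀ {s : ℕ → Tm G} {Δ : Ctx} (σ : TSub G Γ s Δ),
      (M.subst s).labels.Perm (M.labels ++ σ.labels) ∧
      ∃ π' : Deriv G Δ (M.subst s) B, ∀ d x, π'.den d x = ∑ g, σ.den d g * π.den g x := by
  induction π with
  | var h =>
    intro s Δ σ
    obtain ⟨hl, π, hπ⟩ := σ.single h
    exact ⟨by simp [Tm.subst, Tm.labels, hl], π, hπ⟩
  | bit hv =>
    intro s Δ σ
    obtain ⟨hΔ, hl, hσ⟩ := σ.void hv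
    obtain ⟨g₀, -, hg⟩ := VC.sum_of_void hv
    exact ⟨by simp [Tm.subst, Tm.labels, hl], .bit hΔ,
      fun d x => by simp [hg, hσ, Deriv.den]⟩
  | gate hv =>
    intro s Δ σ
    obtain ⟨hΔ, hl, hσ⟩ := σ.void hv
    obtain ⟨g₀, -, hg⟩ := VC.sum_of_void hv
    exact ⟨by simp [Tm.subst, Tm.labels, hl], .gate hΔ,
      fun d x => by simp [hg, hσ, Deriv.den]⟩
  | lam π ih =>
    intro s Δ σ
    obtain ⟨σ', hl, hσ⟩ := σ.up _
    obtain ⟨hl', π', hπ⟩ := ih σ'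
    refine ⟨by simpa [Tm.subst, Tm.labels, hl] using hl', .lam π', fun d x => ?_⟩
    exact (hπ _ _).trans (TSub.sum_up hσ _ _ _)
  | lamPair π ih =>
    intro s Δ σ
    obtain ⟨σ₁, hl₁, hσ₁⟩ := σ.up _
    obtain ⟨σ₂, hl₂, hσ₂⟩ := σ₁.up _
    obtain ⟨hl', π', hπ⟩ := ih σ₂
    refine ⟨by simpa [Tm.subst, Tm.labels, hl₁, hl₂] using hl', .lamPair π', fun d x => ?_⟩
    exact (hπ _ _).trans ((TSub.sum_up hσ₂ _ _ _).trans (TSub.sum_up hσ₁ _ _ _))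
  | app p π₁ π₂ ih₁ ih₂ =>
    intro s Δ σ
    obtain ⟨Δ₁, Δ₂, q, σ₁, σ₂, hl, h⟩ := σ.split p
    obtain ⟨hl₁, π₁', hπ₁⟩ := ih₁ σ₁
    obtain ⟨hl₂, π₂', hπ₂⟩ := ih₂ σ₂
    refine ⟨?_, .app q π₁' π₂', fun d x => ?_⟩
    · simp only [Tm.subst, Tm.labels]
      refine (hl₁.append hl₂).trans (.trans ?_ (hl.symm.append_left _))
      simp only [List.append_assoc]
      refine List.Perm.append_left _ ?_
      simpa using (List.perm_append_comm (l₁ := σ₁.labels)).append_right σ₂.labels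
    · refine (Finset.sum_congr rfl fun a _ => (congrArg₂ (· * ·) (hπ₁ _ (a, x))
        (hπ₂ _ a)).trans (p.sum_mul (σ₁.den (q.fst d)) (fun g => π₁.den g (a, x))
          (σ₂.den (q.snd d)) (fun g => π₂.den g a)).symm).trans ?_
      simp only [Deriv.den, h, Finset.mul_sum]
      exact Finset.sum_comm
  | pair p π₁ π₂ ih₁ ih₂ =>
    intro s Δ σ
    obtain ⟨Δ₁, Δ₂, q, σ₁, σ₂, hl, h⟩ := σ.split p
    obtain ⟨hl₁, π₁', hπ₁⟩ := ih₁ σ₁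
    obtain ⟨hl₂, π₂', hπ₂⟩ := ih₂ σ₂
    refine ⟨?_, .pair q π₁' π₂', fun d x => ?_⟩
    · simp only [Tm.subst, Tm.labels]
      refine (hl₁.append hl₂).trans (.trans ?_ (hl.symm.append_left _))
      simp only [List.append_assoc]
      refine List.Perm.append_left _ ?_
      simpa using (List.perm_append_comm (l₁ := σ₁.labels)).append_right σ₂.labels
    · simp only [Deriv.den, hπ₁, hπ₂, h]
      exact (p.sum_mul (σ₁.den (q.fst d)) (fun g => π₁.den g x.1) (σ₂.den (q.snd d))
        (fun g => π₂.den g x.2)).symm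

end QLam
namespace QLam

variable {G : GateSet}

/-! ### Soundness of the equational theory for tensors -/

/-- The substitution is the identity except at index 0, so the sum over the other variables
collapses and the contraction over the argument type remains, which is the tensor of the redex. -/
theorem Deriv.subst1 {Γ Γ₁ Γ₂ : Ctx} {M N : Tm G} {A B : Ty} (s : Ctx.Split Γ Γ₁ Γ₂)
    (π : Deriv G (some A :: Γ₁) M B) (π₂ : Deriv G Γ₂ N A) :
    (M.subst1 N).labels.Perm (M.labels ++ N.labels) ∧
      ∃ π' : Deriv G Γ (M.subst1 N) B,
        ∀ g x, π'.den g x = ∑ a, π.den (a, s.fst g) x * π₂.den (s.snd g) a := by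
  obtain ⟨σ, hl, hσ⟩ := TSub.exists_id (G := G) Γ₁
  obtain ⟨s', hs⟩ := s.exists_symm
  obtain ⟨h, π', hπ⟩ := π.subst (s := fun i => match i with
    | 0 => N
    | i + 1 => .var i) (.some s' π₂ σ)
  refine ⟨h.trans (by simp [TSub.labels, hl]), π', fun g x => (hπ g x).trans ?_⟩
  rw [VC.sum_cons]
  refine Finset.sum_congr rfl fun a _ => ?_
  simp only [TSub.den, hσ, hs, mul_assoc, ← Finset.mul_sum, sum_ind_mul]
  exact mul_comm _ _

theorem Deriv.subst2 {Γ Γ₁ Γ₂ Γ₃ Γ₄ : Ctx} {M N L : Tm G} {A B C : Ty}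
    (s : Ctx.Split Γ Γ₁ Γ₂) (t : Ctx.Split Γ₂ Γ₃ Γ₄) (π : Deriv G (some B :: some A :: Γ₁) M C)
    (π₃ : Deriv G Γ₃ N A) (π₄ : Deriv G Γ₄ L B) :
    (M.subst2 N L).labels.Perm (M.labels ++ (N.labels ++ L.labels)) ∧
      ∃ π' : Deriv G Γ (M.subst2 N L) C,
        ∀ g x, π'.den g x = ∑ a, ∑ b, π.den (b, (a, s.fst g)) x *
          (π₃.den (t.fst (s.snd g)) a * π₄.den (t.snd (s.snd g)) b) := by
  obtain ⟨σ, hl, hσ⟩ := TSub.exists_id (G := G) Γ₁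
  -- `L` replaces index 0, so its environment has to be split off before that of `N`; the two parts
  -- of `t` are exchanged and the union is rebracketed.
  obtain ⟨t', ht⟩ := t.exists_symm
  obtain ⟨Δ, p, q, hpq⟩ := s.assoc_right t'
  obtain ⟨q', hq⟩ := q.exists_symm
  obtain ⟨h, π', hπ⟩ := π.subst (s := fun i => match i with
    | 0 => L
    | 1 => N
    | i + 2 => .var i) (.some p π₄ (.some q' π₃ σ))
  refine ⟨h.trans (List.Perm.append_left _ ?_), π', fun g x => (hπ g x).trans ?_⟩
  · simpa [TSub.labels, hl] using List.perm_append_comm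
  rw [VC.sum_cons, Finset.sum_comm' (t' := Finset.univ) (s' := fun _ => Finset.univ) (by simp),
    VC.sum_cons, Finset.sum_congr rfl fun a _ => Finset.sum_comm]
  refine Finset.sum_congr rfl fun a _ => Finset.sum_congr rfl fun b _ => ?_
  simp only [TSub.den, hσ, hq, hpq, ht, mul_assoc, ← Finset.mul_sum, sum_ind_mul]
  ring

/-- The tensor of a typable term. -/
noncomputable def tmDen (Γ : Ctx) (A : Ty) (M : Tm G) (g : VC Bool Γ) (x : V Bool A) : ℂ :=
  open Classical in if h : Nonempty (Deriv G Γ M A) then h.some.den g x else 0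

theorem tmDen_eq {Γ : Ctx} {A : Ty} {M : Tm G} (π : Deriv G Γ M A) : tmDen Γ A M = π.den := by
  funext g x
  have h : Nonempty (Deriv G Γ M A) := ⟨π⟩
  rw [tmDen, dif_pos h, Deriv.den_eq h.some π]

/-- The tensor of a superposed term, as a linear function. -/
noncomputable def supDen (Γ : Ctx) (A : Ty) (g : VC Bool Γ) (x : V Bool A) : Sup G →ₗ[ℂ] ℂ :=
  Finsupp.linearCombination ℂ fun M => tmDen Γ A M g x

theorem supDen_ofTm {Γ : Ctx} {A : Ty} {M : Tm G} (π : Deriv G Γ M A) (g : VC Bool Γ)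
    (x : V Bool A) : supDen Γ A g x (.ofTm M) = π.den g x := by
  rw [supDen, Sup.ofTm, Finsupp.linearCombination_single, one_smul, tmDen_eq π]

theorem supDen_map (Γ : Ctx) (A : Ty) (c : Tm G → Tm G) (T : Sup G) (g : VC Bool Γ)
    (x : V Bool A) : supDen Γ A g x (T.map c) = ∑ M ∈ T.support, T M * tmDen Γ A (c M) g x := by
  rw [supDen, Sup.map, Finsupp.linearCombination_mapDomain]
  rfl

theorem supDen_apply (Γ : Ctx) (A : Ty) (T : Sup G) (g : VC Bool Γ)
    (x : V Bool A) : supDen Γ A g x T = ∑ M ∈ T.support, T M * tmDen Γ A M g x := rfl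

/-- A term construct acts on tensors by a linear combination of entries. The coefficients `k` do not
depend on the summand, so the action passes to formal sums and respects equality of their tensors.
-/
theorem supDen_map_congr {Γ Γ' : Ctx} {A A' : Ty} {c : Tm G → Tm G} {T S : Sup G}
    (h : SupHasType Γ T A ∧ SupHasType Γ S A ∧ ∀ g x, supDen Γ A g x T = supDen Γ A g x S)
    {ι : Type} [Fintype ι] {g' : VC Bool Γ'} {x' : V Bool A'} (k : ι → ℂ) (g : ι → VC Bool Γ)
    (x : ι → V Bool A) (hc : ∀ (M : Tm G) (π : Deriv G Γ M A),
      tmDen Γ' A' (c M) g' x' = ∑ i, k i * π.den (g i) (x i)) :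
    supDen Γ' A' g' x' (T.map c) = supDen Γ' A' g' x' (S.map c) := by
  have key : ∀ T : Sup G, SupHasType Γ T A →
      supDen Γ' A' g' x' (T.map c) = ∑ i, k i * supDen Γ A (g i) (x i) T := fun T hT => by
    rw [supDen_map]
    simp only [supDen_apply, Finset.mul_sum]
    rw [Finset.sum_comm]
    refine Finset.sum_congr rfl fun M hM => ?_
    obtain ⟨π⟩ := (hT M hM).2
    rw [hc M π, Finset.mul_sum]
    refine Finset.sum_congr rfl fun i _ => ?_
    rw [tmDen_eq π]
    ring
  rw [key T h.1, key S h.2.1]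
  exact Finset.sum_congr rfl fun i _ => congrArg _ (h.2.2 _ _)

theorem SupHasType.ofTm {Γ : Ctx} {A : Ty} {M : Tm G} (h : HasType Γ M A) :
    SupHasType Γ (.ofTm M) A := by
  intro N hN
  obtain rfl : M = N := by
    by_contra hne
    exact Finsupp.mem_support_iff.1 hN (Finsupp.single_eq_of_ne (Ne.symm hne))
  exact h

theorem SupHasType.map {Γ Γ' : Ctx} {A A' : Ty} {T : Sup G} {c : Tm G → Tm G}
    (h : SupHasType Γ T A) (hc : ∀ M, HasType Γ M A → HasType Γ' (c M) A') :
    SupHasType Γ' (T.map c) A' := by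
  classical
  intro N hN
  obtain ⟨M, hM, rfl⟩ := Finset.mem_image.1 (Finsupp.mapDomain_support hN)
  exact hc M (h M hM)

theorem SupHasType.smul_add {Γ : Ctx} {A : Ty} {T V : Sup G} (α : ℂ) (h : SupHasType Γ T A)
    (hV : SupHasType Γ V A) : SupHasType Γ (α • T + V) A := by
  classical
  intro M hM
  rcases Finset.mem_union.1 (Finsupp.support_add hM) with hM | hM
  · exact h M (Finsupp.support_smul hM)
  · exact hV M hM

theorem Tm.labels_ket : ∀ (k : ℕ) (b c : Fin (k + 1) → Bool) (l : Fin (k + 1) → ℕ),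
    (ket (G := G) k b l).labels = (ket (G := G) k c l).labels
  | 0, _, _, _ => rfl
  | k + 1, b, c, l => congrArg (l 0 :: ·) (Tm.labels_ket k (Fin.tail b) (Fin.tail c) (Fin.tail l))

theorem Deriv.exists_ket {Γ : Ctx} (hΓ : Ctx.Void Γ) :
    ∀ (k : ℕ) (b : Fin (k + 1) → Bool) (l : Fin (k + 1) → ℕ),
      ∃ π : Deriv G Γ (.ket k b l) (.pow k), ∀ g x, π.den g x = ind (b = powV x)
  | 0, b, l => ⟨.bit hΓ, fun g x => by
      refine congrArg ind (propext ⟨fun h => funext fun i => ?_, fun h => congrFun h 0⟩)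
      obtain rfl : i = 0 := Fin.fin_one_eq_zero i
      exact h⟩
  | k + 1, b, l => by
      obtain ⟨π, hπ⟩ := Deriv.exists_ket hΓ k (Fin.tail b) (Fin.tail l)
      obtain ⟨s⟩ := hΓ.split_self
      refine ⟨.pair s (.bit hΓ) π, fun g x => ?_⟩
      refine (congrArg₂ (· * ·) rfl (hπ _ _)).trans ((ind_and _ _).symm.trans
        (congrArg ind (propext ⟨fun h => ?_, fun h => ?_⟩)))
      · exact ((Fin.cons_self_tail b).symm.trans (congrArg₂ _ h.1 h.2) :)
      · rw [h]
        exact ⟨rfl, rfl⟩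

theorem HasType.of_perm {Γ : Ctx} {M N : Tm G} {A : Ty} (h : HasType Γ M A)
    (p : N.labels.Perm M.labels) (π : Deriv G Γ N A) : HasType Γ N A :=
  ⟨p.nodup_iff.2 h.1, ⟨π⟩⟩

/-- Typing of both sides is carried along in the induction, since the action of a construct on the
tensors is only known for typable summands. -/
theorem EqTh.sound {Γ : Ctx} {A : Ty} {T S : Sup G} (h : EqTh Γ A T S) :
    SupHasType Γ T A ∧ SupHasType Γ S A ∧ ∀ g x, supDen Γ A g x T = supDen Γ A g x S := by
  induction h with
  | betaPair h =>
    obtain ⟨hl, ⟨π⟩⟩ := id h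
    cases π with
    | app s π₁ π₂ =>
      cases π₁ with
      | lamPair π₁ =>
        cases π₂ with
        | pair t π₃ π₄ =>
          obtain ⟨hp, π', hπ⟩ := Deriv.subst2 s t π₁ π₃ π₄
          refine ⟨.ofTm h, .ofTm (h.of_perm hp π'), fun g x => ?_⟩
          rw [supDen_ofTm (.app s (.lamPair π₁) (.pair t π₃ π₄)), supDen_ofTm π', hπ]
          exact V.sum_tensor _
  | beta h =>
    obtain ⟨hl, ⟨π⟩⟩ := id h
    cases π with
    | app s π₁ π₂ =>
      cases π₁ with
      | lam π₁ =>
        obtain ⟨hp, π', hπ⟩ := Deriv.subst1 s π₁ π₂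
        refine ⟨.ofTm h, .ofTm (h.of_perm hp π'), fun g x => ?_⟩
        rw [supDen_ofTm (.app s (.lam π₁) π₂), supDen_ofTm π', hπ]
        rfl
  | quant hΓ h =>
    rename_i U b l
    refine ⟨.ofTm h, ?_, fun g x => ?_⟩
    · classical
      intro M hM
      obtain ⟨c, -, hc⟩ := Finset.mem_biUnion.1 (Finsupp.support_finsetSum hM)
      obtain rfl : Tm.ket (G.rank U) c l = M := by
        by_contra hne
        exact Finsupp.mem_support_iff.1 hc (Finsupp.single_eq_of_ne (Ne.symm hne))
      obtain ⟨π, -⟩ := Deriv.exists_ket hΓ (G.rank U) c l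
      refine ⟨?_, ⟨π⟩⟩
      rw [Tm.labels_ket _ c b]
      exact h.1
    · obtain ⟨π, hπ⟩ := Deriv.exists_ket hΓ (G.rank U) b l
      obtain ⟨s⟩ := hΓ.split_self
      rw [supDen_ofTm (.app s (.gate hΓ) π), Sup.gateKet, map_sum]
      have h₁ : ∀ c, supDen (G := G) _ _ g x (Finsupp.single (Tm.ket (G.rank U) c l)
          ((G.op U : Matrix _ _ ℂ) c b)) = (G.op U : Matrix _ _ ℂ) c b * ind (c = powV x) :=
        fun c => by
          obtain ⟨π, hπ⟩ := Deriv.exists_ket hΓ (G.rank U) c l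
          rw [supDen, Finsupp.linearCombination_single, tmDen_eq π, hπ, smul_eq_mul]
      simp only [h₁, sum_mul_ind, Deriv.den, hπ]
      -- Assignments to a tensor power are bit strings, and the basis vector of the argument selects
      -- the column `b` of the matrix.
      refine (Fintype.sum_equiv (powEquiv Bool _) _
        (fun a => (G.op U : Matrix _ _ ℂ) (powV x) a * ind (b = a)) fun a => rfl).trans ?_
      simp only [mul_comm _ (ind _), sum_ind_mul]
  | appLeft s h hM hT hS ih =>
    obtain ⟨π₂⟩ := hM.2
    refine ⟨hT, hS, fun g x => supDen_map_congr ih (fun a => π₂.den (s.snd g) a)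
      (fun _ => s.fst g) (fun a => (a, x)) fun X π₁ => ?_⟩
    rw [tmDen_eq (.app s π₁ π₂)]
    exact Finset.sum_congr rfl fun a _ => mul_comm _ _
  | appRight s hM h hT hS ih =>
    obtain ⟨π₁⟩ := hM.2
    refine ⟨hT, hS, fun g x => supDen_map_congr ih (fun a => π₁.den (s.fst g) (a, x))
      (fun _ => s.snd g) (fun a => a) fun X π₂ => ?_⟩
    rw [tmDen_eq (.app s π₁ π₂)]
    rfl
  | lam h ih =>
    -- Abstraction contracts no index: the new entry is a single old entry, hence the index type
    -- `Unit`.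
    refine ⟨ih.1.map fun M hM => ⟨hM.1, hM.2.map .lam⟩,
      ih.2.1.map fun M hM => ⟨hM.1, hM.2.map .lam⟩, fun g x =>
        supDen_map_congr (ι := Unit) ih (fun _ => 1) (fun _ => (x.1, g)) (fun _ => x.2)
          fun X π => ?_⟩
    rw [tmDen_eq π.lam, Fintype.sum_unique, one_mul]
    rfl
  | lamPair h ih =>
    refine ⟨ih.1.map fun M hM => ⟨hM.1, hM.2.map .lamPair⟩,
      ih.2.1.map fun M hM => ⟨hM.1, hM.2.map .lamPair⟩, fun g x =>
        supDen_map_congr (ι := Unit) ih (fun _ => 1) (fun _ => (x.1.2, (x.1.1, g)))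
          (fun _ => x.2) fun X π => ?_⟩
    rw [tmDen_eq π.lamPair, Fintype.sum_unique, one_mul]
    rfl
  | pairLeft s h hM hT hS ih =>
    obtain ⟨π₂⟩ := hM.2
    refine ⟨hT, hS, fun g x => supDen_map_congr (ι := Unit) ih
      (fun _ => π₂.den (s.snd g) x.2) (fun _ => s.fst g) (fun _ => x.1) fun X π₁ => ?_⟩
    rw [tmDen_eq (.pair s π₁ π₂), Fintype.sum_unique]
    exact mul_comm _ _
  | pairRight s hM h hT hS ih =>
    obtain ⟨π₁⟩ := hM.2
    refine ⟨hT, hS, fun g x => supDen_map_congr (ι := Unit) ih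
      (fun _ => π₁.den (s.fst g) x.1) (fun _ => s.snd g) (fun _ => x.2) fun X π₂ => ?_⟩
    rw [tmDen_eq (.pair s π₁ π₂), Fintype.sum_unique]
    rfl
  | sum α h hV ih =>
    exact ⟨ih.1.smul_add α hV, ih.2.1.smul_add α hV, fun g x => by
      simp only [map_add, map_smul, ih.2.2]⟩
  | refl h => exact ⟨h, h, fun g x => rfl⟩
  | symm h ih => exact ⟨ih.2.1, ih.1, fun g x => (ih.2.2 g x).symm⟩
  | trans h₁ h₂ ih₁ ih₂ =>
    exact ⟨ih₁.1, ih₂.2.1, fun g x => (ih₁.2.2 g x).trans (ih₂.2.2 g x)⟩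

end QLam
namespace QLam

/-! ### Runs of acyclic networks of gates -/

/-- A network of gates on a set of places: the gate `v` acts on the qubits at the places `arg v k`
and moves them to the places `res v k`. -/
structure Net (P : Type) where
  N : Type
  k : N → ℕ
  op : (v : N) → Matrix (Fin (k v) → Bool) (Fin (k v) → Bool) ℂ
  arg : (v : N) → Fin (k v) → P
  res : (v : N) → Fin (k v) → P

namespace Net

variable {P : Type}

/-- A gate fires. -/
inductive Step (W : Net P) {n : ℕ} : (Fin n → P) × Reg n → (Fin n → P) × Reg n → Prop
  | fire (φ : Fin n → P) (Q : Reg n) (v : W.N) (i : Fin (W.k v) → Fin n)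
      (hi : Function.Injective i) (hp : ∀ k, φ (i k) = W.arg v k) :
      Step W (φ, Q) (Function.extend i (W.res v) φ, applyAt (W.op v) i Q)

/-- The network is acyclic, and every place is either a source or a result of exactly one gate, and
either a sink or an argument of exactly one gate. -/
structure Good (W : Net P) {n m : ℕ} (src : Fin n → P) (snk : Fin m → P) : Prop where
  pos : ∀ v, 0 < W.k v
  arg_inj : ∀ x y : (v : W.N) × Fin (W.k v), W.arg x.1 x.2 = W.arg y.1 y.2 → x = y
  res_inj : ∀ x y : (v : W.N) × Fin (W.k v), W.res x.1 x.2 = W.res y.1 y.2 → x = y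
  src_inj : Function.Injective src
  snk_inj : Function.Injective snk
  src_iff : ∀ p, (∃ j, src j = p) ↔ ¬ ∃ v k, W.res v k = p
  snk_iff : ∀ p, (∃ j, snk j = p) ↔ ¬ ∃ v k, W.arg v k = p
  rank : ∃ r : P → ℚ, ∀ v k k', r (W.arg v k) < r (W.res v k')

variable {W : Net P} {n m : ℕ} {src : Fin n → P} {snk : Fin m → P}

/-- The place `p` is a source or a result of a gate in `E`. -/
def Produced (W : Net P) (src : Fin n → P) (E : Finset W.N) (p : P) : Prop :=
  (∃ j, src j = p) ∨ ∃ v ∈ E, ∃ k, W.res v k = p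

/-- The place `p` is an argument of a gate in `E`. -/
def Consumed (W : Net P) (E : Finset W.N) (p : P) : Prop := ∃ v ∈ E, ∃ k, W.arg v k = p

/-- The amplitude of an assignment of bits to the places, where only the gates in `E` count. -/
noncomputable def weight (W : Net P) (src : Fin n → P) (Q₀ : Reg n) (E : Finset W.N)
    (a : P → Bool) : ℂ :=
  Q₀ (fun j => a (src j)) * ∏ v ∈ E, W.op v (fun k => a (W.res v k)) (fun k => a (W.arg v k))

open Classical in
/-- A state which is reached by firing exactly the gates in `E`. -/
structure Inv (W : Net P) [Fintype P] (src : Fin n → P) (Q₀ : Reg n) (E : Finset W.N)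
    (φ : Fin n → P) (Q : Reg n) : Prop where
  inj : Function.Injective φ
  cur : ∀ p, (∃ j, φ j = p) ↔ Produced W src E p ∧ ¬ Consumed W E p
  closed : ∀ v ∈ E, ∀ k, Produced W src E (W.arg v k)
  -- The default `false` at places not yet reached selects one representative of each history, so
  -- that nothing is counted twice.
  value : ∀ z, Q z = ∑ a : P → Bool with
    (∀ j, a (φ j) = z j) ∧ ∀ p, ¬ Produced W src E p → a p = false, weight W src Q₀ E a

/-- Only the sources have been reached, so exactly one assignment is admissible: `z` on the sources
and `false` elsewhere. -/
theorem inv_initial [Fintype P] (h : W.Good src snk) (Q₀ : Reg n) : Inv W src Q₀ ∅ src Q₀ where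
  inj := h.src_inj
  cur p := by simp [Produced, Consumed]
  closed v hv := by simp at hv
  value z := by
    classical
    rw [Finset.sum_eq_single (Function.extend src z fun _ => false)]
    · simp [weight, h.src_inj.extend_apply]
    · intro a ha hne
      refine absurd (funext fun p => ?_) hne
      simp only [Finset.mem_filter, Finset.mem_univ, true_and, Produced, Finset.notMem_empty,
        false_and, exists_false, or_false] at ha
      by_cases hp : ∃ j, src j = p
      · obtain ⟨j, rfl⟩ := hp
        rw [h.src_inj.extend_apply, ha.1]
      · rw [Function.extend_apply' _ _ _ hp, ha.2 p hp]
    · intro hn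
      refine absurd (Finset.mem_filter.2 ⟨Finset.mem_univ _, fun j => ?_, fun p hp => ?_⟩) hn
      · exact h.src_inj.extend_apply _ _ _
      · exact Function.extend_apply' _ _ _ fun hj => hp (Or.inl hj)

theorem Inv.notMem [Fintype P] {E : Finset W.N} {φ : Fin n → P} {Q₀ Q : Reg n} (h : W.Good src snk)
    (hI : Inv W src Q₀ E φ Q) {v : W.N} {i : Fin (W.k v) → Fin n}
    (hp : ∀ k, φ (i k) = W.arg v k) : v ∉ E := fun hv =>
  ((hI.cur _).1 ⟨_, hp ⟨0, h.pos v⟩⟩).2 ⟨v, hv, _, rfl⟩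

theorem Good.not_produced (h : W.Good src snk) {E : Finset W.N} {v : W.N} (hv : v ∉ E)
    (k : Fin (W.k v)) : ¬ Produced W src E (W.res v k) := by
  rintro (hj | ⟨v', hv', k', e⟩)
  · exact (h.src_iff _).1 hj ⟨v, k, rfl⟩
  · obtain rfl : v' = v := congrArg Sigma.fst (h.res_inj ⟨v', k'⟩ ⟨v, k⟩ e)
    exact hv hv'

theorem Good.res_injective (h : W.Good src snk) (v : W.N) : Function.Injective (W.res v) :=
  fun k k' e => by simpa using h.res_inj ⟨v, k⟩ ⟨v, k'⟩ e

theorem Good.arg_injective (h : W.Good src snk) (v : W.N) : Function.Injective (W.arg v) :=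
  fun k k' e => by simpa using h.arg_inj ⟨v, k⟩ ⟨v, k'⟩ e

theorem produced_insert [DecidableEq W.N] {E : Finset W.N} {v : W.N} {p : P} :
    Produced W src (insert v E) p ↔ Produced W src E p ∨ ∃ k, W.res v k = p := by
  simp only [Produced, Finset.mem_insert, exists_eq_or_imp, or_assoc]
  exact or_congr_right or_comm

theorem consumed_insert [DecidableEq W.N] {E : Finset W.N} {v : W.N} {p : P} :
    Consumed W (insert v E) p ↔ Consumed W E p ∨ ∃ k, W.arg v k = p := by
  simp only [Consumed, Finset.mem_insert, exists_eq_or_imp]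
  exact or_comm

theorem weight_congr {E : Finset W.N} {Q₀ : Reg n} (hE : ∀ v ∈ E, ∀ k, Produced W src E (W.arg v k))
    {a b : P → Bool} (hab : ∀ p, Produced W src E p → a p = b p) :
    weight W src Q₀ E a = weight W src Q₀ E b := by
  unfold weight
  congr 1
  · exact congrArg Q₀ (funext fun j => hab _ (Or.inl ⟨j, rfl⟩))
  · refine Finset.prod_congr rfl fun v hv => congrArg₂ _ (funext fun k => ?_) (funext fun k => ?_)
    · exact hab _ (Or.inr ⟨v, hv, k, rfl⟩)
    · exact hab _ (hE v hv k)

open Classical in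
-- The sum over `c` in `applyAt` is absorbed into the sum over assignments: `c` must equal the
-- values of `a` at the arguments of the gate, while the tokens outside the range of `i` keep their
-- constraint.
theorem Inv.value_fire [Fintype P] {E : Finset W.N} {φ : Fin n → P} {Q₀ Q : Reg n}
    (hI : Inv W src Q₀ E φ Q) {v : W.N} {i : Fin (W.k v) → Fin n} (hi : Function.Injective i)
    (hp : ∀ k, φ (i k) = W.arg v k) (z : Fin n → Bool) :
    applyAt (W.op v) i Q z = ∑ a : P → Bool with
      (∀ j, (¬ ∃ k, i k = j) → a (φ j) = z j) ∧ ∀ p, ¬ Produced W src E p → a p = false,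
      W.op v (fun k => z (i k)) (fun k => a (W.arg v k)) * weight W src Q₀ E a := by
  simp only [applyAt, hI.value, Finset.mul_sum, Finset.sum_filter, mul_ite, mul_zero]
  rw [Finset.sum_comm]
  refine Finset.sum_congr rfl fun a _ => ?_
  rw [Finset.sum_eq_single fun k => a (W.arg v k)]
  · refine if_congr (and_congr_left fun _ => ⟨fun H j hj => ?_, fun H j => ?_⟩) rfl rfl
    · rw [H j, Function.extend_apply' _ _ _ hj]
    · by_cases hj : ∃ k, i k = j
      · obtain ⟨k, rfl⟩ := hj
        rw [hi.extend_apply, hp]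
      · rw [Function.extend_apply' _ _ _ hj, H j hj]
  · intro c _ hc
    refine if_neg fun H => hc (funext fun k => ?_)
    have := H.1 (i k)
    rw [hi.extend_apply, hp] at this
    exact this.symm
  · simp

/-- The result places of the gate had the default value before firing. Overwriting them with the
bits now carried by the tokens is a bijection between the old and the new assignments, with inverse
the reset to `false`, and the weight gains the matrix entry of the gate. -/
theorem Inv.fire [Fintype P] [DecidableEq W.N] {E : Finset W.N} {φ : Fin n → P} {Q₀ Q : Reg n}
    (h : W.Good src snk) (hI : Inv W src Q₀ E φ Q) {v : W.N} {i : Fin (W.k v) → Fin n}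
    (hi : Function.Injective i) (hp : ∀ k, φ (i k) = W.arg v k) :
    Inv W src Q₀ (insert v E) (Function.extend i (W.res v) φ) (applyAt (W.op v) i Q) := by
  have hv := hI.notMem h hp
  have hprod : ∀ k, Produced W src E (W.arg v k) := fun k => ((hI.cur _).1 ⟨_, hp k⟩).1
  have hres : ∀ k, ¬ Produced W src E (W.res v k) := h.not_produced hv
  have hφ : ∀ j, Produced W src E (φ j) := fun j => ((hI.cur _).1 ⟨j, rfl⟩).1
  have hcl : ∀ v' ∈ insert v E, ∀ k, Produced W src E (W.arg v' k) := fun v' hv' k => by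
    rcases Finset.mem_insert.1 hv' with rfl | hv'
    · exact hprod k
    · exact hI.closed v' hv' k
  refine ⟨fun j j' e => ?_, fun p => ?_, fun v' hv' k => ?_, fun z => ?_⟩
  · by_cases hj : ∃ k, i k = j <;> by_cases hj' : ∃ k, i k = j'
    · obtain ⟨k, rfl⟩ := hj
      obtain ⟨k', rfl⟩ := hj'
      rw [hi.extend_apply, hi.extend_apply] at e
      rw [h.res_injective v e]
    · obtain ⟨k, rfl⟩ := hj
      rw [hi.extend_apply, Function.extend_apply' _ _ _ hj'] at e
      exact absurd (hφ j') (e ▸ hres k)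
    · obtain ⟨k, rfl⟩ := hj'
      rw [hi.extend_apply, Function.extend_apply' _ _ _ hj] at e
      exact absurd (hφ j) (e ▸ hres k)
    · rw [Function.extend_apply' _ _ _ hj, Function.extend_apply' _ _ _ hj'] at e
      exact hI.inj e
  · rw [produced_insert, consumed_insert]
    constructor
    · rintro ⟨j, rfl⟩
      by_cases hj : ∃ k, i k = j
      · obtain ⟨k, rfl⟩ := hj
        rw [hi.extend_apply]
        refine ⟨Or.inr ⟨k, rfl⟩, ?_⟩
        rintro (⟨v', hv', k', e⟩ | ⟨k', e⟩)
        · exact hres k (e ▸ hI.closed v' hv' k')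
        · exact hres k (e ▸ hprod k')
      · rw [Function.extend_apply' _ _ _ hj]
        refine ⟨Or.inl (hφ j), ?_⟩
        rintro (hc | ⟨k', e⟩)
        · exact ((hI.cur _).1 ⟨j, rfl⟩).2 hc
        · exact hj ⟨k', hI.inj ((hp k').trans e)⟩
    · rintro ⟨hP | ⟨k, rfl⟩, hC⟩
      · obtain ⟨j, rfl⟩ := (hI.cur p).2 ⟨hP, fun hc => hC (Or.inl hc)⟩
        refine ⟨j, Function.extend_apply' _ _ _ ?_⟩
        rintro ⟨k, rfl⟩
        exact hC (Or.inr ⟨k, (hp k).symm⟩)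
      · exact ⟨i k, hi.extend_apply _ _ _⟩
  · exact produced_insert.2 (Or.inl (hcl v' hv' k))
  · classical
    rw [hI.value_fire hi hp]
    refine Finset.sum_bij' (fun a _ => Function.extend (W.res v) (fun k => z (i k)) a)
      (fun a _ => Function.extend (W.res v) (fun _ => false) a) ?_ ?_ ?_ ?_ ?_
    · intro a ha
      simp only [Finset.mem_filter, Finset.mem_univ, true_and] at ha ⊢
      refine ⟨fun j => ?_, fun p hp => ?_⟩
      · by_cases hj : ∃ k, i k = j
        · obtain ⟨k, rfl⟩ := hj
          rw [hi.extend_apply, (h.res_injective v).extend_apply]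
        · rw [Function.extend_apply' _ _ _ hj, Function.extend_apply', ha.1 j hj]
          rintro ⟨k, e⟩
          exact hres k (e ▸ hφ j)
      · rw [produced_insert, not_or] at hp
        rw [Function.extend_apply' _ _ _ hp.2, ha.2 p hp.1]
    · intro a ha
      simp only [Finset.mem_filter, Finset.mem_univ, true_and] at ha ⊢
      refine ⟨fun j hj => ?_, fun p hp => ?_⟩
      · have := ha.1 j
        rw [Function.extend_apply' _ _ _ hj] at this
        rw [Function.extend_apply', this]
        rintro ⟨k, e⟩
        exact hres k (e ▸ hφ j)
      · by_cases hk : ∃ k, W.res v k = p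
        · obtain ⟨k, rfl⟩ := hk
          exact (h.res_injective v).extend_apply _ _ _
        · rw [Function.extend_apply' _ _ _ hk]
          exact ha.2 p fun hP => (produced_insert.1 hP).elim hp hk
    · intro a ha
      have ha := (Finset.mem_filter.1 ha).2
      funext p
      by_cases hk : ∃ k, W.res v k = p
      · obtain ⟨k, rfl⟩ := hk
        rw [(h.res_injective v).extend_apply, ha.2 _ (hres k)]
      · rw [Function.extend_apply' _ _ _ hk, Function.extend_apply' _ _ _ hk]
    · intro a ha
      have ha := (Finset.mem_filter.1 ha).2
      funext p
      by_cases hk : ∃ k, W.res v k = p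
      · obtain ⟨k, rfl⟩ := hk
        have := ha.1 (i k)
        rw [hi.extend_apply] at this
        rw [(h.res_injective v).extend_apply, this]
      · rw [Function.extend_apply' _ _ _ hk, Function.extend_apply' _ _ _ hk]
    · intro a ha
      have hag : ∀ p, Produced W src E p →
          Function.extend (W.res v) (fun k => z (i k)) a p = a p := fun p hP =>
        Function.extend_apply' _ _ _ fun ⟨k, e⟩ => hres k (e ▸ hP)
      rw [← weight_congr hI.closed hag, weight, weight, Finset.prod_insert hv]
      simp only [(h.res_injective v).extend_apply, hag _ (hprod _)]
      ring

/-- Take an unfired gate having a result of least rank. If one of its arguments had not been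
produced, that argument would be a result, of smaller rank, of another unfired gate. It has not been
consumed either, because a place is an argument of only one gate. -/
theorem Inv.exists_enabled [Fintype P] {E : Finset W.N} {φ : Fin n → P} {Q₀ Q : Reg n}
    [Fintype W.N] (h : W.Good src snk) (hI : Inv W src Q₀ E φ Q) (hE : E ≠ Finset.univ) :
    ∃ v ∉ E, ∃ i : Fin (W.k v) → Fin n, Function.Injective i ∧ ∀ k, φ (i k) = W.arg v k := by
  classical
  obtain ⟨r, hr⟩ := h.rank
  obtain ⟨v₀, hv₀⟩ : ∃ v, v ∉ E := by
    by_contra hn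
    exact hE (Finset.eq_univ_iff_forall.2 (by simpa using hn))
  obtain ⟨⟨v, k₀⟩, hv, hmin⟩ := Finset.exists_min_image
    (Eᶜ.sigma fun v => (Finset.univ : Finset (Fin (W.k v)))) (fun x => r (W.res x.1 x.2))
    ⟨⟨v₀, ⟨0, h.pos v₀⟩⟩, by simpa using hv₀⟩
  simp only [Finset.mem_sigma, Finset.mem_compl, Finset.mem_univ, and_true] at hv hmin
  have hcur : ∀ k, ∃ j, φ j = W.arg v k := fun k => by
    refine (hI.cur _).2 ⟨?_, ?_⟩
    · by_contra hn
      obtain ⟨v', k', e⟩ : ∃ v' k', W.res v' k' = W.arg v k := by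
        by_contra hn'
        exact hn (Or.inl ((h.src_iff _).2 hn'))
      refine absurd (hmin ⟨v', k'⟩ fun hv' => hn (Or.inr ⟨v', hv', k', e⟩)) (not_le.2 ?_)
      simpa only [e] using hr v k k₀
    · rintro ⟨v', hv', k', e⟩
      obtain rfl : v' = v := congrArg Sigma.fst (h.arg_inj ⟨v', k'⟩ ⟨v, k⟩ e)
      exact hv hv'
  choose i hi using hcur
  refine ⟨v, hv, i, fun k k' e => h.arg_injective v ?_, hi⟩
  rw [← hi, ← hi, e]

theorem Inv.of_run [Fintype P] {Q₀ : Reg n} (h : W.Good src snk) {s : (Fin n → P) × Reg n}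
    (hs : Relation.ReflTransGen W.Step (src, Q₀) s) : ∃ E, Inv W src Q₀ E s.1 s.2 := by
  classical
  induction hs with
  | refl => exact ⟨∅, inv_initial h Q₀⟩
  | tail _ hst ih =>
    obtain ⟨E, hI⟩ := ih
    cases hst with
    | fire φ Q v i hi hp => exact ⟨_, hI.fire h hi hp⟩

theorem Inv.exists_run [Fintype P] [Fintype W.N] {Q₀ : Reg n} (h : W.Good src snk)
    {E : Finset W.N} {s : (Fin n → P) × Reg n} (hI : Inv W src Q₀ E s.1 s.2) :
    ∃ s', Relation.ReflTransGen W.Step s s' ∧ Inv W src Q₀ Finset.univ s'.1 s'.2 := by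
  classical
  by_cases hE : E = Finset.univ
  · exact ⟨s, .refl, hE ▸ hI⟩
  · obtain ⟨v, hv, i, hi, hp⟩ := hI.exists_enabled h hE
    obtain ⟨s', hs', hI'⟩ := Inv.exists_run h (s := (_, _)) (hI.fire h hi hp)
    exact ⟨s', .head (.fire s.1 s.2 v i hi hp) hs', hI'⟩
termination_by Fintype.card W.N - E.card
decreasing_by
  classical
  have := Finset.card_lt_univ_of_notMem hv
  rw [Finset.card_insert_of_notMem hv]
  omega

/-- Once all gates have fired, every place has been produced, and the places not consumed are the
sinks. -/
theorem Inv.exists_equiv [Fintype P] [Fintype W.N] {φ : Fin n → P} {Q₀ Q : Reg n}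
    (h : W.Good src snk) (hI : Inv W src Q₀ Finset.univ φ Q) :
    ∃ σ : Fin n ≃ Fin m, ∀ j, φ j = snk (σ j) := by
  have hcur : ∀ p, (∃ j, φ j = p) ↔ ∃ j, snk j = p := fun p => by
    rw [hI.cur, h.snk_iff]
    simp only [Produced, Consumed, Finset.mem_univ, true_and, h.src_iff]
    exact and_iff_right (em' _)
  choose f hf using fun j => (hcur (φ j)).1 ⟨j, rfl⟩
  refine ⟨Equiv.ofBijective f ⟨fun j j' e => hI.inj ?_, fun j => ?_⟩, fun j => (hf j).symm⟩
  · rw [← hf, ← hf, e]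
  · obtain ⟨j', hj'⟩ := (hcur (snk j)).2 ⟨j, rfl⟩
    exact ⟨j', h.snk_inj ((hf j').trans hj')⟩

/-- Every run can be completed, so that the tokens stand at the sinks. -/
theorem Good.exists_run [Fintype P] [Fintype W.N] (h : W.Good src snk) (Q₀ : Reg n) :
    ∃ s, Relation.ReflTransGen W.Step (src, Q₀) s ∧
      ∃ σ : Fin n ≃ Fin m, ∀ j, s.1 j = snk (σ j) := by
  obtain ⟨s, hs, hI⟩ := Inv.exists_run h (s := (src, Q₀)) (inv_initial h Q₀)
  exact ⟨s, hs, hI.exists_equiv h⟩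

open Classical in
/-- The register of a state in which all tokens stand at the sinks. -/
theorem Good.run_eq [Fintype P] [Fintype W.N] (h : W.Good src snk) {Q₀ : Reg n}
    {s : (Fin n → P) × Reg n} (hs : Relation.ReflTransGen W.Step (src, Q₀) s)
    (σ : Fin n ≃ Fin m) (hσ : ∀ j, s.1 j = snk (σ j)) (c : Fin m → Bool) :
    s.2 (fun j => c (σ j)) = ∑ a : P → Bool with ∀ j, a (snk j) = c j,
      weight W src Q₀ Finset.univ a := by
  obtain ⟨E, hI⟩ := Inv.of_run h hs
  -- If some gate had not fired, one would be enabled, with a token at an argument. But the tokens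
  -- stand at sinks, and sinks are not arguments.
  obtain rfl : E = Finset.univ := by
    by_contra hE
    obtain ⟨v, -, i, -, hp⟩ := hI.exists_enabled h hE
    refine (h.snk_iff (W.arg v ⟨0, h.pos v⟩)).1 ⟨σ (i ⟨0, h.pos v⟩), ?_⟩ ⟨v, _, rfl⟩
    rw [← hσ, hp]
  rw [hI.value]
  refine Finset.sum_congr (Finset.filter_congr fun a _ => ?_) fun _ _ => rfl
  -- With all gates fired no place is left at its default value, so only the constraint at the sinks
  -- remains.
  have : ∀ p, Produced W src Finset.univ p := fun p => by
    simp only [Produced, Finset.mem_univ, true_and, h.src_iff]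
    exact em' _
  simp only [this, not_true, false_imp_iff, implies_true, and_true, hσ]
  exact ⟨fun H j => by simpa using H (σ.symm j), fun H j => H _⟩

end Net

end QLam
namespace QLam

/-! ### Places linked by an inference -/

/-- Places with one-token moves `Mv`, a boundary of inputs and outputs, and places `B` where tokens
are created. -/
structure Flow where
  P : Type
  J : Type
  root : J → P
  out : J → Bool
  Mv : P → P → Prop
  B : P → Prop

namespace Flow

/-- The juxtaposition of two flows. -/
def union (F₁ F₂ : Flow) : Flow where
  P := F₁.P ⊕ F₂.P
  J := F₁.J ⊕ F₂.J
  root := Sum.map F₁.root F₂.root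
  out := Sum.elim F₁.out F₂.out
  Mv := Sum.LiftRel F₁.Mv F₂.Mv
  B := Sum.elim F₁.B F₂.B

/-- The moves along `Mv` (`f = true`) or backwards (`f = false`). -/
def Dir (F : Flow) (f : Bool) (p q : F.P) : Prop := if f then F.Mv p q else F.Mv q p

/-- The ways in which a token may leave (`f = true`) or reach (`f = false`) the place `p`: across
the boundary, by a move, through a gate (`g` lists the arguments, respectively the results, of the
gates), or by being created. -/
def Way (F : Flow) (f : Bool) {X : Type} (g : X → F.P) (p : F.P) : F.J ⊕ F.P ⊕ X ⊕ Unit → Prop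
  | .inl j => F.out j = f ∧ F.root j = p
  | .inr (.inl q) => F.Dir f p q
  | .inr (.inr (.inl x)) => g x = p
  | .inr (.inr (.inr _)) => f = false ∧ F.B p

/-- There is exactly one way to leave (to reach) each place. -/
def Exact (F : Flow) (f : Bool) {X : Type} (g : X → F.P) : Prop := ∀ p, ∃! t, F.Way f g p t

/-- `F` arises from `F'` by adding new boundary places: each boundary place of `F'` is linked to a
new one or to another boundary place of `F'`. -/
structure IsGlue (F' F : Flow) (sub : F'.P → F.P) (mate : F'.J → F.J ⊕ F'.J) : Prop where
  bij : Function.Bijective (Sum.elim F.root sub)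
  dir : ∀ P Q, F.Mv P Q ↔ (∃ p q, F'.Mv p q ∧ P = sub p ∧ Q = sub q) ∨
    ∃ o, (F'.out o = true ∧ P = sub (F'.root o) ∧
        Q = Sum.elim F.root (fun o' => sub (F'.root o')) (mate o)) ∨
      (F'.out o = false ∧ Q = sub (F'.root o) ∧
        P = Sum.elim F.root (fun o' => sub (F'.root o')) (mate o))
  bit : ∀ P, F.B P ↔ ∃ p, F'.B p ∧ P = sub p
  surj : ∀ j, ∃ o, mate o = .inl j
  inj : ∀ o o' j, mate o = .inl j → mate o' = .inl j → o = o'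
  symm : ∀ o o', mate o = .inr o' → mate o' = .inr o
  out_inl : ∀ o j, mate o = .inl j → F.out j = F'.out o
  out_inr : ∀ o o', mate o = .inr o' → F'.out o' = !F'.out o

variable {F F' F₁ F₂ : Flow} {sub : F'.P → F.P} {mate : F'.J → F.J ⊕ F'.J}

theorem IsGlue.dir_iff (h : IsGlue F' F sub mate) (f : Bool) (P Q : F.P) :
    F.Dir f P Q ↔ (∃ p q, F'.Dir f p q ∧ P = sub p ∧ Q = sub q) ∨
    ∃ o, (F'.out o = f ∧ P = sub (F'.root o) ∧
        Q = Sum.elim F.root (fun o' => sub (F'.root o')) (mate o)) ∨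
      (F'.out o = !f ∧ Q = sub (F'.root o) ∧
        P = Sum.elim F.root (fun o' => sub (F'.root o')) (mate o)) := by
  cases f with
  | true => simpa [Dir] using h.dir P Q
  | false =>
    simp only [Dir, h.dir, Bool.false_eq_true, if_false, Bool.not_false]
    refine or_congr ⟨?_, ?_⟩ (exists_congr fun o => or_comm)
    · rintro ⟨p, q, h, rfl, rfl⟩
      exact ⟨q, p, h, rfl, rfl⟩
    · rintro ⟨p, q, h, rfl, rfl⟩
      exact ⟨q, p, h, rfl, rfl⟩

theorem IsGlue.root_ne (h : IsGlue F' F sub mate) (j : F.J) (p : F'.P) : F.root j ≠ sub p :=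
  fun e => by simpa using h.bij.1 (a₁ := .inl j) (a₂ := .inr p) e

theorem IsGlue.sub_inj (h : IsGlue F' F sub mate) {p q : F'.P} (e : sub p = sub q) : p = q := by
  simpa using h.bij.1 (a₁ := .inr p) (a₂ := .inr q) e

theorem IsGlue.root_inj (h : IsGlue F' F sub mate) {p q : F.J} (e : F.root p = F.root q) :
    p = q := by
  simpa using h.bij.1 (a₁ := .inl p) (a₂ := .inl q) e

theorem IsGlue.cases (h : IsGlue F' F sub mate) (P : F.P) :
    (∃ j, P = F.root j) ∨ ∃ p, P = sub p := by
  obtain ⟨x | x, rfl⟩ := h.bij.2 P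
  · exact .inl ⟨x, rfl⟩
  · exact .inr ⟨x, rfl⟩

/-- Crossing the boundary of `F'` turns into the move to the mate; every other way is inherited. A
new boundary place is passed in one direction across the new boundary, and in the other only by the
link with its unique mate. -/
theorem Exact.glue (h : IsGlue F' F sub mate) {f : Bool} {X : Type} {g : X → F'.P}
    (hg : F'.Exact f g) : F.Exact f fun x => sub (g x) := by
  intro P
  rcases h.cases P with ⟨j, rfl⟩ | ⟨p, rfl⟩
  · by_cases hj : F.out j = f
    · refine ⟨.inl j, ⟨hj, rfl⟩, ?_⟩
      rintro (j' | q | x | u) ht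
      · rw [h.root_inj ht.2]
      · rcases (h.dir_iff f _ _).1 ht with ⟨p, q, -, e, -⟩ | ⟨o, ⟨-, e, -⟩ | ⟨ho, -, e⟩⟩
        · exact absurd e (h.root_ne _ _)
        · exact absurd e (h.root_ne _ _)
        · cases hm : mate o with
          | inl j' =>
            rw [hm] at e
            rw [← h.root_inj e] at hm
            rw [← h.out_inl o j hm, hj] at ho
            simp at ho
          | inr o' =>
            rw [hm] at e
            exact absurd e (h.root_ne _ _)
      · exact absurd ht.symm (h.root_ne _ _)
      · obtain ⟨p, -, e⟩ := (h.bit _).1 ht.2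
        exact absurd e (h.root_ne _ _)
    · obtain ⟨o, ho⟩ := h.surj j
      refine ⟨.inr (.inl (sub (F'.root o))), (h.dir_iff f _ _).2 (.inr ⟨o, .inr ⟨?_, rfl, ?_⟩⟩), ?_⟩
      · rw [← h.out_inl o j ho]
        exact Bool.eq_not_of_ne hj
      · rw [ho]
        rfl
      · rintro (j' | q | x | u) ht
        · obtain rfl := h.root_inj ht.2
          exact absurd ht.1 hj
        · rcases (h.dir_iff f _ _).1 ht with ⟨p, q, -, e, -⟩ | ⟨o', ⟨-, e, -⟩ | ⟨-, e', e⟩⟩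
          · exact absurd e (h.root_ne _ _)
          · exact absurd e (h.root_ne _ _)
          · cases hm : mate o' with
            | inl j' =>
              rw [hm] at e
              rw [← h.root_inj e] at hm
              rw [e', h.inj _ _ _ ho hm]
            | inr o' =>
              rw [hm] at e
              exact absurd e (h.root_ne _ _)
        · exact absurd ht.symm (h.root_ne _ _)
        · obtain ⟨p, -, e⟩ := (h.bit _).1 ht.2
          exact absurd e (h.root_ne _ _)
  · obtain ⟨t, ht, hu⟩ := hg p
    -- a boundary place of the premise is linked to its mate
    have hroot : ∀ o q, F'.out o = f → F'.root o = p → F.Dir f (sub p) q →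
        q = Sum.elim F.root (fun o' => sub (F'.root o')) (mate o) := by
      intro o q ho hop hd
      have hto : Sum.inl o = t := hu (.inl o) ⟨ho, hop⟩
      rcases (h.dir_iff f _ _).1 hd with ⟨p', q', hd', e, -⟩ | ⟨o', ⟨ho', e, e'⟩ | ⟨ho', e', e⟩⟩
      · rw [← h.sub_inj e] at hd'
        simpa [← hto] using hu (.inr (.inl q')) hd'
      · have := hu (.inl o') ⟨ho', (h.sub_inj e).symm⟩
        rw [← hto, Sum.inl.injEq] at this
        rw [e', this]
      · cases hm : mate o' with
        | inl j' =>
          rw [hm] at e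
          exact absurd e.symm (h.root_ne _ _)
        | inr o₂ =>
          rw [hm] at e
          have := hu (.inl o₂) ⟨by rw [h.out_inr _ _ hm, ho', Bool.not_not], (h.sub_inj e).symm⟩
          rw [← hto, Sum.inl.injEq] at this
          rw [e', ← this, h.symm _ _ hm]
          rfl
    have hmove : ∀ q, F.Dir f (sub p) q → (∀ o, t ≠ .inl o) → ∃ q', F'.Dir f p q' ∧ q = sub q' := by
      intro q hd hno
      rcases (h.dir_iff f _ _).1 hd with ⟨p', q', hd', e, e'⟩ | ⟨o', ⟨ho', e, e'⟩ | ⟨ho', e', e⟩⟩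
      · rw [← h.sub_inj e] at hd'
        exact ⟨q', hd', e'⟩
      · exact absurd (hu (.inl o') ⟨ho', (h.sub_inj e).symm⟩).symm (hno _)
      · cases hm : mate o' with
        | inl j' =>
          rw [hm] at e
          exact absurd e.symm (h.root_ne _ _)
        | inr o₂ =>
          rw [hm] at e
          exact absurd (hu (.inl o₂)
            ⟨by rw [h.out_inr _ _ hm, ho', Bool.not_not], (h.sub_inj e).symm⟩).symm (hno _)
    have hgate : ∀ x, sub (g x) = sub p → t = .inr (.inr (.inl x)) := fun x e =>
      (hu (.inr (.inr (.inl x))) (h.sub_inj e)).symm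
    have hbit : f = false → F.B (sub p) → t = .inr (.inr (.inr ())) := fun hf hb => by
      obtain ⟨p', hb', e⟩ := (h.bit _).1 hb
      rw [← h.sub_inj e] at hb'
      exact (hu (.inr (.inr (.inr ()))) ⟨hf, hb'⟩).symm
    rcases t with o | q | x | u
    · refine ⟨.inr (.inl (Sum.elim F.root (fun o' => sub (F'.root o')) (mate o))),
        (h.dir_iff f _ _).2 (.inr ⟨o, .inl ⟨ht.1, by rw [ht.2], rfl⟩⟩), ?_⟩
      rintro (j' | q | x | u) ht'
      · exact absurd ht'.2 (h.root_ne _ _)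
      · rw [hroot o q ht.1 ht.2 ht']
      · simpa using hgate x ht'
      · simpa using hbit ht'.1 ht'.2
    · refine ⟨.inr (.inl (sub q)), (h.dir_iff f _ _).2 (.inl ⟨p, q, ht, rfl, rfl⟩), ?_⟩
      rintro (j' | q | x | u) ht'
      · exact absurd ht'.2 (h.root_ne _ _)
      · obtain ⟨q', hq', rfl⟩ := hmove q ht' (by simp)
        simpa using congrArg (Sum.map id (Sum.map sub id)) (hu (.inr (.inl q')) hq')
      · simpa using hgate x ht'
      · simpa using hbit ht'.1 ht'.2
    · refine ⟨.inr (.inr (.inl x)), congrArg sub ht, ?_⟩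
      rintro (j' | q | x | u) ht'
      · exact absurd ht'.2 (h.root_ne _ _)
      · obtain ⟨q', hq', rfl⟩ := hmove q ht' (by simp)
        simpa using hu (.inr (.inl q')) hq'
      · simpa using (hgate x ht').symm
      · simpa using hbit ht'.1 ht'.2
    · refine ⟨.inr (.inr (.inr u)), ⟨ht.1, (h.bit _).2 ⟨p, ht.2, rfl⟩⟩, ?_⟩
      rintro (j' | q | x | u) ht'
      · exact absurd ht'.2 (h.root_ne _ _)
      · obtain ⟨q', hq', rfl⟩ := hmove q ht' (by simp)
        simpa using hu (.inr (.inl q')) hq'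
      · simpa using hgate x ht'
      · rfl

theorem Exact.union {f : Bool} {X₁ X₂ : Type} {g₁ : X₁ → F₁.P} {g₂ : X₂ → F₂.P}
    (h₁ : F₁.Exact f g₁) (h₂ : F₂.Exact f g₂) : (F₁.union F₂).Exact f (Sum.map g₁ g₂) := by
  have dir₁ : ∀ p q, (F₁.union F₂).Dir f (.inl p) (.inl q) ↔ F₁.Dir f p q := fun p q => by
    cases f <;> exact Sum.liftRel_inl_inl
  have dir₂ : ∀ p q, (F₁.union F₂).Dir f (.inr p) (.inr q) ↔ F₂.Dir f p q := fun p q => by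
    cases f <;> exact Sum.liftRel_inr_inr
  have dir₃ : ∀ p q, ¬ (F₁.union F₂).Dir f (.inl p) (.inr q) := fun p q => by
    cases f
    · exact Sum.not_liftRel_inr_inl
    · exact Sum.not_liftRel_inl_inr
  have dir₄ : ∀ p q, ¬ (F₁.union F₂).Dir f (.inr p) (.inl q) := fun p q => by
    cases f
    · exact Sum.not_liftRel_inl_inr
    · exact Sum.not_liftRel_inr_inl
  rintro (p | p)
  · obtain ⟨t, ht, hu⟩ := h₁ p
    refine ⟨Sum.map Sum.inl (Sum.map Sum.inl (Sum.map Sum.inl id)) t, ?_, ?_⟩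
    · rcases t with o | q | x | u
      · exact ⟨ht.1, congrArg Sum.inl ht.2⟩
      · exact (dir₁ p q).2 ht
      · exact congrArg Sum.inl ht
      · exact ht
    · rintro ((o | o) | (q | q) | (x | x) | u) ht'
      · rw [← hu (.inl o) ⟨ht'.1, Sum.inl_injective ht'.2⟩]
        rfl
      · exact absurd ht'.2 Sum.inr_ne_inl
      · rw [← hu (.inr (.inl q)) ((dir₁ p q).1 ht')]
        rfl
      · exact absurd ht' (dir₃ _ _)
      · rw [← hu (.inr (.inr (.inl x))) (Sum.inl_injective ht')]
        rfl
      · exact absurd ht' Sum.inr_ne_inl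
      · rw [← hu (.inr (.inr (.inr u))) ht']
        rfl
  · obtain ⟨t, ht, hu⟩ := h₂ p
    refine ⟨Sum.map Sum.inr (Sum.map Sum.inr (Sum.map Sum.inr id)) t, ?_, ?_⟩
    · rcases t with o | q | x | u
      · exact ⟨ht.1, congrArg Sum.inr ht.2⟩
      · exact (dir₂ p q).2 ht
      · exact congrArg Sum.inr ht
      · exact ht
    · rintro ((o | o) | (q | q) | (x | x) | u) ht'
      · exact absurd ht'.2 Sum.inl_ne_inr
      · rw [← hu (.inl o) ⟨ht'.1, Sum.inr_injective ht'.2⟩]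
        rfl
      · exact absurd ht' (dir₄ _ _)
      · rw [← hu (.inr (.inl q)) ((dir₂ p q).1 ht')]
        rfl
      · exact absurd ht' Sum.inl_ne_inr
      · rw [← hu (.inr (.inr (.inl x))) (Sum.inr_injective ht')]
        rfl
      · rw [← hu (.inr (.inr (.inr u))) ht']
        rfl

theorem Exact.reindex {f : Bool} {X Y : Type} {g : X → F.P} (hg : F.Exact f g) (e : Y ≃ X) :
    F.Exact f fun y => g (e y) := by
  intro p
  obtain ⟨t, ht, hu⟩ := hg p
  refine ⟨Sum.map id (Sum.map id (Sum.map e.symm id)) t, ?_, ?_⟩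
  · rcases t with o | q | x | u
    · exact ht
    · exact ht
    · show g (e (e.symm x)) = p
      rw [e.apply_symm_apply]
      exact ht
    · exact ht
  · rintro (o | q | x | u) ht'
    · rw [← hu (.inl o) ht']
      rfl
    · rw [← hu (.inr (.inl q)) ht']
      rfl
    · rw [← hu (.inr (.inr (.inl (e x)))) ht']
      simp
    · rw [← hu (.inr (.inr (.inr u))) ht']
      rfl

/-- A ranking of the places which increases along the moves. -/
def Mono (F : Flow) (r : F.P → ℚ) : Prop := ∀ p q, F.Mv p q → r p < r q

/-- The values `y` at the boundary are compatible with the ranking `r`. -/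
def Fits (F : Flow) (r : F.P → ℚ) (y : F.J → ℚ) : Prop :=
  ∀ j, (F.out j = true → r (F.root j) < y j) ∧ (F.out j = false → y j < r (F.root j))

/-- By density of ℚ, each new boundary place can be ranked strictly between its mate and the
prescribed boundary value. Old ranks are kept, so links between two old boundary places must already
increase, which is `hm`. -/
theorem IsGlue.exists_rank (h : IsGlue F' F sub mate) {r' : F'.P → ℚ} (hr : F'.Mono r')
    {y : F.J → ℚ} {y' : F'.J → ℚ} (hy : F'.Fits r' y') (hyy : ∀ o j, mate o = .inl j → y j = y' o)
    (hm : ∀ o o', mate o = .inr o' → F'.out o = true → r' (F'.root o) < r' (F'.root o')) :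
    ∃ r : F.P → ℚ, F.Mono r ∧ F.Fits r y ∧ ∀ p, r (sub p) = r' p := by
  have hx : ∀ j, ∃ x : ℚ, ∀ o, mate o = .inl j →
      (F'.out o = true → r' (F'.root o) < x ∧ x < y j) ∧
        (F'.out o = false → y j < x ∧ x < r' (F'.root o)) := fun j => by
    obtain ⟨o, ho⟩ := h.surj j
    have hj := hyy o j ho
    cases hout : F'.out o with
    | true =>
      obtain ⟨x, h₁, h₂⟩ := exists_between ((hy o).1 hout)
      refine ⟨x, fun o' ho' => ?_⟩
      rw [h.inj _ _ _ ho' ho, hout, hj]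
      exact ⟨fun _ => ⟨h₁, h₂⟩, fun e => by simp at e⟩
    | false =>
      obtain ⟨x, h₁, h₂⟩ := exists_between ((hy o).2 hout)
      refine ⟨x, fun o' ho' => ?_⟩
      rw [h.inj _ _ _ ho' ho, hout, hj]
      exact ⟨fun e => by simp at e, fun _ => ⟨h₁, h₂⟩⟩
  choose x hx using hx
  let e := Equiv.ofBijective _ h.bij
  have hroot : ∀ j, Sum.elim x r' (e.symm (F.root j)) = x j := fun j => by
    rw [show F.root j = e (.inl j) from rfl, e.symm_apply_apply]
    rfl
  have hsub : ∀ p, Sum.elim x r' (e.symm (sub p)) = r' p := fun p => by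
    rw [show sub p = e (.inr p) from rfl, e.symm_apply_apply]
    rfl
  refine ⟨fun p => Sum.elim x r' (e.symm p), fun P Q hPQ => ?_, fun j => ?_, hsub⟩
  · rcases (h.dir _ _).1 hPQ with ⟨p, q, hpq, rfl, rfl⟩ | ⟨o, ⟨ho, rfl, rfl⟩ | ⟨ho, rfl, rfl⟩⟩
    · simpa only [hsub] using hr p q hpq
    · cases hmo : mate o with
      | inl j => simpa only [Sum.elim_inl, hsub, hroot] using ((hx j o hmo).1 ho).1
      | inr o' => simpa only [Sum.elim_inr, hsub] using hm o o' hmo ho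
    · cases hmo : mate o with
      | inl j => simpa only [Sum.elim_inl, hsub, hroot] using ((hx j o hmo).2 ho).2
      | inr o' =>
        simpa only [Sum.elim_inr, hsub] using
          hm o' o (h.symm _ _ hmo) (by rw [h.out_inr _ _ hmo, ho]; rfl)
  · obtain ⟨o, ho⟩ := h.surj j
    simp only [hroot]
    rw [h.out_inl o j ho]
    exact ⟨fun e => ((hx j o ho).1 e).2, fun e => ((hx j o ho).2 e).1⟩

/-- The moves do not change the values `a`. -/
def Const (F : Flow) (a : F.P → Bool) : Prop := ∀ p q, F.Mv p q → a p = a q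

theorem IsGlue.const_iff (h : IsGlue F' F sub mate) (a : F.P → Bool) :
    F.Const a ↔ F'.Const (fun p => a (sub p)) ∧ ∀ o, a (sub (F'.root o)) =
      Sum.elim (fun j => a (F.root j)) (fun o' => a (sub (F'.root o'))) (mate o) := by
  have helim : ∀ o, a (Sum.elim F.root (fun o' => sub (F'.root o')) (mate o)) =
      Sum.elim (fun j => a (F.root j)) (fun o' => a (sub (F'.root o'))) (mate o) := fun o => by
    cases mate o <;> rfl
  constructor
  · intro ha
    refine ⟨fun p q hpq => ha _ _ ((h.dir _ _).2 (.inl ⟨p, q, hpq, rfl, rfl⟩)), fun o => ?_⟩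
    rw [← helim]
    cases ho : F'.out o with
    | true => exact ha _ _ ((h.dir _ _).2 (.inr ⟨o, .inl ⟨ho, rfl, rfl⟩⟩))
    | false => exact (ha _ _ ((h.dir _ _).2 (.inr ⟨o, .inr ⟨ho, rfl, rfl⟩⟩))).symm
  · rintro ⟨ha, hm⟩ P Q hPQ
    rcases (h.dir _ _).1 hPQ with ⟨p, q, hpq, rfl, rfl⟩ | ⟨o, ⟨-, rfl, rfl⟩ | ⟨-, rfl, rfl⟩⟩
    · exact ha p q hpq
    · rw [hm, helim]
    · rw [hm, helim]

theorem sum_ind_eq {X Y : Type} [Fintype X] [Fintype Y] {C : Y → Prop} {f : Y → ℂ} (e : X → Y)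
    (he : Function.Injective e) (hC : ∀ y, C y ↔ ∃ x, e x = y) :
    ∑ y, ind (C y) * f y = ∑ x, f (e x) := by
  classical
  simp only [ind, ite_mul, one_mul, zero_mul, ← Finset.sum_filter]
  rw [← Finset.sum_image (s := Finset.univ) (g := e) (f := f) fun a _ b _ h => he h]
  refine Finset.sum_congr (Finset.ext fun y => ?_) fun _ _ => rfl
  simp [hC]

open Classical in
/-- The sum of `w` over the assignments with boundary values `x` which are constant along moves. -/
noncomputable def total (F : Flow) [Fintype F.P] (w : (F.P → Bool) → ℂ) (x : F.J → Bool) : ℂ :=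
  ∑ a : F.P → Bool, ind (∀ j, a (F.root j) = x j) * (ind (F.Const a) * w a)

/-- The new places lie on the boundary, so their values are prescribed by `x`. What remains is an
assignment to the old places whose boundary values agree along the links; grouping by these values
`x'` gives the contraction. -/
theorem IsGlue.total_eq [Fintype F.P] [Fintype F'.P] [Fintype F'.J] [DecidableEq F'.J]
    (h : IsGlue F' F sub mate) (w : (F'.P → Bool) → ℂ) (x : F.J → Bool) :
    F.total (fun a => w fun p => a (sub p)) x =
      ∑ x' : F'.J → Bool, ind (∀ o, x' o = Sum.elim x x' (mate o)) * F'.total w x' := by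
  classical
  let e := Equiv.ofBijective _ h.bij
  have h₁ : F.total (fun a => w fun p => a (sub p)) x = ∑ a' : F'.P → Bool,
      ind (∀ o, a' (F'.root o) = Sum.elim x (fun o' => a' (F'.root o')) (mate o)) *
        (ind (F'.Const a') * w a') := by
    have hroot : ∀ (a' : F'.P → Bool) j, Sum.elim x a' (e.symm (F.root j)) = x j := fun a' j => by
      rw [show F.root j = e (.inl j) from rfl, e.symm_apply_apply]
      rfl
    have hsub : ∀ (a' : F'.P → Bool) p, Sum.elim x a' (e.symm (sub p)) = a' p := fun a' p => by
      rw [show sub p = e (.inr p) from rfl, e.symm_apply_apply]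
      rfl
    refine (sum_ind_eq (fun a' P => Sum.elim x a' (e.symm P)) (fun a b hab => funext fun p => ?_)
      (fun a => ⟨fun ha => ⟨fun p => a (sub p), funext fun P => ?_⟩, ?_⟩)).trans ?_
    · exact (hsub a p).symm.trans ((congrFun hab (sub p)).trans (hsub b p))
    · rcases h.cases P with ⟨j, rfl⟩ | ⟨p, rfl⟩
      · rw [hroot, ha]
      · rw [hsub]
    · rintro ⟨a', rfl⟩ j
      exact hroot a' j
    · refine Finset.sum_congr rfl fun a' _ => ?_
      rw [h.const_iff, ind_and]
      simp only [hroot, hsub]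
      ring
  rw [h₁]
  unfold total
  simp only [Finset.mul_sum]
  rw [Finset.sum_comm]
  refine Finset.sum_congr rfl fun a' _ => ?_
  rw [Finset.sum_eq_single fun o => a' (F'.root o)]
  · rw [ind_true fun j => rfl, one_mul]
  · intro x' _ hx'
    rw [ind_false (p := ∀ j, a' (F'.root j) = x' j) fun H => hx' (funext fun o => (H o).symm)]
    ring
  · simp

theorem total_union [Fintype F₁.P] [Fintype F₂.P] [Fintype (F₁.union F₂).P]
    (w₁ : (F₁.P → Bool) → ℂ) (w₂ : (F₂.P → Bool) → ℂ) (x : (F₁.union F₂).J → Bool) :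
    (F₁.union F₂).total (fun a => w₁ (fun p => a (.inl p)) * w₂ (fun p => a (.inr p))) x =
      F₁.total w₁ (fun j => x (.inl j)) * F₂.total w₂ (fun j => x (.inr j)) := by
  classical
  unfold total
  rw [Finset.sum_mul_sum]
  let e : ((F₁.union F₂).P → Bool) ≃ (F₁.P → Bool) × (F₂.P → Bool) :=
    Equiv.sumArrowEquivProdArrow F₁.P F₂.P Bool
  refine (Fintype.sum_equiv e _
    (fun p : (F₁.P → Bool) × (F₂.P → Bool) =>
      ind (∀ j, p.1 (F₁.root j) = x (.inl j)) * (ind (F₁.Const p.1) * w₁ p.1) *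
        (ind (∀ j, p.2 (F₂.root j) = x (.inr j)) * (ind (F₂.Const p.2) * w₂ p.2)))
    fun a => ?_).trans (Fintype.sum_prod_type _)
  have h₁ : (∀ j, a ((F₁.union F₂).root j) = x j) ↔
      (∀ j, a (.inl (F₁.root j)) = x (.inl j)) ∧ ∀ j, a (.inr (F₂.root j)) = x (.inr j) :=
    Sum.forall
  have h₂ : (F₁.union F₂).Const a ↔
      F₁.Const (fun p => a (.inl p)) ∧ F₂.Const fun p => a (.inr p) := by
    refine ⟨fun H => ⟨fun p q h => H _ _ (.inl h), fun p q h => H _ _ (.inr h)⟩, ?_⟩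
    rintro ⟨H₁, H₂⟩ _ _ (h | h)
    · exact H₁ _ _ h
    · exact H₂ _ _ h
  rw [h₁, h₂, ind_and, ind_and]
  exact (by intros; ring : ∀ a b c d e f : ℂ, a * b * (c * d * (e * f)) = a * (c * e) * (b * (d * f)))
    _ _ _ _ _ _

end Flow

end QLam
namespace QLam

variable {G : GateSet}

/-! ### The flow of a derivation -/

/-- Is the occurrence an output? -/
def JudgOcc.isOut {Γ : Ctx} {A : Ty} : JudgOcc Γ A → Bool
  | .ctx (s := s) _ => !s
  | .concl (s := s) _ => s

/-- The occurrences of `𝔹` in a derivation, with the moves of single tokens. -/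
def Deriv.flow {Γ : Ctx} {M : Tm G} {A : Ty} (π : Deriv G Γ M A) : Flow where
  P := Place π
  J := JudgOcc Γ A
  root := .root
  out := JudgOcc.isOut
  Mv := Move
  B p := ∃ x ∈ bitAxioms π, x.2.2 = p

/-- Double negation of polarities. -/
def Occ.dneg {A : Ty} : {s : Bool} → Occ s A → Occ (!!s) A
  | true, o => o
  | false, o => o

/-- In an abstraction: the neighbour of an occurrence in the premise. -/
def lamMate {Γ : Ctx} {A B : Ty} : JudgOcc (some A :: Γ) B → JudgOcc Γ (.lolli A B)
  -- At polarity `!s`, `arg` takes an occurrence of polarity `!!s`, which reduces to `s` only when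
  -- `s` is concrete.
  | .ctx (s := s) (.here o) => .concl (s := !s) (.arg o.dneg)
  | .ctx (.there v) => .ctx v
  | .concl o => .concl (.res o)

/-- In an abstraction over a pair: the neighbour of an occurrence in the premise. -/
def lamPairMate {Γ : Ctx} {A B C : Ty} :
    JudgOcc (some B :: some A :: Γ) C → JudgOcc Γ (.lolli (.tensor A B) C)
  | .ctx (s := s) (.here o) => .concl (s := !s) (.arg (.snd o.dneg))
  | .ctx (s := s) (.there (.here o)) => .concl (s := !s) (.arg (.fst o.dneg))
  | .ctx (.there (.there v)) => .ctx v
  | .concl o => .concl (.res o)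

/-- In an application: the neighbour of an occurrence in the premises. -/
def appMate {Γ Γ₁ Γ₂ : Ctx} {A B : Ty} (h : Ctx.Split Γ Γ₁ Γ₂) :
    JudgOcc Γ₁ (.lolli A B) ⊕ JudgOcc Γ₂ A →
      JudgOcc Γ B ⊕ (JudgOcc Γ₁ (.lolli A B) ⊕ JudgOcc Γ₂ A)
  | .inl (.ctx v) => .inl (.ctx (h.inl v))
  | .inl (.concl (.arg o)) => .inr (.inr (.concl o))
  | .inl (.concl (.res o)) => .inl (.concl o)
  | .inr (.ctx v) => .inl (.ctx (h.inr v))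
  | .inr (.concl (s := s) o) => .inr (.inl (.concl (s := !s) (.arg o.dneg)))

/-- In a pair: the neighbour of an occurrence in the premises. -/
def pairMate {Γ Γ₁ Γ₂ : Ctx} {A B : Ty} (h : Ctx.Split Γ Γ₁ Γ₂) :
    JudgOcc Γ₁ A ⊕ JudgOcc Γ₂ B → JudgOcc Γ (.tensor A B)
  | .inl (.ctx v) => .ctx (h.inl v)
  | .inl (.concl o) => .concl (.fst o)
  | .inr (.ctx v) => .ctx (h.inr v)
  | .inr (.concl o) => .concl (.snd o)

theorem Ctx.Void.no_occ {s : Bool} {Γ : Ctx} (h : Ctx.Void Γ) (v : CtxOcc s Γ) : False := by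
  induction v with
  | here o => simp [Ctx.Void] at h
  | there v ih => exact ih fun o ho => h o (by simp [ho])

theorem Ctx.Single.exists_occ {Γ : Ctx} {i : ℕ} {A : Ty} (h : Ctx.Single Γ i A) {s : Bool}
    (v : CtxOcc s Γ) : ∃ o, v = h.occ o := by
  induction h with
  | zero hv =>
    cases v with
    | here o => exact ⟨o, rfl⟩
    | there v => exact (hv.no_occ v).elim
  | succ h ih =>
    cases v with
    | there v =>
      obtain ⟨o, rfl⟩ := ih v
      exact ⟨o, rfl⟩

theorem Ctx.Single.occ_inj {Γ : Ctx} {i : ℕ} {A : Ty} (h : Ctx.Single Γ i A) {s : Bool}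
    {o o' : Occ s A} (e : h.occ o = h.occ o') : o = o' := by
  induction h with
  | zero hv => simpa [Ctx.Single.occ] using e
  | succ h ih => exact ih (by simpa [Ctx.Single.occ] using e)

theorem Ctx.Split.cases_occ {Γ Γ₁ Γ₂ : Ctx} (h : Ctx.Split Γ Γ₁ Γ₂) {s : Bool} (v : CtxOcc s Γ) :
    (∃ w, v = h.inl w) ∨ ∃ w, v = h.inr w := by
  induction h with
  | nil => cases v
  | skip h ih =>
    cases v with
    | there v =>
      rcases ih v with ⟨w, rfl⟩ | ⟨w, rfl⟩
      · exact .inl ⟨.there w, rfl⟩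
      · exact .inr ⟨.there w, rfl⟩
  | left h ih =>
    cases v with
    | here o => exact .inl ⟨.here o, rfl⟩
    | there v =>
      rcases ih v with ⟨w, rfl⟩ | ⟨w, rfl⟩
      · exact .inl ⟨.there w, rfl⟩
      · exact .inr ⟨.there w, rfl⟩
  | right h ih =>
    cases v with
    | here o => exact .inr ⟨.here o, rfl⟩
    | there v =>
      rcases ih v with ⟨w, rfl⟩ | ⟨w, rfl⟩
      · exact .inl ⟨.there w, rfl⟩
      · exact .inr ⟨.there w, rfl⟩

theorem Ctx.Split.inl_inj {Γ Γ₁ Γ₂ : Ctx} (h : Ctx.Split Γ Γ₁ Γ₂) {s : Bool}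
    {v w : CtxOcc s Γ₁} (e : h.inl v = h.inl w) : v = w := by
  induction h with
  | nil => cases v
  | skip h ih | right h ih =>
    cases v with
    | there v =>
      cases w with
      | there w => exact congrArg _ (ih (v := v) (w := w) (by simpa [Ctx.Split.inl] using e))
  | left h ih =>
    cases v with
    | here o => cases w <;> simp_all [Ctx.Split.inl]
    | there v =>
      cases w with
      | here o => simp [Ctx.Split.inl] at e
      | there w => exact congrArg _ (ih (v := v) (w := w) (by simpa [Ctx.Split.inl] using e))

theorem Ctx.Split.inr_inj {Γ Γ₁ Γ₂ : Ctx} (h : Ctx.Split Γ Γ₁ Γ₂) {s : Bool}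
    {v w : CtxOcc s Γ₂} (e : h.inr v = h.inr w) : v = w := by
  induction h with
  | nil => cases v
  | skip h ih | left h ih =>
    cases v with
    | there v =>
      cases w with
      | there w => exact congrArg _ (ih (v := v) (w := w) (by simpa [Ctx.Split.inr] using e))
  | right h ih =>
    cases v with
    | here o => cases w <;> simp_all [Ctx.Split.inr]
    | there v =>
      cases w with
      | here o => simp [Ctx.Split.inr] at e
      | there w => exact congrArg _ (ih (v := v) (w := w) (by simpa [Ctx.Split.inr] using e))

theorem Ctx.Split.inl_ne_inr {Γ Γ₁ Γ₂ : Ctx} (h : Ctx.Split Γ Γ₁ Γ₂) {s : Bool}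
    (v : CtxOcc s Γ₁) (w : CtxOcc s Γ₂) : h.inl v ≠ h.inr w := by
  induction h with
  | nil => cases v
  | skip h ih =>
    cases v with
    | there v =>
      cases w with
      | there w => simpa [Ctx.Split.inl, Ctx.Split.inr] using ih v w
  | left h ih =>
    cases w with
    | there w =>
      cases v with
      | here o => simp [Ctx.Split.inl, Ctx.Split.inr]
      | there v => simpa [Ctx.Split.inl, Ctx.Split.inr] using ih v w
  | right h ih =>
    cases v with
    | there v =>
      cases w with
      | here o => simp [Ctx.Split.inl, Ctx.Split.inr]
      | there w => simpa [Ctx.Split.inl, Ctx.Split.inr] using ih v w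

/-- For the rules other than application: no two occurrences in the premises are linked to each
other, and the conclusion has the same boundary as the premises together. -/
theorem Flow.IsGlue.of_bijective {F' F : Flow} {sub : F'.P → F.P} {mate : F'.J → F.J}
    (bij : Function.Bijective (Sum.elim F.root sub)) (hm : Function.Bijective mate)
    (hout : ∀ o, F.out (mate o) = F'.out o)
    (dir : ∀ P Q, F.Mv P Q ↔ (∃ p q, F'.Mv p q ∧ P = sub p ∧ Q = sub q) ∨
      ∃ o, (F'.out o = true ∧ P = sub (F'.root o) ∧ Q = F.root (mate o)) ∨
        (F'.out o = false ∧ Q = sub (F'.root o) ∧ P = F.root (mate o)))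
    (bit : ∀ P, F.B P ↔ ∃ p, F'.B p ∧ P = sub p) :
    F'.IsGlue F sub fun o => .inl (mate o) where
  bij := bij
  dir := dir
  bit := bit
  surj j := (hm.2 j).imp fun _ h => congrArg _ h
  inj o o' j h h' := hm.1 (Sum.inl_injective (h.trans h'.symm))
  symm o o' h := by simp at h
  out_inl o j h := by rw [← Sum.inl_injective h, hout]
  out_inr o o' h := by simp at h

theorem lamMate_bijective {Γ : Ctx} {A B : Ty} :
    Function.Bijective (lamMate (Γ := Γ) (A := A) (B := B)) := by
  constructor
  · rintro (@⟨_ | _, o | v⟩ | @⟨_ | _, o⟩) (@⟨_ | _, o' | v'⟩ | @⟨_ | _, o'⟩) h <;>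
      simp_all [lamMate, Occ.dneg]
  · rintro (@⟨s, v⟩ | @⟨_ | _, _ | _ | _ | o | o⟩)
    · exact ⟨.ctx (.there v), rfl⟩
    · exact ⟨.ctx (s := true) (.here o), rfl⟩
    · exact ⟨.concl o, rfl⟩
    · exact ⟨.ctx (s := false) (.here o), rfl⟩
    · exact ⟨.concl o, rfl⟩

/-- Each clause of `Move` at the last rule is one link, whose direction is the polarity of the
occurrence. -/
theorem Deriv.glue_lam {Γ : Ctx} {M : Tm G} {A B : Ty} (π : Deriv G (some A :: Γ) M B) :
    π.flow.IsGlue π.lam.flow Place.lam fun o => .inl (lamMate o) := by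
  refine .of_bijective ⟨?_, ?_⟩ lamMate_bijective ?_ (fun P Q => ⟨fun h => ?_, ?_⟩) ?_
  · rintro (a | a) (b | b) h <;> cases h <;> rfl
  · rintro (j | p)
    · exact ⟨.inl j, rfl⟩
    · exact ⟨.inr p, rfl⟩
  · rintro (@⟨_ | _, o | v⟩ | @⟨_ | _, o⟩) <;> rfl
  · cases h with
    | lamArgNeg o => exact .inr ⟨.ctx (s := false) (.here o), .inl ⟨rfl, rfl, rfl⟩⟩
    | lamArgPos o => exact .inr ⟨.ctx (s := true) (.here o), .inr ⟨rfl, rfl, rfl⟩⟩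
    | lamResPos o => exact .inr ⟨.concl (s := true) o, .inl ⟨rfl, rfl, rfl⟩⟩
    | lamResNeg o => exact .inr ⟨.concl (s := false) o, .inr ⟨rfl, rfl, rfl⟩⟩
    | lamCtxPos v => exact .inr ⟨.ctx (s := true) (.there v), .inr ⟨rfl, rfl, rfl⟩⟩
    | lamCtxNeg v => exact .inr ⟨.ctx (s := false) (.there v), .inl ⟨rfl, rfl, rfl⟩⟩
    | inLam h => exact .inl ⟨_, _, h, rfl, rfl⟩
  · rintro (⟨p, q, h, rfl, rfl⟩ | ⟨o, ⟨ho, rfl, rfl⟩ | ⟨ho, rfl, rfl⟩⟩)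
    · exact .inLam h
    · rcases o with (@⟨_ | _, o | v⟩ | @⟨_ | _, o⟩) <;> cases ho
      · exact .lamArgNeg o
      · exact .lamCtxNeg v
      · exact .lamResPos o
    · rcases o with (@⟨_ | _, o | v⟩ | @⟨_ | _, o⟩) <;> cases ho
      · exact .lamArgPos o
      · exact .lamCtxPos v
      · exact .lamResNeg o
  · intro P
    simp only [Deriv.flow, bitAxioms, List.mem_map]
    constructor
    · rintro ⟨_, ⟨x, hx, rfl⟩, rfl⟩
      exact ⟨_, ⟨x, hx, rfl⟩, rfl⟩
    · rintro ⟨_, ⟨x, hx, rfl⟩, rfl⟩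
      exact ⟨_, ⟨x, hx, rfl⟩, rfl⟩

theorem lamPairMate_bijective {Γ : Ctx} {A B C : Ty} :
    Function.Bijective (lamPairMate (Γ := Γ) (A := A) (B := B) (C := C)) := by
  constructor
  · rintro (@⟨_ | _, o | (o | v)⟩ | @⟨_ | _, o⟩) (@⟨_ | _, o' | (o' | v')⟩ | @⟨_ | _, o'⟩) h <;>
      simp_all [lamPairMate, Occ.dneg]
  · rintro (@⟨s, v⟩ | @⟨_ | _, _ | _ | _ | (_ | o | o | _ | _) | o⟩)
    · exact ⟨.ctx (.there (.there v)), rfl⟩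
    · exact ⟨.ctx (s := true) (.there (.here o)), rfl⟩
    · exact ⟨.ctx (s := true) (.here o), rfl⟩
    · exact ⟨.concl o, rfl⟩
    · exact ⟨.ctx (s := false) (.there (.here o)), rfl⟩
    · exact ⟨.ctx (s := false) (.here o), rfl⟩
    · exact ⟨.concl o, rfl⟩

end QLam
-- Gluing of flows at pair abstractions, pairs and applications.
namespace QLam

variable {G : GateSet}

theorem Deriv.glue_lamPair {Γ : Ctx} {M : Tm G} {A B C : Ty}
    (π : Deriv G (some B :: some A :: Γ) M C) :
    π.flow.IsGlue π.lamPair.flow Place.lamPair fun o => .inl (lamPairMate o) := by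
  refine .of_bijective ⟨?_, ?_⟩ lamPairMate_bijective ?_ (fun P Q => ⟨fun h => ?_, ?_⟩) ?_
  · rintro (a | a) (b | b) h <;> cases h <;> rfl
  · rintro (j | _ | p)
    · exact ⟨.inl j, rfl⟩
    · exact ⟨.inr p, rfl⟩
  · rintro (@⟨_ | _, o | (o | v)⟩ | @⟨_ | _, o⟩) <;> rfl
  · cases h with
    | lamPairFstNeg o => exact .inr ⟨.ctx (s := false) (.there (.here o)), .inl ⟨rfl, rfl, rfl⟩⟩
    | lamPairFstPos o => exact .inr ⟨.ctx (s := true) (.there (.here o)), .inr ⟨rfl, rfl, rfl⟩⟩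
    | lamPairSndNeg o => exact .inr ⟨.ctx (s := false) (.here o), .inl ⟨rfl, rfl, rfl⟩⟩
    | lamPairSndPos o => exact .inr ⟨.ctx (s := true) (.here o), .inr ⟨rfl, rfl, rfl⟩⟩
    | lamPairResPos o => exact .inr ⟨.concl (s := true) o, .inl ⟨rfl, rfl, rfl⟩⟩
    | lamPairResNeg o => exact .inr ⟨.concl (s := false) o, .inr ⟨rfl, rfl, rfl⟩⟩
    | lamPairCtxPos v => exact .inr ⟨.ctx (s := true) (.there (.there v)), .inr ⟨rfl, rfl, rfl⟩⟩
    | lamPairCtxNeg v => exact .inr ⟨.ctx (s := false) (.there (.there v)), .inl ⟨rfl, rfl, rfl⟩⟩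
    | inLamPair h => exact .inl ⟨_, _, h, rfl, rfl⟩
  · rintro (⟨p, q, h, rfl, rfl⟩ | ⟨o, ⟨ho, rfl, rfl⟩ | ⟨ho, rfl, rfl⟩⟩)
    · exact .inLamPair h
    · rcases o with (@⟨_ | _, o | (o | v)⟩ | @⟨_ | _, o⟩) <;> cases ho
      · exact .lamPairSndNeg o
      · exact .lamPairFstNeg o
      · exact .lamPairCtxNeg v
      · exact .lamPairResPos o
    · rcases o with (@⟨_ | _, o | (o | v)⟩ | @⟨_ | _, o⟩) <;> cases ho
      · exact .lamPairSndPos o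
      · exact .lamPairFstPos o
      · exact .lamPairCtxPos v
      · exact .lamPairResNeg o
  · intro P
    simp only [Deriv.flow, bitAxioms, List.mem_map]
    constructor
    · rintro ⟨_, ⟨x, hx, rfl⟩, rfl⟩
      exact ⟨_, ⟨x, hx, rfl⟩, rfl⟩
    · rintro ⟨_, ⟨x, hx, rfl⟩, rfl⟩
      exact ⟨_, ⟨x, hx, rfl⟩, rfl⟩

theorem pairMate_bijective {Γ Γ₁ Γ₂ : Ctx} {A B : Ty} (h : Ctx.Split Γ Γ₁ Γ₂) :
    Function.Bijective (pairMate (A := A) (B := B) h) := by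
  constructor
  · rintro ((@⟨s, v⟩ | @⟨s, v⟩) | (@⟨s, v⟩ | @⟨s, v⟩)) ((@⟨s', v'⟩ | @⟨s', v'⟩) |
      (@⟨s', v'⟩ | @⟨s', v'⟩)) e <;>
      first | (injection e with e₁ e₂; subst e₁) | cases e
    · rw [h.inl_inj (eq_of_heq e₂)]
    · exact absurd (eq_of_heq e₂) (h.inl_ne_inr _ _)
    · cases e₂
      rfl
    · cases e₂
    · exact absurd (eq_of_heq e₂).symm (h.inl_ne_inr _ _)
    · rw [h.inr_inj (eq_of_heq e₂)]
    · cases e₂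
    · cases e₂
      rfl
  · rintro (@⟨s, v⟩ | @⟨s, _ | o | o | _ | _⟩)
    · obtain ⟨w, rfl⟩ | ⟨w, rfl⟩ := h.cases_occ v
      · exact ⟨.inl (.ctx w), rfl⟩
      · exact ⟨.inr (.ctx w), rfl⟩
    · exact ⟨.inl (.concl o), rfl⟩
    · exact ⟨.inr (.concl o), rfl⟩

theorem Deriv.glue_pair {Γ Γ₁ Γ₂ : Ctx} {M N : Tm G} {A B : Ty} (h : Ctx.Split Γ Γ₁ Γ₂)
    (π₁ : Deriv G Γ₁ M A) (π₂ : Deriv G Γ₂ N B) :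
    (π₁.flow.union π₂.flow).IsGlue (Deriv.pair h π₁ π₂).flow (Sum.elim Place.pairL Place.pairR)
      fun o => .inl (pairMate h o) := by
  refine .of_bijective ⟨?_, ?_⟩ (pairMate_bijective h) ?_ (fun P Q => ⟨fun h => ?_, ?_⟩) ?_
  · rintro (a | a | a) (b | b | b) h <;> cases h <;> rfl
  · rintro (j | _ | _ | _ | _ | p | p)
    · exact ⟨.inl j, rfl⟩
    · exact ⟨.inr (.inl p), rfl⟩
    · exact ⟨.inr (.inr p), rfl⟩
  · rintro ((v | o) | (v | o)) <;> rfl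
  · cases h with
    | pairFstNeg o => exact .inr ⟨.inl (.concl (s := false) o), .inr ⟨rfl, rfl, rfl⟩⟩
    | pairFstPos o => exact .inr ⟨.inl (.concl (s := true) o), .inl ⟨rfl, rfl, rfl⟩⟩
    | pairSndNeg o => exact .inr ⟨.inr (.concl (s := false) o), .inr ⟨rfl, rfl, rfl⟩⟩
    | pairSndPos o => exact .inr ⟨.inr (.concl (s := true) o), .inl ⟨rfl, rfl, rfl⟩⟩
    | pairCtxLPos v => exact .inr ⟨.inl (.ctx (s := true) v), .inr ⟨rfl, rfl, rfl⟩⟩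
    | pairCtxLNeg v => exact .inr ⟨.inl (.ctx (s := false) v), .inl ⟨rfl, rfl, rfl⟩⟩
    | pairCtxRPos v => exact .inr ⟨.inr (.ctx (s := true) v), .inr ⟨rfl, rfl, rfl⟩⟩
    | pairCtxRNeg v => exact .inr ⟨.inr (.ctx (s := false) v), .inl ⟨rfl, rfl, rfl⟩⟩
    | inPairL h => exact .inl ⟨_, _, .inl h, rfl, rfl⟩
    | inPairR h => exact .inl ⟨_, _, .inr h, rfl, rfl⟩
  · rintro (⟨_, _, h | h, rfl, rfl⟩ | ⟨o, ⟨ho, rfl, rfl⟩ | ⟨ho, rfl, rfl⟩⟩)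
    · exact .inPairL h
    · exact .inPairR h
    · rcases o with ((@⟨_ | _, o⟩ | @⟨_ | _, o⟩) | (@⟨_ | _, o⟩ | @⟨_ | _, o⟩)) <;> cases ho
      · exact .pairCtxLNeg o
      · exact .pairFstPos o
      · exact .pairCtxRNeg o
      · exact .pairSndPos o
    · rcases o with ((@⟨_ | _, o⟩ | @⟨_ | _, o⟩) | (@⟨_ | _, o⟩ | @⟨_ | _, o⟩)) <;> cases ho
      · exact .pairCtxLPos o
      · exact .pairFstNeg o
      · exact .pairCtxRPos o
      · exact .pairSndNeg o
  · intro P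
    simp only [Deriv.flow, bitAxioms, List.mem_append, List.mem_map]
    constructor
    · rintro ⟨_, ⟨x, hx, rfl⟩ | ⟨x, hx, rfl⟩, rfl⟩
      · exact ⟨.inl _, ⟨x, hx, rfl⟩, rfl⟩
      · exact ⟨.inr _, ⟨x, hx, rfl⟩, rfl⟩
    · rintro ⟨_ | _, ⟨x, hx, rfl⟩, rfl⟩
      · exact ⟨_, .inl ⟨x, hx, rfl⟩, rfl⟩
      · exact ⟨_, .inr ⟨x, hx, rfl⟩, rfl⟩

/-- The only rule with links inside the premises: an occurrence in the argument type appears in the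
function and in the argument, as an output of one and an input of the other, and not in the
conclusion. -/
theorem Deriv.glue_app {Γ Γ₁ Γ₂ : Ctx} {M N : Tm G} {A B : Ty} (h : Ctx.Split Γ Γ₁ Γ₂)
    (π₁ : Deriv G Γ₁ M (.lolli A B)) (π₂ : Deriv G Γ₂ N A) :
    (π₁.flow.union π₂.flow).IsGlue (Deriv.app h π₁ π₂).flow (Sum.elim Place.appL Place.appR)
      (appMate h) := by
  refine ⟨⟨?_, ?_⟩, fun P Q => ⟨fun h => ?_, ?_⟩, ?_, ?_, ?_, ?_, ?_, ?_⟩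
  · rintro (a | a | a) (b | b | b) h <;> cases h <;> rfl
  · rintro (j | _ | _ | p | p)
    · exact ⟨.inl j, rfl⟩
    · exact ⟨.inr (.inl p), rfl⟩
    · exact ⟨.inr (.inr p), rfl⟩
  · cases h with
    | appArgPos o => exact .inr ⟨.inr (.concl (s := true) o), .inl ⟨rfl, rfl, rfl⟩⟩
    | appArgNeg o => exact .inr ⟨.inr (.concl (s := false) o), .inr ⟨rfl, rfl, rfl⟩⟩
    | appResPos o => exact .inr ⟨.inl (.concl (s := true) (.res o)), .inl ⟨rfl, rfl, rfl⟩⟩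
    | appResNeg o => exact .inr ⟨.inl (.concl (s := false) (.res o)), .inr ⟨rfl, rfl, rfl⟩⟩
    | appCtxLPos v => exact .inr ⟨.inl (.ctx (s := true) v), .inr ⟨rfl, rfl, rfl⟩⟩
    | appCtxLNeg v => exact .inr ⟨.inl (.ctx (s := false) v), .inl ⟨rfl, rfl, rfl⟩⟩
    | appCtxRPos v => exact .inr ⟨.inr (.ctx (s := true) v), .inr ⟨rfl, rfl, rfl⟩⟩
    | appCtxRNeg v => exact .inr ⟨.inr (.ctx (s := false) v), .inl ⟨rfl, rfl, rfl⟩⟩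
    | inAppL h => exact .inl ⟨_, _, .inl h, rfl, rfl⟩
    | inAppR h => exact .inl ⟨_, _, .inr h, rfl, rfl⟩
  · rintro (⟨_, _, h | h, rfl, rfl⟩ | ⟨o, ⟨ho, rfl, rfl⟩ | ⟨ho, rfl, rfl⟩⟩)
    · exact .inAppL h
    · exact .inAppR h
    · rcases o with ((@⟨_ | _, o⟩ | @⟨_ | _, _ | _ | _ | o | o⟩) |
        (@⟨_ | _, o⟩ | @⟨_ | _, o⟩)) <;> cases ho
      · exact .appCtxLNeg o
      · exact .appArgNeg o
      · exact .appResPos o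
      · exact .appCtxRNeg o
      · exact .appArgPos o
    · rcases o with ((@⟨_ | _, o⟩ | @⟨_ | _, _ | _ | _ | o | o⟩) |
        (@⟨_ | _, o⟩ | @⟨_ | _, o⟩)) <;> cases ho
      · exact .appCtxLPos o
      · exact .appArgPos o
      · exact .appResNeg o
      · exact .appCtxRPos o
      · exact .appArgNeg o
  · intro P
    simp only [Deriv.flow, bitAxioms, List.mem_append, List.mem_map]
    constructor
    · rintro ⟨_, ⟨x, hx, rfl⟩ | ⟨x, hx, rfl⟩, rfl⟩
      · exact ⟨.inl _, ⟨x, hx, rfl⟩, rfl⟩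
      · exact ⟨.inr _, ⟨x, hx, rfl⟩, rfl⟩
    · rintro ⟨_ | _, ⟨x, hx, rfl⟩, rfl⟩
      · exact ⟨_, .inl ⟨x, hx, rfl⟩, rfl⟩
      · exact ⟨_, .inr ⟨x, hx, rfl⟩, rfl⟩
  · rintro (@⟨s, v⟩ | @⟨s, o⟩)
    · obtain ⟨w, rfl⟩ | ⟨w, rfl⟩ := h.cases_occ v
      · exact ⟨.inl (.ctx w), rfl⟩
      · exact ⟨.inr (.ctx w), rfl⟩
    · exact ⟨.inl (.concl (.res o)), rfl⟩
  · rintro ((@⟨s, v⟩ | @⟨s, _ | _ | _ | o | o⟩) | (@⟨s, v⟩ | @⟨s, o⟩))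
      ((@⟨s', v'⟩ | @⟨s', _ | _ | _ | o' | o'⟩) | (@⟨s', v'⟩ | @⟨s', o'⟩)) j e e' <;>
      cases e <;> first | (injection e' with e'; injection e' with e₁ e₂; subst e₁) | cases e'
    · rw [h.inl_inj (eq_of_heq e₂)]
    · exact absurd (eq_of_heq e₂).symm (h.inl_ne_inr _ _)
    · cases e₂
      rfl
    · exact absurd (eq_of_heq e₂) (h.inl_ne_inr _ _)
    · rw [h.inr_inj (eq_of_heq e₂)]
  · rintro ((@⟨s, v⟩ | @⟨_ | _, _ | _ | _ | o | o⟩) | (@⟨s, v⟩ | @⟨_ | _, o⟩)) o' e <;>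
      cases e <;> rfl
  · rintro ((@⟨s, v⟩ | @⟨_ | _, _ | _ | _ | o | o⟩) | (@⟨s, v⟩ | @⟨_ | _, o⟩)) j e <;>
      cases e <;> rfl
  · rintro ((@⟨s, v⟩ | @⟨_ | _, _ | _ | _ | o | o⟩) | (@⟨s, v⟩ | @⟨_ | _, o⟩)) j e <;>
      cases e <;> rfl

end QLam
-- Gate axioms, and uniqueness of the way into and out of each place.
namespace QLam

variable {G : GateSet}

/-- The gate axioms in a derivation. -/
def Deriv.GIx : {Γ : Ctx} → {M : Tm G} → {A : Ty} → Deriv G Γ M A → Type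
  | _, _, _, .var _ => Empty
  | _, _, _, .bit _ => Empty
  | _, _, _, .gate _ => Unit
  | _, _, _, .lam π => π.GIx
  | _, _, _, .lamPair π => π.GIx
  | _, _, _, .app _ π₁ π₂ => π₁.GIx ⊕ π₂.GIx
  | _, _, _, .pair _ π₁ π₂ => π₁.GIx ⊕ π₂.GIx

noncomputable instance Deriv.instFintypeGIx {Γ : Ctx} {M : Tm G} {A : Ty} (π : Deriv G Γ M A) :
    Fintype π.GIx := by
  induction π with
  | var h => exact inferInstanceAs (Fintype Empty)
  | bit h => exact inferInstanceAs (Fintype Empty)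
  | gate h => exact inferInstanceAs (Fintype Unit)
  | lam π ih => exact ih
  | lamPair π ih => exact ih
  | app h π₁ π₂ ih₁ ih₂ => exact inferInstanceAs (Fintype (_ ⊕ _))
  | pair h π₁ π₂ ih₁ ih₂ => exact inferInstanceAs (Fintype (_ ⊕ _))

/-- The symbol of a gate axiom. -/
def Deriv.gsym : {Γ : Ctx} → {M : Tm G} → {A : Ty} → (π : Deriv G Γ M A) → π.GIx → G.Sym
  | _, _, _, .var _ => Empty.elim
  | _, _, _, .bit _ => Empty.elim
  | _, _, _, .gate (U := U) _ => fun _ => U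
  | _, _, _, .lam π => π.gsym
  | _, _, _, .lamPair π => π.gsym
  | _, _, _, .app _ π₁ π₂ => Sum.elim π₁.gsym π₂.gsym
  | _, _, _, .pair _ π₁ π₂ => Sum.elim π₁.gsym π₂.gsym

/-- The argument occurrences (`f = true`) and the result occurrences (`f = false`) of a gate
axiom. -/
def Deriv.gpt (f : Bool) : {Γ : Ctx} → {M : Tm G} → {A : Ty} → (π : Deriv G Γ M A) →
    (i : π.GIx) → Fin (G.arity (π.gsym i)) → Place π
  | _, _, _, .var _ => fun i => Empty.elim i
  | _, _, _, .bit _ => fun i => Empty.elim i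
  | _, _, _, .gate (U := U) _ => fun _ k =>
    match f with
    | true => .atType false (.arg (powOcc (G.rank U) k))
    | false => .atType true (.res (powOcc (G.rank U) k))
  | _, _, _, .lam π => fun i k => .lam (π.gpt f i k)
  | _, _, _, .lamPair π => fun i k => .lamPair (π.gpt f i k)
  | _, _, _, .app _ π₁ π₂ => fun i => match i with
    | Sum.inl i => fun k => .appL (π₁.gpt f i k)
    | Sum.inr i => fun k => .appR (π₂.gpt f i k)
  | _, _, _, .pair _ π₁ π₂ => fun i => match i with
    | Sum.inl i => fun k => .pairL (π₁.gpt f i k)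
    | Sum.inr i => fun k => .pairR (π₂.gpt f i k)

/-- The equality is stated between dependent triples because the types of `p` and `q` depend on the
gate symbol. -/
theorem GateAt.exists_index {Γ : Ctx} {M : Tm G} {A : Ty} {π : Deriv G Γ M A} {U : G.Sym}
    {p q : Fin (G.arity U) → Place π} (h : GateAt U p q) :
    ∃ i, (⟨π.gsym i, π.gpt true i, π.gpt false i⟩ :
      (U : G.Sym) × (Fin (G.arity U) → Place π) × (Fin (G.arity U) → Place π)) = ⟨U, p, q⟩ := by
  induction h with
  | axiomAt => exact ⟨(), rfl⟩
  | inLam h ih =>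
    obtain ⟨i, hi⟩ := ih
    cases hi
    exact ⟨i, rfl⟩
  | inLamPair h ih =>
    obtain ⟨i, hi⟩ := ih
    cases hi
    exact ⟨i, rfl⟩
  | inAppL h ih | inPairL h ih =>
    obtain ⟨i, hi⟩ := ih
    cases hi
    exact ⟨.inl i, rfl⟩
  | inAppR h ih | inPairR h ih =>
    obtain ⟨i, hi⟩ := ih
    cases hi
    exact ⟨.inr i, rfl⟩

theorem Deriv.gateAt {Γ : Ctx} {M : Tm G} {A : Ty} (π : Deriv G Γ M A) (i : π.GIx) :
    GateAt (π.gsym i) (π.gpt true i) (π.gpt false i) := by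
  induction π with
  | var h => exact i.elim
  | bit h => exact i.elim
  | gate h => exact .axiomAt
  | lam π ih => exact .inLam (ih i)
  | lamPair π ih => exact .inLamPair (ih i)
  | app h π₁ π₂ ih₁ ih₂ =>
    rcases i with i | i
    · exact .inAppL (ih₁ i)
    · exact .inAppR (ih₂ i)
  | pair h π₁ π₂ ih₁ ih₂ =>
    rcases i with i | i
    · exact .inPairL (ih₁ i)
    · exact .inPairR (ih₂ i)

theorem Occ.pow_false {n : ℕ} (o : Occ false (.pow n)) : False := by
  induction n with
  | zero => cases o
  | succ n ih =>
    rcases o with _ | o | o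
    · cases o
    · exact ih o

theorem exists_powOcc {n : ℕ} (o : Occ true (.pow n)) : ∃ k, powOcc n k = o := by
  induction n with
  | zero =>
    cases o
    exact ⟨0, rfl⟩
  | succ n ih =>
    rcases o with _ | o | o
    · cases o
      exact ⟨0, rfl⟩
    · obtain ⟨k, rfl⟩ := ih o
      exact ⟨k.succ, rfl⟩

theorem powOcc_injective (n : ℕ) : Function.Injective (powOcc n) := by
  induction n with
  | zero => exact fun k k' _ => Subsingleton.elim (α := Fin 1) k k'
  | succ n ih =>
    intro k k' h
    cases k using Fin.cases <;> cases k' using Fin.cases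
    · rfl
    · cases h
    · cases h
    · exact congrArg Fin.succ (ih (Occ.snd.inj h))

theorem move_var_iff {Γ : Ctx} {i : ℕ} {A : Ty} {h : Ctx.Single Γ i A}
    {p q : Place (G := G) (.var h)} : Move p q ↔
      (∃ o : Occ true A, p = .atCtx (h.occ o) ∧ q = .atType true o) ∨
        ∃ o : Occ false A, p = .atType false o ∧ q = .atCtx (h.occ o) := by
  constructor
  · intro hm
    cases hm with
    | varPos o => exact .inl ⟨o, rfl, rfl⟩
    | varNeg o => exact .inr ⟨o, rfl, rfl⟩
  · rintro (⟨o, rfl, rfl⟩ | ⟨o, rfl, rfl⟩)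
    · exact .varPos o
    · exact .varNeg o

/-- Meant for the axioms, where every place lies on the boundary: half of the places are passed
across it, and only the other half needs an inner way. -/
theorem Flow.Exact.of_root {F : Flow} {f : Bool} {X : Type} {g : X → F.P}
    (inj : Function.Injective F.root) (surj : Function.Surjective F.root)
    (h₁ : ∀ j, F.out j = f → ∀ t, ¬ F.Way f g (F.root j) (.inr t))
    (h₂ : ∀ j, F.out j = !f → ∃! t, F.Way f g (F.root j) (.inr t)) : F.Exact f g := by
  intro p
  obtain ⟨j, rfl⟩ := surj p
  by_cases hj : F.out j = f
  · refine ⟨.inl j, ⟨hj, rfl⟩, ?_⟩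
    rintro (j' | t) ht
    · rw [inj ht.2]
    · exact absurd ht (h₁ j hj t)
  · obtain ⟨t, ht, hu⟩ := h₂ j (Bool.eq_not_of_ne hj)
    refine ⟨.inr t, ht, ?_⟩
    rintro (j' | t') ht'
    · obtain rfl := inj ht'.2
      exact absurd ht'.1 hj
    · rw [hu t' ht']

theorem Deriv.exact_var {Γ : Ctx} {i : ℕ} {A : Ty} (h : Ctx.Single Γ i A) (f : Bool) {X : Type}
    [IsEmpty X] (g : X → Place (G := G) (.var h)) :
    (Deriv.flow (.var h)).Exact f g := by
  have hB : ∀ p, ¬ (Deriv.flow (G := G) (.var h)).B p := by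
    rintro p ⟨x, hx, -⟩
    cases hx
  have hdir : ∀ p q, (Deriv.flow (G := G) (.var h)).Mv p q ↔ _ := fun p q => move_var_iff
  refine .of_root (fun _ _ => Place.root.inj) (fun | .root j => ⟨j, rfl⟩) (fun j hj t => ?_)
    fun j hj => ?_
  · rcases t with q | x | u
    · simp only [Flow.Way, Flow.Dir, hdir]
      rcases j with @⟨_ | _, v⟩ | @⟨_ | _, o⟩ <;> cases hj <;> simp [flow, JudgOcc.isOut]
    · exact isEmptyElim x
    · exact fun ht => hB _ ht.2
  · obtain ⟨q, hq⟩ : ∃ q, ∀ q', (Deriv.flow (.var h)).Dir f ((Deriv.flow (.var h)).root j) q' ↔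
        q' = q := by
      simp only [Flow.Dir, hdir]
      rcases j with @⟨s, v⟩ | @⟨s, o⟩
      · obtain ⟨o, rfl⟩ := h.exists_occ v
        refine ⟨.atType s o, ?_⟩
        have hinj : ∀ o' : Occ s A, h.occ o = h.occ o' ↔ o = o' := fun o' =>
          ⟨h.occ_inj, congrArg _⟩
        cases s <;> cases f <;> simp [flow, JudgOcc.isOut, hinj] at hj ⊢
      · refine ⟨.atCtx (h.occ o), ?_⟩
        cases s <;> cases f <;> simp [flow, JudgOcc.isOut] at hj ⊢
    refine ⟨.inl q, (hq q).2 rfl, ?_⟩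
    rintro (q' | x | u) ht
    · rw [(hq q').1 ht]
    · exact isEmptyElim x
    · exact absurd ht.2 (hB _)

theorem Deriv.exact_bit {Γ : Ctx} {b : Bool} {l : ℕ} (h : Ctx.Void Γ) (f : Bool) {X : Type}
    [IsEmpty X] (g : X → Place (G := G) (.bit (b := b) (l := l) h)) :
    (Deriv.flow (.bit (b := b) (l := l) h)).Exact f g := by
  have hdir : ∀ p q, ¬ (Deriv.flow (G := G) (.bit (b := b) (l := l) h)).Mv p q := by
    intro p q hm
    cases hm
  have hdir' : ∀ p q, ¬ (Deriv.flow (G := G) (.bit (b := b) (l := l) h)).Dir f p q := by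
    cases f
    · exact fun p q => hdir q p
    · exact hdir
  refine .of_root (fun _ _ => Place.root.inj) (fun | .root j => ⟨j, rfl⟩) (fun j hj t => ?_)
    fun j hj => ?_
  · rcases t with q | x | u
    · exact hdir' _ _
    · exact isEmptyElim x
    · rcases j with v | o
      · exact (h.no_occ v).elim
      · cases o
        cases hj
        exact fun ht => Bool.noConfusion ht.1
  · rcases j with v | o
    · exact (h.no_occ v).elim
    · cases o
      obtain rfl : f = false := by simpa [flow, JudgOcc.isOut] using hj
      refine ⟨.inr (.inr ()), ⟨rfl, ⟨_, List.mem_singleton_self _, rfl⟩⟩, ?_⟩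
      rintro (q' | x | u) ht
      · exact absurd ht (hdir' _ _)
      · exact isEmptyElim x
      · rfl

theorem Deriv.exact_gate {Γ : Ctx} {U : G.Sym} (h : Ctx.Void Γ) (f : Bool) :
    (Deriv.flow (.gate (U := U) h)).Exact f
      fun x : (i : (Deriv.gate (U := U) h).GIx) × Fin (G.arity ((Deriv.gate h).gsym i)) =>
        (Deriv.gate h).gpt f x.1 x.2 := by
  have hdir : ∀ p q, ¬ (Deriv.flow (G := G) (.gate (U := U) h)).Mv p q := by
    intro p q hm
    cases hm
  have hdir' : ∀ p q, ¬ (Deriv.flow (G := G) (.gate (U := U) h)).Dir f p q := by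
    cases f
    · exact fun p q => hdir q p
    · exact hdir
  have hB : ∀ p, ¬ (Deriv.flow (G := G) (.gate (U := U) h)).B p := by
    rintro p ⟨x, hx, -⟩
    cases hx
  refine .of_root (fun _ _ => Place.root.inj) (fun | .root j => ⟨j, rfl⟩) (fun j hj t => ?_)
    fun j hj => ?_
  · rcases t with q | ⟨i, k⟩ | u
    · exact hdir' _ _
    · intro ht
      cases f <;> (cases Place.root.inj ht; cases hj)
    · exact fun ht => hB _ ht.2
  · obtain ⟨k, hk⟩ : ∃ k, ∀ k', (Deriv.gate (U := U) h).gpt f () k' = Place.root j ↔ k' = k := by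
      rcases j with v | @⟨_ | _, _ | _ | _ | o | o⟩
      · exact (h.no_occ v).elim
      · obtain ⟨k, rfl⟩ := exists_powOcc o
        obtain rfl : f = true := by simpa [flow, JudgOcc.isOut] using hj
        refine ⟨k, fun k' => ⟨fun e => powOcc_injective _ ?_, fun e => by rw [e]; rfl⟩⟩
        exact Occ.arg.inj (eq_of_heq (JudgOcc.concl.inj (Place.root.inj e)).2)
      · exact o.pow_false.elim
      · exact o.pow_false.elim
      · obtain ⟨k, rfl⟩ := exists_powOcc o
        obtain rfl : f = false := by simpa [flow, JudgOcc.isOut] using hj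
        refine ⟨k, fun k' => ⟨fun e => powOcc_injective _ ?_, fun e => by rw [e]; rfl⟩⟩
        exact Occ.res.inj (eq_of_heq (JudgOcc.concl.inj (Place.root.inj e)).2)
    refine ⟨.inr (.inl ⟨(), k⟩), (hk k).2 rfl, ?_⟩
    rintro (q' | ⟨i, k'⟩ | u) ht
    · exact absurd ht (hdir' _ _)
    · rw [(hk k').1 ht]
      rfl
    · exact absurd ht.2 (hB _)

/-- This is the determinism of the machine up to the order of independent steps: two tokens can
never be sent to the same place, and no token has a choice. -/
theorem Deriv.exact (f : Bool) {Γ : Ctx} {M : Tm G} {A : Ty} (π : Deriv G Γ M A) :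
    π.flow.Exact f fun x : (i : π.GIx) × Fin (G.arity (π.gsym i)) => π.gpt f x.1 x.2 := by
  induction π with
  | var h =>
    have : IsEmpty ((i : (Deriv.var (G := G) h).GIx) × Fin (G.arity ((Deriv.var h).gsym i))) :=
      ⟨fun x => Empty.elim x.1⟩
    exact exact_var h f _
  | @bit _ b l h =>
    have : IsEmpty ((i : (Deriv.bit (G := G) (b := b) (l := l) h).GIx) ×
      Fin (G.arity ((Deriv.bit (b := b) (l := l) h).gsym i))) := ⟨fun x => Empty.elim x.1⟩
    exact exact_bit h f _
  | gate h => exact exact_gate h f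
  | lam π ih => exact ih.glue π.glue_lam
  | lamPair π ih => exact ih.glue π.glue_lamPair
  | app h π₁ π₂ ih₁ ih₂ =>
    refine (congrArg _ (funext fun ⟨i, k⟩ => ?_)).mp (((ih₁.union ih₂).glue
      (glue_app h π₁ π₂)).reindex (Equiv.sumSigmaDistrib fun i : π₁.GIx ⊕ π₂.GIx =>
        Fin (G.arity ((Deriv.app h π₁ π₂).gsym i))))
    cases i <;> rfl
  | pair h π₁ π₂ ih₁ ih₂ =>
    refine (congrArg _ (funext fun ⟨i, k⟩ => ?_)).mp (((ih₁.union ih₂).glue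
      (glue_pair h π₁ π₂)).reindex (Equiv.sumSigmaDistrib fun i : π₁.GIx ⊕ π₂.GIx =>
        Fin (G.arity ((Deriv.pair h π₁ π₂).gsym i))))
    cases i <;> rfl

end QLam
namespace QLam

variable {G : GateSet}

/-! ### Values at occurrences -/

section At

variable {D : Type}

/-- The value at an occurrence in a type. -/
def V.at : {A : Ty} → {s : Bool} → V D A → Occ s A → D
  | _, _, x, .hole => x
  | _, _, x, .fst o => V.at x.1 o
  | _, _, x, .snd o => V.at x.2 o
  | _, _, x, .arg o => V.at x.1 o
  | _, _, x, .res o => V.at x.2 o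

/-- The value at an occurrence in an environment. -/
def VC.at {s : Bool} : {Γ : Ctx} → VC D Γ → CtxOcc s Γ → D
  | some _ :: _, g, .here o => V.at g.1 o
  | some _ :: _, g, .there v => VC.at g.2 v
  | none :: Γ, g, .there v => (VC.at : VC D Γ → CtxOcc s Γ → D) g v

/-- The value at an occurrence in a judgement. -/
def JudgOcc.val {Γ : Ctx} {A : Ty} (g : VC D Γ) (x : V D A) : JudgOcc Γ A → D
  | .ctx v => g.at v
  | .concl o => x.at o

theorem V.ext_at {A : Ty} {x y : V D A} (h : ∀ s (o : Occ s A), x.at o = y.at o) : x = y := by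
  induction A with
  | bit => exact h true .hole
  | lolli A B ihA ihB =>
    exact Prod.ext (ihA fun s o => by cases s; exacts [h true (.arg o), h false (.arg o)])
      (ihB fun s o => h s (.res o))
  | tensor A B ihA ihB =>
    exact Prod.ext (ihA fun s o => h s (.fst o)) (ihB fun s o => h s (.snd o))

theorem V.exists_at {A : Ty} (f : ∀ s, Occ s A → D) : ∃ x : V D A, ∀ s (o : Occ s A),
    x.at o = f s o := by
  induction A with
  | bit =>
    refine ⟨f true .hole, fun s o => ?_⟩
    cases o
    rfl
  | lolli A B ihA ihB =>
    obtain ⟨x, hx⟩ := ihA fun s o => f (!s) (.arg o.dneg)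
    obtain ⟨y, hy⟩ := ihB fun s o => f s (.res o)
    refine ⟨(x, y), fun s o => ?_⟩
    cases o with
    | arg o => cases s <;> exact hx _ o
    | res o => exact hy _ o
  | tensor A B ihA ihB =>
    obtain ⟨x, hx⟩ := ihA fun s o => f s (.fst o)
    obtain ⟨y, hy⟩ := ihB fun s o => f s (.snd o)
    refine ⟨(x, y), fun s o => ?_⟩
    cases o with
    | fst o => exact hx _ o
    | snd o => exact hy _ o

theorem VC.ext_at {Γ : Ctx} {g g' : VC D Γ} (h : ∀ s (v : CtxOcc s Γ), g.at v = g'.at v) :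
    g = g' := by
  induction Γ with
  | nil => rfl
  | cons o Γ ih =>
    cases o with
    | none => exact ih fun s v => h s (.there v)
    | some A =>
      exact Prod.ext (V.ext_at fun s o => h s (.here o)) (ih fun s v => h s (.there v))

theorem VC.exists_at {Γ : Ctx} (f : ∀ s, CtxOcc s Γ → D) : ∃ g : VC D Γ, ∀ s (v : CtxOcc s Γ),
    g.at v = f s v := by
  induction Γ with
  | nil =>
    refine ⟨(), fun s v => ?_⟩
    cases v
  | cons o Γ ih =>
    obtain ⟨g, hg⟩ := ih fun s v => f s (.there v)
    cases o with
    | none =>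
      refine ⟨g, fun s v => ?_⟩
      cases v with
      | there v => exact hg s v
    | some A =>
      obtain ⟨x, hx⟩ := V.exists_at fun s o => f s (.here o)
      refine ⟨(x, g), fun s v => ?_⟩
      cases v with
      | here o => exact hx s o
      | there v => exact hg s v

/-- Together with `JudgOcc.val_inj`, identifies the index pairs of a tensor with the assignments of
values to the boundary places. -/
theorem JudgOcc.exists_val {Γ : Ctx} {A : Ty} (f : JudgOcc Γ A → D) :
    ∃ (g : VC D Γ) (x : V D A), JudgOcc.val g x = f := by
  obtain ⟨g, hg⟩ := VC.exists_at fun s v => f (.ctx (s := s) v)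
  obtain ⟨x, hx⟩ := V.exists_at fun s o => f (.concl (s := s) o)
  refine ⟨g, x, funext fun j => ?_⟩
  cases j with
  | ctx v => exact hg _ v
  | concl o => exact hx _ o

theorem JudgOcc.val_inj {Γ : Ctx} {A : Ty} {g g' : VC D Γ} {x x' : V D A}
    (h : JudgOcc.val g x = JudgOcc.val g' x') : g = g' ∧ x = x' :=
  ⟨VC.ext_at fun _ v => congrFun h (.ctx v), V.ext_at fun _ o => congrFun h (.concl o)⟩

theorem Ctx.Single.val_at {Γ : Ctx} {i : ℕ} {A : Ty} (h : Ctx.Single Γ i A) (g : VC D Γ) {s : Bool}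
    (o : Occ s A) : (h.val g).at o = g.at (h.occ o) := by
  induction h with
  | zero hv => rfl
  | succ h ih => exact ih g o

theorem Ctx.Split.fst_at {Γ Γ₁ Γ₂ : Ctx} (h : Ctx.Split Γ Γ₁ Γ₂) {s : Bool} :
    ∀ (g : VC D Γ) (v : CtxOcc s Γ₁), (h.fst g).at v = g.at (h.inl v) := by
  induction h with
  | nil =>
    intro g v
    cases v
  | skip h ih =>
    intro g v
    cases v with
    | there v => exact ih g v
  | left h ih =>
    intro g v
    cases v with
    | here o => rfl
    | there v => exact ih g.2 v
  | right h ih =>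
    intro g v
    cases v with
    | there v => exact ih g.2 v

theorem Ctx.Split.snd_at {Γ Γ₁ Γ₂ : Ctx} (h : Ctx.Split Γ Γ₁ Γ₂) {s : Bool} :
    ∀ (g : VC D Γ) (v : CtxOcc s Γ₂), (h.snd g).at v = g.at (h.inr v) := by
  induction h with
  | nil =>
    intro g v
    cases v
  | skip h ih =>
    intro g v
    cases v with
    | there v => exact ih g v
  | right h ih =>
    intro g v
    cases v with
    | here o => rfl
    | there v => exact ih g.2 v
  | left h ih =>
    intro g v
    cases v with
    | there v => exact ih g.2 v

theorem powV_at {n : ℕ} (x : V D (Ty.pow n)) (k : Fin (n + 1)) : x.at (powOcc n k) = powV x k := by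
  induction n with
  | zero => rfl
  | succ n ih =>
    cases k using Fin.cases with
    | zero => rfl
    | succ k => exact ih x.2 k

theorem V.at_dneg {A : Ty} {s : Bool} (x : V D A) (o : Occ s A) : x.at o.dneg = x.at o := by
  cases s <;> rfl

theorem val_lamMate {Γ : Ctx} {A B : Ty} (g : VC D Γ) (x : V D (.lolli A B))
    (o : JudgOcc (some A :: Γ) B) :
    JudgOcc.val g x (lamMate o) = JudgOcc.val (Γ := some A :: Γ) (x.1, g) x.2 o := by
  rcases o with (@⟨_ | _, o | v⟩ | o) <;> rfl

theorem val_lamPairMate {Γ : Ctx} {A B C : Ty} (g : VC D Γ) (x : V D (.lolli (.tensor A B) C))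
    (o : JudgOcc (some B :: some A :: Γ) C) : JudgOcc.val g x (lamPairMate o) =
      JudgOcc.val (Γ := some B :: some A :: Γ) (x.1.2, (x.1.1, g)) x.2 o := by
  rcases o with (@⟨_ | _, o | (o | v)⟩ | o) <;> rfl

theorem val_pairMate {Γ Γ₁ Γ₂ : Ctx} {A B : Ty} (h : Ctx.Split Γ Γ₁ Γ₂) (g : VC D Γ)
    (x : V D (.tensor A B)) (o : JudgOcc Γ₁ A ⊕ JudgOcc Γ₂ B) :
    JudgOcc.val g x (pairMate h o) =
      Sum.elim (JudgOcc.val (h.fst g) x.1) (JudgOcc.val (h.snd g) x.2) o := by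
  rcases o with ((v | o) | (v | o))
  · exact (h.fst_at g v).symm
  · rfl
  · exact (h.snd_at g v).symm
  · rfl

/-- Boundary values of the premises that agree along the links amount to one assignment `x` to the
argument type, shared by function and argument. This is the index contracted in `Deriv.den`. -/
theorem val_appMate_iff {Γ Γ₁ Γ₂ : Ctx} {A B : Ty} (h : Ctx.Split Γ Γ₁ Γ₂) (g : VC D Γ)
    (b : V D B) (y : JudgOcc Γ₁ (.lolli A B) ⊕ JudgOcc Γ₂ A → D) :
    (∀ o, y o = Sum.elim (JudgOcc.val g b) y (appMate h o)) ↔ ∃ x : V D A,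
      Sum.elim (JudgOcc.val (A := .lolli A B) (h.fst g) (x, b)) (JudgOcc.val (h.snd g) x) = y := by
  constructor
  · intro H
    obtain ⟨x, hx⟩ := V.exists_at fun _ (o : Occ _ A) => y (.inr (.concl o))
    refine ⟨x, funext ?_⟩
    rintro ((v | o) | (v | o))
    · exact (h.fst_at g v).trans (H (.inl (.ctx v))).symm
    · cases o with
      | arg o => exact (hx _ o).trans (H (.inl (.concl (.arg o)))).symm
      | res o => exact (H (.inl (.concl (.res o)))).symm
    · exact (h.snd_at g v).trans (H (.inr (.ctx v))).symm
    · exact hx _ o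
  · rintro ⟨x, rfl⟩ ((v | o) | (v | o))
    · exact h.fst_at g v
    · cases o <;> rfl
    · exact h.snd_at g v
    · exact (x.at_dneg o).symm

end At

end QLam
namespace QLam

variable {G : GateSet}

/-! ### The sum over all assignments of bits to the places -/

theorem mem_occs {A : Ty} {s : Bool} (o : Occ s A) : o ∈ occs s A := by
  induction o with
  | hole => simp [occs]
  | @fst s A B o ih | @snd s A B o ih => cases s <;> simpa [occs] using ih
  | @arg s A B o ih | @res s A B o ih => cases s <;> simpa [occs] using ih

theorem mem_ctxOccs {Γ : Ctx} {s : Bool} (v : CtxOcc s Γ) : v ∈ ctxOccs s Γ := by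
  induction v with
  | here o => simpa [ctxOccs] using mem_occs o
  | @there a Γ v ih => cases a <;> simpa [ctxOccs] using ih

theorem mem_inputs {Γ : Ctx} {A : Ty} {j : JudgOcc Γ A} : j ∈ inputs Γ A ↔ j.isOut = false := by
  rcases j with @⟨_ | _, v⟩ | @⟨_ | _, o⟩ <;> simp [inputs, JudgOcc.isOut, mem_occs, mem_ctxOccs]

theorem mem_outputs {Γ : Ctx} {A : Ty} {j : JudgOcc Γ A} : j ∈ outputs Γ A ↔ j.isOut = true := by
  rcases j with @⟨_ | _, v⟩ | @⟨_ | _, o⟩ <;> simp [outputs, JudgOcc.isOut, mem_occs, mem_ctxOccs]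

instance JudgOcc.instFinite (Γ : Ctx) (A : Ty) : Finite (JudgOcc Γ A) := by
  refine Set.finite_univ_iff.1 (Set.Finite.subset
    (List.finite_toSet (inputs Γ A ++ outputs Γ A)) fun j _ => ?_)
  simp only [Set.mem_ofPred_eq, List.mem_append, mem_inputs, mem_outputs]
  cases j.isOut <;> simp

instance Place.instFinite {Γ : Ctx} {M : Tm G} {A : Ty} (π : Deriv G Γ M A) :
    Finite (Place π) := by
  induction π with
  | var h => exact Finite.of_surjective Place.root fun | .root j => ⟨j, rfl⟩
  | bit h => exact Finite.of_surjective Place.root fun | .root j => ⟨j, rfl⟩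
  | gate h => exact Finite.of_surjective Place.root fun | .root j => ⟨j, rfl⟩
  | lam π ih => exact Finite.of_surjective (α := JudgOcc _ _ ⊕ Place π) _ π.glue_lam.bij.2
  | lamPair π ih => exact Finite.of_surjective (α := JudgOcc _ _ ⊕ Place π) _ π.glue_lamPair.bij.2
  | app h π₁ π₂ ih₁ ih₂ =>
    refine Finite.of_surjective (α := JudgOcc _ _ ⊕ (Place π₁ ⊕ Place π₂)) _
      (Deriv.glue_app h π₁ π₂).bij.2
  | pair h π₁ π₂ ih₁ ih₂ =>
    refine Finite.of_surjective (α := JudgOcc _ _ ⊕ (Place π₁ ⊕ Place π₂)) _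
      (Deriv.glue_pair h π₁ π₂).bij.2

instance Deriv.instFiniteFlow {Γ : Ctx} {M : Tm G} {A : Ty} (π : Deriv G Γ M A) :
    Finite π.flow.J := JudgOcc.instFinite Γ A

noncomputable instance Deriv.instFintypeFlow {Γ : Ctx} {M : Tm G} {A : Ty} (π : Deriv G Γ M A) :
    Fintype π.flow.P := @Fintype.ofFinite (Place π) _

open Classical in
/-- The amplitude of the gates and bits under an assignment of bits to the places. -/
noncomputable def Deriv.wt {Γ : Ctx} {M : Tm G} {A : Ty} (π : Deriv G Γ M A)
    (a : Place π → Bool) : ℂ :=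
  (∏ i, (G.op (π.gsym i) : Matrix _ _ ℂ) (fun k => a (π.gpt false i k))
    fun k => a (π.gpt true i k)) * ind (∀ z ∈ bitAxioms π, a z.2.2 = z.2.1)

theorem Flow.total_of_root (F : Flow) [Fintype F.P] (hF : Function.Bijective F.root)
    (w : (F.P → Bool) → ℂ) (a : F.P → Bool) :
    F.total w (fun j => a (F.root j)) = ind (F.Const a) * w a := by
  unfold total
  rw [Finset.sum_eq_single a]
  · rw [ind_true fun j => rfl, one_mul]
  · intro b _ hb
    rw [ind_false, zero_mul]
    refine fun h => hb (funext fun p => ?_)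
    obtain ⟨j, rfl⟩ := hF.2 p
    exact h j
  · simp

theorem Flow.total_congr {F : Flow} [Fintype F.P] {w w' : (F.P → Bool) → ℂ} (h : ∀ a, w a = w' a)
    (x : F.J → Bool) : F.total w x = F.total w' x := congrArg (F.total · x) (funext h)

/-- Without links inside the premises, their boundary values are read off from those of the
conclusion, so nothing is contracted. -/
theorem Flow.IsGlue.total_inl {F F' : Flow} {sub : F'.P → F.P} {mate : F'.J → F.J} [Fintype F.P]
    [Fintype F'.P] [Finite F'.J] (h : IsGlue F' F sub fun o => .inl (mate o))
    (w : (F'.P → Bool) → ℂ) (x : F.J → Bool) :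
    F.total (fun a => w fun p => a (sub p)) x = F'.total w fun o => x (mate o) := by
  classical
  have := Fintype.ofFinite F'.J
  rw [h.total_eq]
  simp only [Sum.elim_inl]
  rw [Finset.sum_eq_single fun o => x (mate o)]
  · rw [ind_true fun o => rfl, one_mul]
  · intro y _ hy
    rw [ind_false fun h => hy (funext h), zero_mul]
  · simp

theorem Deriv.wt_lam {Γ : Ctx} {M : Tm G} {A B : Ty} (π : Deriv G (some A :: Γ) M B)
    (a : Place π.lam → Bool) : π.lam.wt a = π.wt fun p => a (.lam p) := by
  unfold Deriv.wt
  congr 2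
  simp only [bitAxioms, List.forall_mem_map]

theorem Deriv.wt_lamPair {Γ : Ctx} {M : Tm G} {A B C : Ty}
    (π : Deriv G (some B :: some A :: Γ) M C) (a : Place π.lamPair → Bool) :
    π.lamPair.wt a = π.wt fun p => a (.lamPair p) := by
  unfold Deriv.wt
  congr 2
  simp only [bitAxioms, List.forall_mem_map]

theorem Deriv.wt_app {Γ Γ₁ Γ₂ : Ctx} {M N : Tm G} {A B : Ty} (h : Ctx.Split Γ Γ₁ Γ₂)
    (π₁ : Deriv G Γ₁ M (.lolli A B)) (π₂ : Deriv G Γ₂ N A) (a : Place (Deriv.app h π₁ π₂) → Bool) :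
    (Deriv.app h π₁ π₂).wt a = π₁.wt (fun p => a (.appL p)) * π₂.wt fun p => a (.appR p) := by
  unfold Deriv.wt
  rw [mul_mul_mul_comm, ← ind_and]
  congr 2
  · exact Fintype.prod_sum_type _
  · simp only [bitAxioms, List.forall_mem_append, List.forall_mem_map]

theorem Deriv.wt_pair {Γ Γ₁ Γ₂ : Ctx} {M N : Tm G} {A B : Ty} (h : Ctx.Split Γ Γ₁ Γ₂)
    (π₁ : Deriv G Γ₁ M A) (π₂ : Deriv G Γ₂ N B) (a : Place (Deriv.pair h π₁ π₂) → Bool) :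
    (Deriv.pair h π₁ π₂).wt a = π₁.wt (fun p => a (.pairL p)) * π₂.wt fun p => a (.pairR p) := by
  unfold Deriv.wt
  rw [mul_mul_mul_comm, ← ind_and]
  congr 2
  · exact Fintype.prod_sum_type _
  · simp only [bitAxioms, List.forall_mem_append, List.forall_mem_map]

/-- Meant for the axioms: with all places on the boundary, the boundary values leave a single
assignment in the sum. -/
theorem Deriv.exists_total_eq {Γ : Ctx} {M : Tm G} {A : Ty} (π : Deriv G Γ M A)
    (hπ : ∀ p : Place π, ∃ j, p = .root j) (x : JudgOcc Γ A → Bool) :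
    ∃ a : Place π → Bool, (∀ j, a (.root j) = x j) ∧
      π.flow.total π.wt x = ind (π.flow.Const a) * π.wt a := by
  have hb : Function.Bijective π.flow.root :=
    ⟨fun _ _ => Place.root.inj, fun p => (hπ p).imp fun _ h => h.symm⟩
  let e := Equiv.ofBijective _ hb
  have he : ∀ j, x (e.symm (π.flow.root j)) = x j := fun j =>
    congrArg x (e.symm_apply_apply j)
  refine ⟨fun p => x (e.symm p), he, ?_⟩
  exact (congrArg _ (funext fun j => (he j).symm)).trans
    (π.flow.total_of_root hb π.wt fun p => x (e.symm p))

theorem Deriv.total_var {Γ : Ctx} {i : ℕ} {A : Ty} (h : Ctx.Single Γ i A) (g : VC Bool Γ)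
    (x : V Bool A) : (Deriv.var (G := G) h).flow.total (Deriv.wt _) (JudgOcc.val g x) =
      (Deriv.var (G := G) h).den g x := by
  obtain ⟨a, ha, e⟩ := (Deriv.var (G := G) h).exists_total_eq (fun | .root j => ⟨j, rfl⟩)
    (JudgOcc.val g x)
  have hw : (Deriv.var h).wt a = 1 :=
    (congrArg₂ (· * ·) (Finset.prod_empty) (ind_true fun z hz => by cases hz)).trans (one_mul 1)
  rw [e, hw, mul_one]
  refine congrArg ind (propext ⟨fun H => V.ext_at fun s o => ?_, ?_⟩)
  · rw [h.val_at]
    cases s with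
    | true => simpa [ha, JudgOcc.val] using H _ _ (Move.varPos o)
    | false => simpa [ha, JudgOcc.val] using (H _ _ (Move.varNeg o)).symm
  · rintro rfl p q hm
    rcases move_var_iff.1 hm with ⟨o, rfl, rfl⟩ | ⟨o, rfl, rfl⟩
    · simpa [ha, JudgOcc.val] using (h.val_at g o).symm
    · simpa [ha, JudgOcc.val] using h.val_at g o

theorem Deriv.total_bit {Γ : Ctx} {b : Bool} {l : ℕ} (h : Ctx.Void Γ) (g : VC Bool Γ)
    (x : V Bool .bit) :
    (Deriv.bit (G := G) (b := b) (l := l) h).flow.total (Deriv.wt _) (JudgOcc.val g x) =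
      (Deriv.bit (G := G) (b := b) (l := l) h).den g x := by
  obtain ⟨a, ha, e⟩ := (Deriv.bit (G := G) (b := b) (l := l) h).exists_total_eq
    (fun | .root j => ⟨j, rfl⟩) (JudgOcc.val g x)
  have hc : (Deriv.bit (G := G) (b := b) (l := l) h).flow.Const a := fun p q hm => by cases hm
  rw [e, ind_true hc, one_mul]
  refine (congrArg₂ (· * ·) (Finset.prod_empty) (congrArg ind (propext ?_))).trans (one_mul _)
  simp only [bitAxioms, List.forall_mem_singleton, Place.atType, ha]
  exact eq_comm

theorem Deriv.total_gate {Γ : Ctx} {U : G.Sym} (h : Ctx.Void Γ) (g : VC Bool Γ)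
    (x : V Bool (.lolli (.pow (G.rank U)) (.pow (G.rank U)))) :
    (Deriv.gate h).flow.total (Deriv.wt _) (JudgOcc.val g x) = (Deriv.gate h).den g x := by
  obtain ⟨a, ha, e⟩ := (Deriv.gate (U := U) h).exists_total_eq
    (fun | .root j => ⟨j, rfl⟩) (JudgOcc.val g x)
  have hc : (Deriv.gate (U := U) h).flow.Const a := fun p q hm => by cases hm
  rw [e, ind_true hc, one_mul]
  refine (congrArg₂ (· * ·) (Finset.prod_singleton _ _) (ind_true fun z hz => by cases hz)).trans
    ((mul_one _).trans ?_)
  refine congrArg₂ (G.op U : Matrix (Fin (G.arity U) → Bool) (Fin (G.arity U) → Bool) ℂ) (funext fun k => ?_) (funext fun k => ?_)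
  · exact (ha _).trans (powV_at x.2 k)
  · exact (ha _).trans (powV_at x.1 k)

theorem Deriv.total_pair {Γ Γ₁ Γ₂ : Ctx} {M N : Tm G} {A B : Ty} (h : Ctx.Split Γ Γ₁ Γ₂)
    (π₁ : Deriv G Γ₁ M A) (π₂ : Deriv G Γ₂ N B) (g : VC Bool Γ) (x : V Bool (.tensor A B)) :
    (Deriv.pair h π₁ π₂).flow.total (Deriv.wt _) (JudgOcc.val g x) =
      π₁.flow.total π₁.wt (JudgOcc.val (h.fst g) x.1) *
        π₂.flow.total π₂.wt (JudgOcc.val (h.snd g) x.2) := by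
  have : Fintype (π₁.flow.union π₂.flow).P := instFintypeSum π₁.flow.P π₂.flow.P
  have : Finite (π₁.flow.union π₂.flow).J := inferInstanceAs (Finite (JudgOcc _ _ ⊕ JudgOcc _ _))
  have e := (glue_pair h π₁ π₂).total_inl
    (fun a => π₁.wt (fun p => a (.inl p)) * π₂.wt fun p => a (.inr p)) (JudgOcc.val g x)
  refine (Flow.total_congr (F := (Deriv.pair h π₁ π₂).flow) (wt_pair h π₁ π₂) _).trans
    (e.trans ((Flow.total_union _ _ _).trans ?_))
  · exact congrArg₂ (· * ·) (congrArg _ (funext fun j => val_pairMate h g x (.inl j)))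
      (congrArg _ (funext fun j => val_pairMate h g x (.inr j)))

theorem Deriv.total_app {Γ Γ₁ Γ₂ : Ctx} {M N : Tm G} {A B : Ty} (h : Ctx.Split Γ Γ₁ Γ₂)
    (π₁ : Deriv G Γ₁ M (.lolli A B)) (π₂ : Deriv G Γ₂ N A) (g : VC Bool Γ) (b : V Bool B) :
    (Deriv.app h π₁ π₂).flow.total (Deriv.wt _) (JudgOcc.val g b) = ∑ x : V Bool A,
      π₁.flow.total π₁.wt (JudgOcc.val (A := .lolli A B) (h.fst g) (x, b)) *
        π₂.flow.total π₂.wt (JudgOcc.val (h.snd g) x) := by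
  classical
  have : Fintype (π₁.flow.union π₂.flow).P := instFintypeSum π₁.flow.P π₂.flow.P
  have : Fintype (π₁.flow.union π₂.flow).J := @Fintype.ofFinite _
    (inferInstanceAs (Finite (JudgOcc _ _ ⊕ JudgOcc _ _)))
  have e := (glue_app h π₁ π₂).total_eq
    (fun a => π₁.wt (fun p => a (.inl p)) * π₂.wt fun p => a (.inr p)) (JudgOcc.val g b)
  refine (Flow.total_congr (F := (Deriv.app h π₁ π₂).flow) (wt_app h π₁ π₂) _).trans
    (e.trans ((Finset.sum_congr rfl fun y _ => congrArg _ (Flow.total_union _ _ _)).trans ?_))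
  -- The consistent boundary values are parametrised by `x`, injectively since `x` is visible in the
  -- premise of the argument.
  · exact Flow.sum_ind_eq (Y := (π₁.flow.union π₂.flow).J → Bool) (fun x : V Bool A =>
      Sum.elim (JudgOcc.val (A := .lolli A B) (h.fst g) (x, b)) (JudgOcc.val (h.snd g) x))
      (fun x x' hx => (JudgOcc.val_inj (funext fun j => congrFun hx (.inr j))).2)
      fun y => val_appMate_iff h g b y

/-- The sum of the amplitudes over all assignments of bits to the places which are constant along
the moves is the tensor computed by the derivation. -/
theorem Deriv.total_eq {Γ : Ctx} {M : Tm G} {A : Ty} (π : Deriv G Γ M A) (g : VC Bool Γ)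
    (x : V Bool A) : π.flow.total π.wt (JudgOcc.val g x) = π.den g x := by
  induction π with
  | var h => exact total_var h g x
  | bit h => exact total_bit h g x
  | gate h => exact total_gate h g x
  | @lam Γ M A B π ih =>
    have e := π.glue_lam.total_inl π.wt (JudgOcc.val g x)
    exact (Flow.total_congr (F := π.lam.flow) π.wt_lam _).trans
      (e.trans ((congrArg _ (funext (val_lamMate g x))).trans (ih (x.1, g) x.2)))
  | @lamPair Γ M A B C π ih =>
    have e := π.glue_lamPair.total_inl π.wt (JudgOcc.val g x)
    exact (Flow.total_congr (F := π.lamPair.flow) π.wt_lamPair _).trans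
      (e.trans ((congrArg _ (funext (val_lamPairMate g x))).trans
        (ih (x.1.2, (x.1.1, g)) x.2)))
  | app h π₁ π₂ ih₁ ih₂ =>
    rw [total_app]
    exact Finset.sum_congr rfl fun y _ => congrArg₂ _ (ih₁ _ _) (ih₂ _ _)
  | pair h π₁ π₂ ih₁ ih₂ =>
    rw [total_pair, ih₁, ih₂]
    rfl

end QLam
namespace QLam

variable {G : GateSet}

/-! ### Acyclicity -/

/-- The order in which tokens cross an interface of type `A`. -/
def V.Lt : {A : Ty} → V ℚ A → V ℚ A → Prop
  | .bit, a, b => (show ℚ from a) < (show ℚ from b)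
  | .lolli _ _, a, b => V.Lt b.1 a.1 ∧ V.Lt a.2 b.2
  | .tensor _ _, a, b => V.Lt a.1 b.1 ∧ V.Lt a.2 b.2

/-- Here `a` is a timing on the side of the value and `b` one on the side of its consumer. Tokens
cross positive occurrences from the value to the consumer and negative ones back, which reverses the
inequality. -/
theorem V.lt_iff {A : Ty} {a b : V ℚ A} : V.Lt a b ↔
    (∀ o : Occ true A, a.at o < b.at o) ∧ ∀ o : Occ false A, b.at o < a.at o := by
  induction A with
  | bit =>
    refine ⟨fun h => ⟨fun o => ?_, fun o => ?_⟩, fun h => h.1 .hole⟩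
    · cases o
      exact h
    · cases o
  | lolli A B ihA ihB =>
    refine (and_congr ihA ihB).trans ⟨fun h => ⟨fun o => ?_, fun o => ?_⟩, fun h => ?_⟩
    · cases o with
      | arg o => exact h.1.2 o
      | res o => exact h.2.1 o
    · cases o with
      | arg o => exact h.1.1 o
      | res o => exact h.2.2 o
    · exact ⟨⟨fun o => h.2 (.arg (s := false) o), fun o => h.1 (.arg (s := true) o)⟩,
        fun o => h.1 (.res o), fun o => h.2 (.res o)⟩
  | tensor A B ihA ihB =>
    refine (and_congr ihA ihB).trans ⟨fun h => ⟨fun o => ?_, fun o => ?_⟩, fun h => ?_⟩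
    · cases o with
      | fst o => exact h.1.1 o
      | snd o => exact h.2.1 o
    · cases o with
      | fst o => exact h.1.2 o
      | snd o => exact h.2.2 o
    · exact ⟨⟨fun o => h.1 (.fst o), fun o => h.2 (.fst o)⟩,
        fun o => h.1 (.snd o), fun o => h.2 (.snd o)⟩

theorem V.exists_gt {A : Ty} (a : V ℚ A) : ∃ b, V.Lt a b := by
  obtain ⟨b, hb⟩ := V.exists_at fun s (o : Occ s A) => bif s then a.at o + 1 else a.at o - 1
  exact ⟨b, V.lt_iff.2 ⟨fun o => by simp [hb], fun o => by simp [hb]⟩⟩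

theorem V.exists_lt {A : Ty} (b : V ℚ A) : ∃ a, V.Lt a b := by
  obtain ⟨a, ha⟩ := V.exists_at fun s (o : Occ s A) => bif s then b.at o - 1 else b.at o + 1
  exact ⟨a, V.lt_iff.2 ⟨fun o => by simp [ha], fun o => by simp [ha]⟩⟩

/-- Some element of `s` comes before some element of `t`. -/
def Before {A : Ty} (s t : Set (V ℚ A)) : Prop := ∃ a ∈ s, ∃ b ∈ t, V.Lt a b

/-- The sets of assignments which serve as tests at a type. -/
def IsTest : (A : Ty) → Set (V ℚ A) → Prop
  -- A token may take arbitrarily long, so a test must accept arbitrarily late arrivals.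
  | .bit, t => ∀ m : ℚ, ∃ b ∈ t, m < (show ℚ from b)
  | .lolli A B, t => ∃ s u, (∀ t', IsTest A t' → Before s t') ∧ IsTest B u ∧
      t = {p | p.1 ∈ s ∧ p.2 ∈ u}
  | .tensor A B, t => ∀ s u, (∀ t', IsTest A t' → Before s t') →
      (∀ t', IsTest B t' → Before u t') →
      Before (A := .tensor A B) {p | p.1 ∈ s ∧ p.2 ∈ u} t

/-- The sets of assignments which meet all tests at a type. -/
def IsValue (A : Ty) (s : Set (V ℚ A)) : Prop := ∀ t, IsTest A t → Before s t

/-- Products of sets which meet all tests at the types of an environment. -/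
def IsEnv : (Γ : Ctx) → Set (VC ℚ Γ) → Prop
  | [], e => e = Set.univ
  | none :: Γ, e => IsEnv Γ e
  | some A :: Γ, e => ∃ s u, IsValue A s ∧ IsEnv Γ u ∧ e = {p | p.1 ∈ s ∧ p.2 ∈ u}

/-- Non-empty tests make the full set a value, and the full set being a test makes values non-empty.
At function and tensor types each of the two assertions draws on the other, hence the conjunction.
-/
theorem isTest_univ (A : Ty) :
    IsTest A Set.univ ∧ ∀ t, IsTest A t → t.Nonempty := by
  have value : ∀ A : Ty, (∀ t, IsTest A t → t.Nonempty) → IsValue A Set.univ := fun A h t ht => by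
    obtain ⟨b, hb⟩ := h t ht
    obtain ⟨a, ha⟩ := V.exists_lt b
    exact ⟨a, trivial, b, hb, ha⟩
  induction A with
  | bit =>
    refine ⟨fun m => ⟨(m + 1 : ℚ), trivial, lt_add_one m⟩, fun t ht => ?_⟩
    obtain ⟨b, hb, -⟩ := ht 0
    exact ⟨b, hb⟩
  | lolli A B ihA ihB =>
    refine ⟨⟨Set.univ, Set.univ, value A ihA.2, ihB.1, ?_⟩, ?_⟩
    · exact Set.ext fun p => ⟨fun _ => ⟨trivial, trivial⟩, fun _ => trivial⟩
    · rintro t ⟨s, u, hs, hu, rfl⟩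
      obtain ⟨a, ha, -⟩ := hs _ ihA.1
      obtain ⟨b, hb⟩ := ihB.2 u hu
      exact ⟨(a, b), ha, hb⟩
  | tensor A B ihA ihB =>
    refine ⟨fun s u hs hu => ?_, fun t ht => ?_⟩
    · obtain ⟨a, ha, -⟩ := hs _ ihA.1
      obtain ⟨b, hb, -⟩ := hu _ ihB.1
      obtain ⟨c, hc⟩ := V.exists_gt (A := .tensor A B) (a, b)
      exact ⟨(a, b), ⟨ha, hb⟩, c, trivial, hc⟩
    · obtain ⟨-, -, b, hb, -⟩ := ht _ _ (value A ihA.2) (value B ihB.2)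
      exact ⟨b, hb⟩

theorem IsValue.nonempty {A : Ty} {s : Set (V ℚ A)} (h : IsValue A s) : s.Nonempty :=
  let ⟨a, ha, _⟩ := h _ (isTest_univ A).1
  ⟨a, ha⟩

theorem isValue_univ (A : Ty) : IsValue A Set.univ := fun t ht => by
  obtain ⟨b, hb⟩ := (isTest_univ A).2 t ht
  obtain ⟨a, ha⟩ := V.exists_lt b
  exact ⟨a, trivial, b, hb, ha⟩

theorem exists_isEnv : (Γ : Ctx) → ∃ e, IsEnv Γ e
  | [] => ⟨_, rfl⟩
  | none :: Γ => exists_isEnv Γ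
  | some A :: Γ =>
    let ⟨e, he⟩ := exists_isEnv Γ
    ⟨_, _, e, isValue_univ A, he, rfl⟩

theorem IsEnv.nonempty {Γ : Ctx} {e : Set (VC ℚ Γ)} (h : IsEnv Γ e) : e.Nonempty := by
  induction Γ with
  | nil => exact ⟨(), h ▸ trivial⟩
  | cons o Γ ih =>
    cases o with
    | none => exact ih h
    | some A =>
      obtain ⟨s, u, hs, hu, rfl⟩ := h
      obtain ⟨a, ha⟩ := hs.nonempty
      obtain ⟨g, hg⟩ := ih hu
      exact ⟨(a, g), ha, hg⟩

theorem IsEnv.single {Γ : Ctx} {i : ℕ} {A : Ty} (h : Ctx.Single Γ i A) :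
    ∀ {e : Set (VC ℚ Γ)}, IsEnv Γ e → ∃ s, IsValue A s ∧ ∀ a ∈ s, ∃ g ∈ e, h.val g = a := by
  induction h with
  | zero hv =>
    rintro _ ⟨s, u, hs, hu, rfl⟩
    obtain ⟨g, hg⟩ := IsEnv.nonempty hu
    exact ⟨s, hs, fun a ha => ⟨(a, g), ⟨ha, hg⟩, rfl⟩⟩
  | succ h ih =>
    intro e he
    exact ih he

theorem Ctx.Single.exists_val {Γ : Ctx} {i : ℕ} {A : Ty} (h : Ctx.Single Γ i A) (a : V ℚ A) :
    ∃ g, h.val g = a := by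
  induction h with
  | @zero Γ A hv =>
    obtain ⟨g, -⟩ := VC.exists_at fun s (_ : CtxOcc s Γ) => (0 : ℚ)
    exact ⟨(a, g), rfl⟩
  | succ h ih => exact ih a

theorem IsEnv.split {Γ Γ₁ Γ₂ : Ctx} (h : Ctx.Split Γ Γ₁ Γ₂) :
    ∀ {e : Set (VC ℚ Γ)}, IsEnv Γ e → ∃ e₁ e₂, IsEnv Γ₁ e₁ ∧ IsEnv Γ₂ e₂ ∧
      ∀ g₁ ∈ e₁, ∀ g₂ ∈ e₂, ∃ g ∈ e, h.fst g = g₁ ∧ h.snd g = g₂ := by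
  induction h with
  | nil =>
    rintro _ rfl
    exact ⟨Set.univ, Set.univ, rfl, rfl, fun _ _ _ _ => ⟨(), trivial, rfl, rfl⟩⟩
  | skip h ih =>
    intro e he
    exact ih he
  | left h ih =>
    rintro _ ⟨s, u, hs, hu, rfl⟩
    obtain ⟨e₁, e₂, he₁, he₂, H⟩ := ih hu
    refine ⟨_, e₂, ⟨s, e₁, hs, he₁, rfl⟩, he₂, fun g₁ hg₁ g₂ hg₂ => ?_⟩
    obtain ⟨g, hg, h₁, h₂⟩ := H g₁.2 hg₁.2 g₂ hg₂
    exact ⟨(g₁.1, g), ⟨hg₁.1, hg⟩, Prod.ext rfl h₁, h₂⟩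
  | right h ih =>
    rintro _ ⟨s, u, hs, hu, rfl⟩
    obtain ⟨e₁, e₂, he₁, he₂, H⟩ := ih hu
    refine ⟨e₁, _, he₁, ⟨s, e₂, hs, he₂, rfl⟩, fun g₁ hg₁ g₂ hg₂ => ?_⟩
    obtain ⟨g, hg, h₁, h₂⟩ := H g₁ hg₁ g₂.2 hg₂.2
    exact ⟨(g₂.1, g), ⟨hg₂.1, hg⟩, h₁, Prod.ext rfl h₂⟩

/-- Since tests at 𝔹 are unbounded, singletons are values there and, inductively, at the tensor
powers. A test thus lies partly beyond any given timing. -/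
theorem IsTest.pow {n : ℕ} : ∀ {t : Set (V ℚ (.pow n))}, IsTest (.pow n) t →
    ∀ a, ∃ b ∈ t, V.Lt a b := by
  induction n with
  | zero => exact fun ht a => ht a
  | succ n ih =>
    intro t ht a
    obtain ⟨a', ⟨h₁, h₂⟩, b, hb, hab⟩ := ht {a.1} {a.2}
      (fun t' ht' => ⟨a.1, rfl, ht' a.1⟩) (fun t' ht' => ⟨a.2, rfl, ih ht' a.2⟩)
    exact ⟨b, hb, (Prod.ext h₁ h₂ : a' = a) ▸ hab⟩

/-- A ranking of the places which increases along the moves and from the arguments of the gates to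
their results. -/
def Deriv.Ranked {Γ : Ctx} {M : Tm G} {A : Ty} (π : Deriv G Γ M A) (r : Place π → ℚ) : Prop :=
  π.flow.Mono r ∧ ∀ i k k', r (π.gpt true i k) < r (π.gpt false i k')

/-- The assignments to the conclusion which are compatible with a ranking and with some assignment
to the environment in `e`. -/
def Deriv.realized {Γ : Ctx} {M : Tm G} {A : Ty} (π : Deriv G Γ M A) (e : Set (VC ℚ Γ)) :
    Set (V ℚ A) :=
  {b | ∃ g ∈ e, ∃ r, π.Ranked r ∧ π.flow.Fits r (JudgOcc.val g b)}

theorem Deriv.fits_iff {Γ : Ctx} {M : Tm G} {A : Ty} {π : Deriv G Γ M A} {r : Place π → ℚ}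
    {g : VC ℚ Γ} {b : V ℚ A} : π.flow.Fits r (JudgOcc.val g b) ↔
      ((∀ v : CtxOcc true Γ, g.at v < r (.atCtx v)) ∧ ∀ v : CtxOcc false Γ, r (.atCtx v) < g.at v) ∧
        (∀ o : Occ true A, r (.atType true o) < b.at o) ∧
          ∀ o : Occ false A, b.at o < r (.atType false o) := by
  constructor
  · intro h
    exact ⟨⟨fun v => (h (.ctx v)).2 rfl, fun v => (h (.ctx v)).1 rfl⟩,
      fun o => (h (.concl o)).1 rfl, fun o => (h (.concl o)).2 rfl⟩
  · rintro ⟨⟨h₁, h₂⟩, h₃, h₄⟩ (@⟨_ | _, v⟩ | @⟨_ | _, o⟩)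
    · exact ⟨fun _ => h₂ v, fun h => Bool.noConfusion h⟩
    · exact ⟨fun h => Bool.noConfusion h, fun _ => h₁ v⟩
    · exact ⟨fun h => Bool.noConfusion h, fun _ => h₄ o⟩
    · exact ⟨fun _ => h₃ o, fun h => Bool.noConfusion h⟩

theorem Deriv.fits_of_lt {Γ : Ctx} {M : Tm G} {A : Ty} {π : Deriv G Γ M A} {r : Place π → ℚ}
    {g : VC ℚ Γ} {a b : V ℚ A} (h : π.flow.Fits r (JudgOcc.val g a)) (hab : V.Lt a b) :
    π.flow.Fits r (JudgOcc.val g b) := by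
  rw [fits_iff] at h ⊢
  rw [V.lt_iff] at hab
  exact ⟨h.1, fun o => (h.2.1 o).trans (hab.1 o), fun o => (hab.2 o).trans (h.2.2 o)⟩

/-- The inequalities in `Fits` are strict, so midpoints leave room for a smaller timing. This slack
turns a realized element of a test into an instance of `Before`. -/
theorem Deriv.exists_fits_lt {Γ : Ctx} {M : Tm G} {A : Ty} {π : Deriv G Γ M A} {r : Place π → ℚ}
    {g : VC ℚ Γ} {b : V ℚ A} (h : π.flow.Fits r (JudgOcc.val g b)) :
    ∃ a, V.Lt a b ∧ π.flow.Fits r (JudgOcc.val g a) := by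
  rw [fits_iff] at h
  obtain ⟨a, ha⟩ := V.exists_at fun s (o : Occ s A) => (b.at o + r (.atType s o)) / 2
  refine ⟨a, V.lt_iff.2 ⟨fun o => ?_, fun o => ?_⟩, fits_iff.2 ⟨h.1, fun o => ?_, fun o => ?_⟩⟩
  · have := h.2.1 o
    rw [ha]
    linarith
  · have := h.2.2 o
    rw [ha]
    linarith
  · have := h.2.1 o
    rw [ha]
    linarith
  · have := h.2.2 o
    rw [ha]
    linarith

/-- A link between two old boundary places carries one common value, which lies strictly between the
ranks of its ends. -/
theorem Flow.IsGlue.exists_rank_of_eq {F F' : Flow} {sub : F'.P → F.P} {mate : F'.J → F.J ⊕ F'.J}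
    (h : IsGlue F' F sub mate) {r' : F'.P → ℚ} (hr : F'.Mono r') {y : F.J → ℚ} {y' : F'.J → ℚ}
    (hy : F'.Fits r' y') (H : ∀ o, y' o = Sum.elim y y' (mate o)) :
    ∃ r : F.P → ℚ, F.Mono r ∧ F.Fits r y ∧ ∀ p, r (sub p) = r' p := by
  refine h.exists_rank hr hy (fun o j ho => ?_) fun o o' ho hout => ?_
  · rw [H, ho]
    rfl
  · have e := H o
    rw [ho] at e
    exact ((hy o).1 hout).trans (e ▸ (hy o').2 (by rw [h.out_inr o o' ho, hout]; rfl))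

end QLam
-- Every derivation meets every test.
namespace QLam

variable {G : GateSet}

theorem Deriv.realized_var {Γ : Ctx} {i : ℕ} {A : Ty} (h : Ctx.Single Γ i A) {e : Set (VC ℚ Γ)}
    (he : IsEnv Γ e) {t : Set (V ℚ A)} (ht : IsTest A t) :
    ∃ b ∈ t, b ∈ (Deriv.var (G := G) h).realized e := by
  obtain ⟨s, hs, H⟩ := he.single h
  obtain ⟨a, ha, b, hb, hab⟩ := hs t ht
  obtain ⟨g, hg, rfl⟩ := H a ha
  obtain ⟨g', rfl⟩ := h.exists_val b
  rw [V.lt_iff] at hab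
  simp only [h.val_at] at hab
  -- The two ends of the axiom are placed at the thirds of the interval between `g` and `g'`, which
  -- makes all three inequalities strict.
  refine ⟨_, hb, g, hg, fun p => match p with
    | .root (.ctx v) => (2 * g.at v + g'.at v) / 3
    | .root (.concl o) => (g.at (h.occ o) + 2 * g'.at (h.occ o)) / 3, ⟨fun p q hm => ?_,
      fun i => Empty.elim i⟩, fits_iff.2 ⟨⟨fun v => ?_, fun v => ?_⟩, fun o => ?_, fun o => ?_⟩⟩
  · rcases move_var_iff.1 hm with ⟨o, rfl, rfl⟩ | ⟨o, rfl, rfl⟩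
    · have := hab.1 o
      dsimp only
      linarith
    · have := hab.2 o
      dsimp only
      linarith
  · obtain ⟨o, rfl⟩ := h.exists_occ v
    have := hab.1 o
    dsimp only
    linarith
  · obtain ⟨o, rfl⟩ := h.exists_occ v
    have := hab.2 o
    dsimp only
    linarith
  · have := hab.1 o
    simp only [h.val_at]
    linarith
  · have := hab.2 o
    simp only [h.val_at]
    linarith

theorem Deriv.realized_bit {Γ : Ctx} {b : Bool} {l : ℕ} (h : Ctx.Void Γ) {e : Set (VC ℚ Γ)}
    (he : IsEnv Γ e) {t : Set (V ℚ .bit)} (ht : IsTest .bit t) :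
    ∃ c ∈ t, c ∈ (Deriv.bit (G := G) (b := b) (l := l) h).realized e := by
  obtain ⟨g, hg⟩ := he.nonempty
  obtain ⟨c, hc, hlt⟩ := ht 0
  refine ⟨c, hc, g, hg, fun _ => 0, ⟨fun p q hm => (by cases hm), fun i => Empty.elim i⟩,
    fits_iff.2 ⟨⟨fun v => (h.no_occ v).elim, fun v => (h.no_occ v).elim⟩, fun o => ?_,
      fun o => ?_⟩⟩
  · cases o
    exact hlt
  · cases o

theorem Deriv.realized_gate {Γ : Ctx} {U : G.Sym} (h : Ctx.Void Γ) {e : Set (VC ℚ Γ)}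
    (he : IsEnv Γ e) {t : Set (V ℚ (.lolli (.pow (G.rank U)) (.pow (G.rank U))))}
    (ht : IsTest _ t) : ∃ c ∈ t, c ∈ (Deriv.gate (U := U) h).realized e := by
  obtain ⟨g, hg⟩ := he.nonempty
  obtain ⟨s, u, hs, hu, rfl⟩ := ht
  obtain ⟨a, ha⟩ := IsValue.nonempty hs
  -- The gate waits for its last argument: `m` bounds the arrival times, the arguments are ranked `m
  -- + 1`, the results `m + 2`, and the test accepts a still later delivery.
  obtain ⟨m, hm⟩ := (Set.finite_range (powV a)).bddAbove
  obtain ⟨b, hb, hlt⟩ := hu.pow (unpowV fun _ => m + 2)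
  rw [V.lt_iff] at hlt
  refine ⟨(a, b), ⟨ha, hb⟩, g, hg, fun p => match p with
    | .root (.ctx v) => 0
    | .root (.concl (.arg o)) => m + 1
    | .root (.concl (.res o)) => m + 2, ⟨fun p q hm => (by cases hm), fun i k k' => ?_⟩,
    fits_iff.2 ⟨⟨fun v => (h.no_occ v).elim, fun v => (h.no_occ v).elim⟩, fun o => ?_,
      fun o => ?_⟩⟩
  · simp only [gpt, Place.atType]
    linarith
  · rcases o with _ | _ | _ | o | o
    · exact o.pow_false.elim
    · have := hlt.1 o
      obtain ⟨k, rfl⟩ := exists_powOcc o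
      rwa [powV_at, powV_unpowV] at this
  · rcases o with _ | _ | _ | o | o
    · obtain ⟨k, rfl⟩ := exists_powOcc o
      have := hm ⟨k, rfl⟩
      rw [← powV_at] at this
      exact lt_of_le_of_lt this (lt_add_one m)
    · exact o.pow_false.elim

theorem Deriv.isValue_realized {Γ : Ctx} {M : Tm G} {A : Ty} {π : Deriv G Γ M A}
    {e : Set (VC ℚ Γ)} (h : ∀ t, IsTest A t → ∃ b ∈ t, b ∈ π.realized e) :
    IsValue A (π.realized e) := fun t ht => by
  obtain ⟨b, hb, g, hg, r, hr, hf⟩ := h t ht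
  obtain ⟨a, hab, ha⟩ := exists_fits_lt hf
  exact ⟨a, ⟨g, hg, r, hr, ha⟩, b, hb, hab⟩

theorem Deriv.fits_of_gt {Γ : Ctx} {M : Tm G} {A B C : Ty}
    {π : Deriv G (some B :: some A :: Γ) M C} {r : Place π → ℚ} {g : VC ℚ Γ} {c : V ℚ C}
    {p q : V ℚ (.tensor A B)}
    (h : π.flow.Fits r (JudgOcc.val (Γ := some B :: some A :: Γ) (q.2, (q.1, g)) c))
    (hpq : V.Lt p q) :
    π.flow.Fits r (JudgOcc.val (Γ := some B :: some A :: Γ) (p.2, (p.1, g)) c) := by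
  replace h := fits_iff.1 h
  rw [V.lt_iff] at hpq
  refine fits_iff.2 ⟨⟨?_, ?_⟩, h.2⟩
  · rintro (o | (o | v))
    · exact (hpq.1 (.snd o)).trans (h.1.1 (.here o))
    · exact (hpq.1 (.fst o)).trans (h.1.1 (.there (.here o)))
    · exact h.1.1 (.there (.there v))
  · rintro (o | (o | v))
    · exact (h.1.2 (.here o)).trans (hpq.2 (.snd o))
    · exact (h.1.2 (.there (.here o))).trans (hpq.2 (.fst o))
    · exact h.1.2 (.there (.there v))

/-- The same slack as in `Deriv.exists_fits_lt`, on the side of the two bound variables, where the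
order is reversed. -/
theorem Deriv.exists_fits_gt {Γ : Ctx} {M : Tm G} {A B C : Ty}
    {π : Deriv G (some B :: some A :: Γ) M C} {r : Place π → ℚ} {g : VC ℚ Γ} {c : V ℚ C}
    {p : V ℚ (.tensor A B)}
    (h : π.flow.Fits r (JudgOcc.val (Γ := some B :: some A :: Γ) (p.2, (p.1, g)) c)) :
    ∃ q : V ℚ (.tensor A B), V.Lt p q ∧
      π.flow.Fits r (JudgOcc.val (Γ := some B :: some A :: Γ) (q.2, (q.1, g)) c) := by
  replace h := fits_iff.1 h
  obtain ⟨q₁, hq₁⟩ := V.exists_at fun s (o : Occ s A) =>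
    (V.at (A := A) p.1 o + r (.atCtx (.there (.here o)))) / 2
  obtain ⟨q₂, hq₂⟩ := V.exists_at fun s (o : Occ s B) =>
    (V.at (A := B) p.2 o + r (.atCtx (.here o))) / 2
  have h₁ : ∀ o : Occ true A, V.at (A := A) p.1 o < r (.atCtx (.there (.here o))) :=
    fun o => h.1.1 (.there (.here o))
  have h₂ : ∀ o : Occ false A, r (.atCtx (.there (.here o))) < V.at (A := A) p.1 o :=
    fun o => h.1.2 (.there (.here o))
  have h₃ : ∀ o : Occ true B, V.at (A := B) p.2 o < r (.atCtx (.here o)) :=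
    fun o => h.1.1 (.here o)
  have h₄ : ∀ o : Occ false B, r (.atCtx (.here o)) < V.at (A := B) p.2 o :=
    fun o => h.1.2 (.here o)
  refine ⟨(q₁, q₂), V.lt_iff.2 ⟨?_, ?_⟩, fits_iff.2 ⟨⟨?_, ?_⟩, h.2⟩⟩
  · rintro (_ | o | o | _ | _)
    · have := h₁ o
      show p.1.at o < q₁.at o
      rw [hq₁]
      linarith
    · have := h₃ o
      show p.2.at o < q₂.at o
      rw [hq₂]
      linarith
  · rintro (_ | o | o | _ | _)
    · have := h₂ o
      show q₁.at o < p.1.at o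
      rw [hq₁]
      linarith
    · have := h₄ o
      show q₂.at o < p.2.at o
      rw [hq₂]
      linarith
  · rintro (o | (o | v))
    · have := h₃ o
      show q₂.at o < _
      rw [hq₂]
      linarith
    · have := h₁ o
      show q₁.at o < _
      rw [hq₁]
      linarith
    · exact h.1.1 (.there (.there v))
  · rintro (o | (o | v))
    · have := h₄ o
      show _ < q₂.at o
      rw [hq₂]
      linarith
    · have := h₂ o
      show _ < q₁.at o
      rw [hq₁]
      linarith
    · exact h.1.2 (.there (.there v))

/-- The statement speaks of tests and not of fixed timings because the time at which an argument
answers may depend on when the function queries it. Sets of timings record this dependence well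
enough for the induction to pass through application. -/
theorem Deriv.exists_realized {Γ : Ctx} {M : Tm G} {A : Ty} (π : Deriv G Γ M A) :
    ∀ {e : Set (VC ℚ Γ)}, IsEnv Γ e → ∀ t, IsTest A t → ∃ b ∈ t, b ∈ π.realized e := by
  induction π with
  | var h => exact fun he t ht => realized_var h he ht
  | bit h => exact fun he t ht => realized_bit h he ht
  | gate h => exact fun he t ht => realized_gate h he ht
  | @lam Γ M A B π ih =>
    rintro e he _ ⟨s, u, hs, hu, rfl⟩
    obtain ⟨b, hb, g, ⟨hg₁, hg₂⟩, r', hr', hf⟩ := ih (e := {p | p.1 ∈ s ∧ p.2 ∈ e})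
      ⟨s, e, hs, he, rfl⟩ u hu
    obtain ⟨r, hr, hrf, hsub⟩ := π.glue_lam.exists_rank_of_eq hr'.1 hf
      (y := JudgOcc.val (A := .lolli A B) g.2 (g.1, b)) fun o => (val_lamMate g.2 (g.1, b) o).symm
    refine ⟨(g.1, b), ⟨hg₁, hb⟩, g.2, hg₂, r, ⟨hr, fun i k k' => ?_⟩, hrf⟩
    exact (hsub _).symm ▸ (hsub _).symm ▸ hr'.2 i k k'
  | @lamPair Γ M A B C π ih =>
    rintro e he _ ⟨s, u, hs, hu, rfl⟩
    -- The set `s` need not be a product, so its components cannot be put into the environment.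
    -- Instead the timings `q` that the body admits for some `c ∈ u` are shown to be a test on the
    -- tensor type, and `s` meets it.
    obtain ⟨p, hp, q, ⟨g, hg, c, hc, r', hr', hf⟩, hpq⟩ := hs {q | ∃ g ∈ e, ∃ c ∈ u, ∃ r',
        π.Ranked r' ∧ π.flow.Fits r' (JudgOcc.val (Γ := some B :: some A :: Γ)
          (q.2, (q.1, g)) c)} fun s₁ s₂ h₁ h₂ => by
      obtain ⟨c, hc, ⟨a₂, a₁, g⟩, ⟨ha₂, ha₁, hg⟩, r', hr', hf⟩ := ih
        (e := {p | p.1 ∈ s₂ ∧ p.2 ∈ {p : VC ℚ (some A :: Γ) | p.1 ∈ s₁ ∧ p.2 ∈ e}})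
        ⟨s₂, _, h₂, ⟨s₁, e, h₁, he, rfl⟩, rfl⟩ u hu
      obtain ⟨q, hq, hfq⟩ := exists_fits_gt (p := (a₁, a₂)) hf
      exact ⟨(a₁, a₂), ⟨ha₁, ha₂⟩, q, ⟨g, hg, c, hc, r', hr', hfq⟩, hq⟩
    obtain ⟨r, hr, hrf, hsub⟩ := π.glue_lamPair.exists_rank_of_eq hr'.1 (fits_of_gt hf hpq)
      (y := JudgOcc.val (A := .lolli (.tensor A B) C) g (p, c))
      fun o => (val_lamPairMate g (p, c) o).symm
    refine ⟨(p, c), ⟨hp, hc⟩, g, hg, r, ⟨hr, fun i k k' => ?_⟩, hrf⟩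
    exact (hsub _).symm ▸ (hsub _).symm ▸ hr'.2 i k k'
  | @app Γ Γ₁ Γ₂ M N A B h π₁ π₂ ih₁ ih₂ =>
    intro e he t ht
    obtain ⟨e₁, e₂, he₁, he₂, H⟩ := IsEnv.split h he
    -- The timings realized by the argument form a value, hence with `t` a test for the function.
    -- The function meets it at a timing `a` that suits both premises, so their rankings fit
    -- together.
    obtain ⟨⟨a, b⟩, ⟨⟨g₂, hg₂, r₂, hr₂, hf₂⟩, hb⟩, g₁, hg₁, r₁, hr₁, hf₁⟩ := ih₁ he₁ _
      ⟨π₂.realized e₂, t, isValue_realized (ih₂ he₂), ht, rfl⟩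
    obtain ⟨g, hg, rfl, rfl⟩ := H g₁ hg₁ g₂ hg₂
    have hmono : (π₁.flow.union π₂.flow).Mono (Sum.elim r₁ r₂) := by
      rintro _ _ (h | h)
      · exact hr₁.1 _ _ h
      · exact hr₂.1 _ _ h
    have hfits : (π₁.flow.union π₂.flow).Fits (Sum.elim r₁ r₂) (Sum.elim
        (JudgOcc.val (A := .lolli A B) (h.fst g) (a, b)) (JudgOcc.val (h.snd g) a)) := by
      rintro (j | j)
      · exact hf₁ j
      · exact hf₂ j
    obtain ⟨r, hr, hrf, hsub⟩ := (glue_app h π₁ π₂).exists_rank_of_eq hmono hfits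
      (y := JudgOcc.val g b) ((val_appMate_iff h g b _).2 ⟨a, rfl⟩)
    · refine ⟨b, hb, g, hg, r, ⟨hr, ?_⟩, hrf⟩
      rintro (i | i) k k'
      · exact (hsub (.inl _)).symm ▸ (hsub (.inl _)).symm ▸ hr₁.2 i k k'
      · exact (hsub (.inr _)).symm ▸ (hsub (.inr _)).symm ▸ hr₂.2 i k k'
  | @pair Γ Γ₁ Γ₂ M N A B h π₁ π₂ ih₁ ih₂ =>
    intro e he t ht
    obtain ⟨e₁, e₂, he₁, he₂, H⟩ := IsEnv.split h he
    obtain ⟨a, ⟨⟨g₁, hg₁, r₁, hr₁, hf₁⟩, g₂, hg₂, r₂, hr₂, hf₂⟩, b, hb, hab⟩ :=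
      ht _ _ (isValue_realized (ih₁ he₁)) (isValue_realized (ih₂ he₂))
    obtain ⟨g, hg, rfl, rfl⟩ := H g₁ hg₁ g₂ hg₂
    have hmono : (π₁.flow.union π₂.flow).Mono (Sum.elim r₁ r₂) := by
      rintro _ _ (h | h)
      · exact hr₁.1 _ _ h
      · exact hr₂.1 _ _ h
    have hfits : (π₁.flow.union π₂.flow).Fits (Sum.elim r₁ r₂) (Sum.elim
        (JudgOcc.val (h.fst g) a.1) (JudgOcc.val (h.snd g) a.2)) := by
      rintro (j | j)
      · exact hf₁ j
      · exact hf₂ j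
    obtain ⟨r, hr, hrf, hsub⟩ := (glue_pair h π₁ π₂).exists_rank_of_eq hmono hfits
      (y := JudgOcc.val g a) fun o => (val_pairMate h g a o).symm
    · refine ⟨b, hb, g, hg, r, ⟨hr, ?_⟩, fits_of_lt hrf hab⟩
      rintro (i | i) k k'
      · exact (hsub (.inl _)).symm ▸ (hsub (.inl _)).symm ▸ hr₁.2 i k k'
      · exact (hsub (.inr _)).symm ▸ (hsub (.inr _)).symm ▸ hr₂.2 i k k'

theorem Deriv.exists_ranked {Γ : Ctx} {M : Tm G} {A : Ty} (π : Deriv G Γ M A) :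
    ∃ r, π.Ranked r := by
  obtain ⟨e, he⟩ := exists_isEnv Γ
  obtain ⟨b, -, g, -, r, hr, -⟩ := π.exists_realized he _ (isTest_univ A).1
  exact ⟨r, hr⟩

end QLam
namespace QLam

variable {G : GateSet}

/-! ### The machine as a network -/

theorem nodup_occs (A : Ty) : ∀ s, (occs s A).Nodup := by
  induction A with
  | bit => intro s; cases s <;> simp [occs]
  | lolli A B ihA ihB =>
    intro s
    have h : ((occs (!s) A).map (Occ.arg (B := B)) ++ (occs s B).map Occ.res).Nodup := by
      refine ((ihA _).map fun _ _ => Occ.arg.inj).append ((ihB s).map fun _ _ => Occ.res.inj) ?_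
      simp [List.Disjoint]
    cases s <;> exact h
  | tensor A B ihA ihB =>
    intro s
    have h : ((occs s A).map (Occ.fst (B := B)) ++ (occs s B).map Occ.snd).Nodup := by
      refine ((ihA _).map fun _ _ => Occ.fst.inj).append ((ihB s).map fun _ _ => Occ.snd.inj) ?_
      simp [List.Disjoint]
    cases s <;> exact h

theorem nodup_ctxOccs (s : Bool) : ∀ Γ, (ctxOccs s Γ).Nodup
  | [] => List.nodup_nil
  | none :: Γ => (nodup_ctxOccs s Γ).map fun _ _ => CtxOcc.there.inj
  | some A :: Γ => by
    refine ((nodup_occs A s).map fun _ _ => CtxOcc.here.inj).append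
      ((nodup_ctxOccs s Γ).map fun _ _ => CtxOcc.there.inj) ?_
    simp [List.Disjoint]

theorem JudgOcc.ctx_inj {Γ : Ctx} {A : Ty} {s : Bool} :
    Function.Injective (JudgOcc.ctx (Γ := Γ) (A := A) (s := s)) :=
  fun _ _ h => eq_of_heq (JudgOcc.ctx.inj h).2

theorem JudgOcc.concl_inj {Γ : Ctx} {A : Ty} {s : Bool} :
    Function.Injective (JudgOcc.concl (Γ := Γ) (A := A) (s := s)) :=
  fun _ _ h => eq_of_heq (JudgOcc.concl.inj h).2

theorem nodup_inputs (Γ : Ctx) (A : Ty) : (inputs Γ A).Nodup := by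
  refine ((nodup_ctxOccs true Γ).map JudgOcc.ctx_inj).append
    ((nodup_occs A false).map JudgOcc.concl_inj) ?_
  simp [List.Disjoint]

theorem nodup_outputs (Γ : Ctx) (A : Ty) : (outputs Γ A).Nodup := by
  refine ((nodup_ctxOccs false Γ).map JudgOcc.ctx_inj).append
    ((nodup_occs A true).map JudgOcc.concl_inj) ?_
  simp [List.Disjoint]

section Machine

variable {Γ : Ctx} {M : Tm G} {A : Ty}

theorem nodup_bitAxioms (π : Deriv G Γ M A) : ((bitAxioms π).map fun z => z.2.2).Nodup := by
  induction π with
  | var h => exact List.nodup_nil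
  | bit h => exact List.nodup_singleton _
  | gate h => exact List.nodup_nil
  | lam π ih => simpa [bitAxioms, Function.comp_def] using ih.map fun _ _ => Place.lam.inj
  | lamPair π ih => simpa [bitAxioms, Function.comp_def] using ih.map fun _ _ => Place.lamPair.inj
  | app h π₁ π₂ ih₁ ih₂ =>
    have hd : ∀ (l : List (Place π₁)) (l' : List (Place π₂)),
        (l.map (Place.appL (h := h) (π₂ := π₂))).Disjoint (l'.map Place.appR) :=
        fun l l' a h₁ h₂ => by
      obtain ⟨p, -, rfl⟩ := List.mem_map.1 h₁
      obtain ⟨q, -, e⟩ := List.mem_map.1 h₂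
      cases e
    simpa [bitAxioms, Function.comp_def] using (ih₁.map fun _ _ => Place.appL.inj).append
      (ih₂.map fun _ _ => Place.appR.inj) (hd _ _)
  | pair h π₁ π₂ ih₁ ih₂ =>
    have hd : ∀ (l : List (Place π₁)) (l' : List (Place π₂)),
        (l.map (Place.pairL (h := h) (π₂ := π₂))).Disjoint (l'.map Place.pairR) :=
        fun l l' a h₁ h₂ => by
      obtain ⟨p, -, rfl⟩ := List.mem_map.1 h₁
      obtain ⟨q, -, e⟩ := List.mem_map.1 h₂
      cases e
    simpa [bitAxioms, Function.comp_def] using (ih₁.map fun _ _ => Place.pairL.inj).append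
      (ih₂.map fun _ _ => Place.pairR.inj) (hd _ _)

theorem sortedBits_perm (π : Deriv G Γ M A) : (sortedBits π).Perm (bitAxioms π) :=
  List.perm_insertionSort _ _

theorem bitOcc_injective (π : Deriv G Γ M A) : Function.Injective (bitOcc π) := by
  have h := ((sortedBits_perm π).map fun z => z.2.2).nodup_iff.2 (nodup_bitAxioms π)
  intro j j' e
  exact List.inj_on_of_nodup_map h (List.get_mem _ _) (List.get_mem _ _) e |>
    ((sortedBits_perm π).nodup_iff.2 (nodup_bitAxioms π).of_map).injective_get

theorem exists_bitOcc (π : Deriv G Γ M A) (p : Place π) : (∃ j, bitOcc π j = p) ↔ π.flow.B p := by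
  constructor
  · rintro ⟨j, rfl⟩
    exact ⟨_, (sortedBits_perm π).mem_iff.1 (List.get_mem _ j), rfl⟩
  · rintro ⟨z, hz, rfl⟩
    obtain ⟨j, rfl⟩ := List.get_of_mem ((sortedBits_perm π).mem_iff.2 hz)
    exact ⟨j, rfl⟩

/-- The places before (`f = true`) and after (`f = false`) a move of a single token or of the
tokens at a gate. -/
def Deriv.npt (π : Deriv G Γ M A) (f : Bool) : (v : {e : Place π × Place π // Move e.1 e.2} ⊕ π.GIx) →
    Fin (Sum.elim (fun _ => 1) (fun i => G.arity (π.gsym i)) v) → Place π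
  | .inl e, _ => bif f then e.1.1 else e.1.2
  | .inr i, k => π.gpt f i k

/-- The network of a derivation, where the moves of single tokens are gates of arity one. -/
noncomputable def Deriv.net (π : Deriv G Γ M A) : Net (Place π) where
  N := {e : Place π × Place π // Move e.1 e.2} ⊕ π.GIx
  k := Sum.elim (fun _ => 1) fun i => G.arity (π.gsym i)
  op
    | .inl _ => 1
    | .inr i => (G.op (π.gsym i)).1
  arg := π.npt true
  res := π.npt false

/-- The way of leaving or reaching a place by an element of the network. -/
def Deriv.way (π : Deriv G Γ M A) (f : Bool) : (x : (v : π.net.N) × Fin (π.net.k v)) →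
    JudgOcc Γ A ⊕ Place π ⊕ ((i : π.GIx) × Fin (G.arity (π.gsym i))) ⊕ Unit
  | ⟨.inl e, _⟩ => .inr (.inl (bif f then e.1.2 else e.1.1))
  | ⟨.inr i, k⟩ => .inr (.inr (.inl ⟨i, k⟩))

theorem Deriv.way_npt (π : Deriv G Γ M A) (f : Bool) (x : (v : π.net.N) × Fin (π.net.k v)) :
    π.flow.Way f (fun y : (i : π.GIx) × Fin (G.arity (π.gsym i)) => π.gpt f y.1 y.2)
      (π.npt f x.1 x.2) (π.way f x) := by
  rcases x with ⟨e | i, k⟩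
  · cases f <;> exact e.2
  · rfl

/-- An element of the network at a place is a way of leaving or reaching it, and by `Deriv.exact`
there is only one. For a move, the way records the other end. -/
theorem Deriv.npt_inj (π : Deriv G Γ M A) (f : Bool) (x y : (v : π.net.N) × Fin (π.net.k v))
    (h : π.npt f x.1 x.2 = π.npt f y.1 y.2) : x = y := by
  have hw : π.way f x = π.way f y :=
    (π.exact f _).unique (π.way_npt f x) (h ▸ π.way_npt f y)
  rcases x with ⟨⟨⟨p, q⟩, e⟩ | i, k⟩ <;> rcases y with ⟨⟨⟨p', q'⟩, e'⟩ | i', k'⟩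
  · have hk : k = (0 : Fin 1) := Subsingleton.elim (α := Fin 1) _ _
    have hk' : k' = (0 : Fin 1) := Subsingleton.elim (α := Fin 1) _ _
    rw [hk, hk']
    cases f <;> cases hw <;> cases h <;> rfl
  · cases hw
  · cases hw
  · cases hw
    rfl

theorem Deriv.not_exists_npt (π : Deriv G Γ M A) (f : Bool) (p : Place π) :
    (¬ ∃ v k, π.npt f v k = p) ↔
      (∃ j : JudgOcc Γ A, j.isOut = f ∧ Place.root j = p) ∨ f = false ∧ π.flow.B p := by
  constructor
  · intro h
    obtain ⟨t, ht, -⟩ := π.exact f p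
    rcases t with j | q | ⟨i, k⟩ | u
    · exact .inl ⟨j, ht⟩
    · refine absurd ?_ h
      cases f
      · exact ⟨.inl ⟨(q, p), ht⟩, (0 : Fin 1), rfl⟩
      · exact ⟨.inl ⟨(p, q), ht⟩, (0 : Fin 1), rfl⟩
    · exact absurd ⟨.inr i, k, ht⟩ h
    · exact .inr ht
  · rintro h ⟨v, k, rfl⟩
    have hw := π.way_npt f ⟨v, k⟩
    rcases h with ⟨j, hj⟩ | hB
    · have := (π.exact f _).unique hw (y₂ := .inl j) hj
      rcases v with e | i <;> cases this
    · have := (π.exact f _).unique hw (y₂ := .inr (.inr (.inr ()))) hB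
      rcases v with e | i <;> cases this

/-- The initial places of the tokens. -/
abbrev Deriv.src (π : Deriv G Γ M A) :
    Fin (inArity Γ A + (sortedBits π).length) → Place π :=
  Fin.append (fun j => Place.root ((inputs Γ A).get j)) (bitOcc π)

/-- The final places of the tokens. -/
abbrev Deriv.snk (π : Deriv G Γ M A) : Fin (outArity Γ A) → Place π :=
  fun j => Place.root ((outputs Γ A).get j)

theorem Deriv.exists_src (π : Deriv G Γ M A) (p : Place π) : (∃ j, π.src j = p) ↔
    (∃ j : JudgOcc Γ A, j.isOut = false ∧ Place.root j = p) ∨ π.flow.B p := by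
  rw [← exists_bitOcc]
  constructor
  · rintro ⟨j, rfl⟩
    induction j using Fin.addCases with
    | left j => exact .inl ⟨_, mem_inputs.1 (List.get_mem _ j), (Fin.append_left
        (fun j => Place.root ((inputs Γ A).get j)) (bitOcc π) j).symm⟩
    | right j => exact .inr ⟨j, (Fin.append_right _ _ j).symm⟩
  · rintro (⟨j, hj, rfl⟩ | ⟨j, rfl⟩)
    · obtain ⟨k, rfl⟩ := List.get_of_mem (mem_inputs.2 hj)
      exact ⟨Fin.castAdd _ k, Fin.append_left _ _ k⟩
    · exact ⟨Fin.natAdd _ j, Fin.append_right _ _ j⟩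

theorem Deriv.exists_snk (π : Deriv G Γ M A) (p : Place π) : (∃ j, π.snk j = p) ↔
    ∃ j : JudgOcc Γ A, j.isOut = true ∧ Place.root j = p := by
  constructor
  · rintro ⟨j, rfl⟩
    exact ⟨_, mem_outputs.1 (List.get_mem _ j), rfl⟩
  · rintro ⟨j, hj, rfl⟩
    obtain ⟨k, rfl⟩ := List.get_of_mem (mem_outputs.2 hj)
    exact ⟨k, rfl⟩

theorem Deriv.not_root_bit (π : Deriv G Γ M A) {j : JudgOcc Γ A} (hj : j.isOut = false)
    (hB : π.flow.B (.root j)) : False := by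
  have := (π.exact false (.root j)).unique (y₁ := .inl j) (y₂ := .inr (.inr (.inr ())))
    ⟨hj, rfl⟩ ⟨rfl, hB⟩
  cases this

/-- The conditions on the wiring are consequences of `Deriv.exact`; acyclicity is
`Deriv.exists_ranked`. -/
theorem Deriv.net_good (π : Deriv G Γ M A) : π.net.Good π.src π.snk where
  pos := by
    rintro (e | i)
    · exact Nat.one_pos
    · exact Nat.succ_pos _
  arg_inj := π.npt_inj true
  res_inj := π.npt_inj false
  src_inj := by
    refine Fin.append_injective_iff.2 ⟨fun i j e => ?_, bitOcc_injective π, fun i j e => ?_⟩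
    · exact (nodup_inputs Γ A).injective_get (Place.root.inj e)
    · exact π.not_root_bit (mem_inputs.1 (List.get_mem (inputs Γ A) i))
        ((exists_bitOcc π _).1 ⟨j, e.symm⟩)
  snk_inj := fun i j e => (nodup_outputs Γ A).injective_get (Place.root.inj e)
  src_iff p := by
    rw [π.exists_src]
    exact (by simp : _ ↔ _).trans (π.not_exists_npt false p).symm
  snk_iff p := by
    rw [π.exists_snk]
    exact (by simp : _ ↔ _).trans (π.not_exists_npt true p).symm
  rank := by
    obtain ⟨r, hr⟩ := π.exists_ranked
    refine ⟨r, ?_⟩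
    rintro (e | i) k k'
    · exact hr.1 _ _ e.2
    · exact hr.2 i k k'

end Machine

end QLam
-- The function computed by the machine.
namespace QLam

variable {G : GateSet}

section Machine

variable {Γ : Ctx} {M : Tm G} {A : Ty}

theorem applyAt_one {m n : ℕ} {i : Fin m → Fin n} (hi : Function.Injective i) (Q : Reg n) :
    applyAt 1 i Q = Q := by
  funext b
  rw [applyAt, Finset.sum_eq_single fun k => b (i k)]
  · rw [Matrix.one_apply_eq, one_mul]
    refine congrArg Q (funext fun j => ?_)
    by_cases hj : ∃ k, i k = j
    · obtain ⟨k, rfl⟩ := hj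
      exact hi.extend_apply _ _ _
    · exact Function.extend_apply' _ _ _ hj
  · intro c _ hc
    rw [Matrix.one_apply_ne' hc, zero_mul]
  · simp

theorem extend_const {α β : Type} [DecidableEq α] (j : α) (q : β) (φ : α → β) :
    Function.extend (fun _ : Fin 1 => j) (fun _ => q) φ = Function.update φ j q := by
  funext i
  by_cases h : i = j
  · subst h
    rw [Function.update_self]
    exact (show Function.Injective (fun _ : Fin 1 => i) from
      fun _ _ _ => Subsingleton.elim _ _).extend_apply _ _ 0
  · rw [Function.update_of_ne h, Function.extend_apply']
    rintro ⟨_, rfl⟩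
    exact h rfl

theorem Step.net {π : Deriv G Γ M A} {n : ℕ} {s t : State π n} (h : Step π s t) :
    π.net.Step (s.tok, s.reg) (t.tok, t.reg) := by
  cases h with
  | move φ Q j q h =>
    have hi : Function.Injective (fun _ : Fin 1 => j) := fun _ _ _ => Subsingleton.elim _ _
    have := Net.Step.fire (W := π.net) φ Q (.inl ⟨(φ j, q), h⟩) (fun _ => j) hi fun _ => rfl
    have e₁ : Function.extend (fun _ : Fin 1 => j) (π.net.res (.inl ⟨(φ j, q), h⟩)) φ =
        Function.update φ j q := extend_const j q φ
    have e₂ : applyAt (π.net.op (.inl ⟨(φ j, q), h⟩)) (fun _ => j) Q = Q := applyAt_one hi Q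
    exact (congrArg₂ (fun a b => π.net.Step (φ, Q) (a, b)) e₁ e₂).mp this
  | gate φ Q U p q h i hi hp =>
    obtain ⟨x, hx⟩ := h.exists_index
    cases hx
    exact Net.Step.fire (W := π.net) φ Q (.inr x) i hi hp

theorem Net.Step.machine {π : Deriv G Γ M A} {n : ℕ} {s t : (Fin n → Place π) × Reg n}
    (h : π.net.Step s t) : QLam.Step π ⟨s.1, s.2⟩ ⟨t.1, t.2⟩ := by
  cases h with
  | fire φ Q v i hi hp =>
    rcases v with ⟨⟨p, q⟩, h⟩ | x
    · have hc : i = fun _ => i (0 : Fin 1) := funext fun k =>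
        congrArg i (Subsingleton.elim (α := Fin 1) k 0)
      have hm : Move (φ (i (0 : Fin 1))) q :=
        (congrArg (Move · q) (hp (0 : Fin 1))).mpr h
      have e₁ : Function.extend i (π.net.res (.inl ⟨(p, q), h⟩)) φ =
          Function.update φ (i (0 : Fin 1)) q :=
        (congrArg (fun i => Function.extend i _ φ) hc).trans (extend_const _ q φ)
      have e₂ : applyAt (π.net.op (.inl ⟨(p, q), h⟩)) i Q = Q := applyAt_one hi Q
      exact (congrArg₂ (fun a b => QLam.Step π ⟨φ, Q⟩ ⟨a, b⟩) e₁ e₂).mpr (.move φ Q _ q hm)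
    · exact .gate φ Q _ _ _ (π.gateAt x) i hi hp

open Classical in
noncomputable instance (π : Deriv G Γ M A) : Fintype π.net.N :=
  @Fintype.ofFinite _ (inferInstanceAs (Finite (_ ⊕ π.GIx)))

noncomputable instance (π : Deriv G Γ M A) : Fintype (Place π) := Fintype.ofFinite _

open Classical in
-- Single-valuedness: the register of a final state is given by a formula in which the run does not
-- occur. Totality: some run reaches the sinks.
theorem computes_iff (π : Deriv G Γ M A) (Q : Reg (inArity Γ A)) (R : Reg (outArity Γ A)) :
    Computes π Q R ↔ R = fun c => ∑ a : Place π → Bool with ∀ j, a (π.snk j) = c j,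
      π.net.weight π.src (initial π Q).reg Finset.univ a := by
  constructor
  · rintro ⟨s, hs, σ, hσ, hR⟩
    have hrun : Relation.ReflTransGen π.net.Step (π.src, (initial π Q).reg) (s.tok, s.reg) :=
      hs.lift (fun s : State π _ => (s.tok, s.reg)) fun _ _ => Step.net
    funext c
    rw [hR, ← π.net_good.run_eq hrun σ hσ c]
  · rintro rfl
    obtain ⟨s, hs, σ, hσ⟩ := π.net_good.exists_run (initial π Q).reg
    refine ⟨⟨s.1, s.2⟩, hs.lift (fun s : (Fin _ → Place π) × Reg _ => (⟨s.1, s.2⟩ : State π _))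
      fun _ _ => Net.Step.machine, σ, hσ, fun c => ?_⟩
    exact (π.net_good.run_eq hs σ hσ c).symm

theorem ind_forall {X : Type} [Fintype X] (p : X → Prop) : ind (∀ x, p x) = ∏ x, ind (p x) := by
  classical
  by_cases h : ∀ x, p x
  · rw [ind_true h, Finset.prod_eq_one fun x _ => ind_true (h x)]
  · rw [ind_false h]
    obtain ⟨x, hx⟩ := not_forall.1 h
    exact (Finset.prod_eq_zero (Finset.mem_univ x) (ind_false hx)).symm

/-- The identity matrix of a move vanishes unless the bits at its two ends agree, whence the
indicator of constancy along the moves. The initial register supplies the input vector and the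
indicator for the bit axioms. -/
theorem Deriv.weight_eq (π : Deriv G Γ M A) (Q : Reg (inArity Γ A)) (a : Place π → Bool) :
    π.net.weight π.src (initial π Q).reg Finset.univ a =
      Q (fun j => a (.root ((inputs Γ A).get j))) * (ind (π.flow.Const a) * π.wt a) := by
  classical
  have h₁ : (initial π Q).reg (fun j => a (π.src j)) =
      Q (fun j => a (.root ((inputs Γ A).get j))) * ind (∀ z ∈ bitAxioms π, a z.2.2 = z.2.1) := by
    simp only [initial, Deriv.src, Fin.append_left, Fin.append_right]
    refine congrArg _ ?_
    have hiff : ((fun j => a (bitOcc π j)) = bitVal π) ↔ ∀ z ∈ bitAxioms π, a z.2.2 = z.2.1 := by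
      simp only [← (sortedBits_perm π).mem_iff]
      refine funext_iff.trans ⟨fun h z hz => ?_, fun h j => h _ (List.get_mem _ j)⟩
      obtain ⟨j, rfl⟩ := List.get_of_mem hz
      exact h j
    by_cases h : (fun j => a (bitOcc π j)) = bitVal π
    · rw [if_pos h, ind_true (hiff.1 h)]
    · rw [if_neg h, ind_false (mt hiff.2 h)]
  have h₂ : ∏ v : π.net.N, π.net.op v (fun k => a (π.net.res v k)) (fun k => a (π.net.arg v k)) =
      ind (π.flow.Const a) * ∏ i, (G.op (π.gsym i)).1 (fun k => a (π.gpt false i k))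
        fun k => a (π.gpt true i k) := by
    have : Fintype {e : Place π × Place π // Move e.1 e.2} := Fintype.ofFinite _
    have hc : π.flow.Const a ↔ ∀ e : {e : Place π × Place π // Move e.1 e.2},
        a e.1.1 = a e.1.2 := ⟨fun h e => h _ _ e.2, fun h p q e => h ⟨(p, q), e⟩⟩
    rw [hc, ind_forall]
    refine (congrArg (fun i : Fintype π.net.N => @Finset.prod _ _ _ (@Finset.univ _ i) _)
      (Subsingleton.elim _ _)).trans ((Fintype.prod_sum_type (α₁ := {e : Place π × Place π //
        Move e.1 e.2}) (α₂ := π.GIx) _).trans (congrArg₂ _ (Finset.prod_congr rfl fun e _ => ?_) rfl))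
    by_cases h : a e.1.1 = a e.1.2
    · rw [ind_true h]
      exact (congrArg (fun x => (1 : Matrix (Fin 1 → Bool) (Fin 1 → Bool) ℂ) (fun _ => a e.1.2) x)
        (funext fun _ => h)).trans (Matrix.one_apply_eq _)
    · rw [ind_false h]
      exact Matrix.one_apply_ne fun he => h (congrFun he (0 : Fin 1)).symm
  rw [Net.weight, h₁, h₂, Deriv.wt]
  ring

/-- The linear map on registers given by a tensor. -/
noncomputable def regMap (Γ : Ctx) (A : Ty) (D : VC Bool Γ → V Bool A → ℂ)
    (Q : Reg (inArity Γ A)) : Reg (outArity Γ A) := fun y =>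
  ∑ g, ∑ x, ind (∀ j, JudgOcc.val g x ((outputs Γ A).get j) = y j) *
    Q (fun j => JudgOcc.val g x ((inputs Γ A).get j)) * D g x

/-- The sum over all assignments is sorted by boundary values; each group sums to `Flow.total`,
which is an entry of `π.den`. -/
theorem Deriv.isFunctionOf (π : Deriv G Γ M A) : IsFunctionOf π (regMap Γ A π.den) := by
  classical
  intro Q R
  rw [computes_iff]
  refine Eq.congr_right (funext fun y => ?_)
  rw [Finset.sum_filter]
  have hx : ∀ a : Place π → Bool, (if ∀ j, a (π.snk j) = y j then
      π.net.weight π.src (initial π Q).reg Finset.univ a else 0) =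
      ∑ g, ∑ x, ind (∀ j, JudgOcc.val g x ((outputs Γ A).get j) = y j) *
        Q (fun j => JudgOcc.val g x ((inputs Γ A).get j)) *
          (ind (∀ j, a (.root j) = JudgOcc.val g x j) * (ind (π.flow.Const a) * π.wt a)) :=
    fun a => by
    -- Only the index pair read off from `a` at the boundary contributes to the double sum.
    obtain ⟨g, x, hgx⟩ := JudgOcc.exists_val fun j => a (.root j)
    rw [Fintype.sum_eq_single g, Fintype.sum_eq_single x]
    · rw [ind_true (p := ∀ j, a (.root j) = JudgOcc.val g x j) fun j => (congrFun hgx j).symm,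
        π.weight_eq, one_mul]
      by_cases hy : ∀ j, a (π.snk j) = y j
      · have e : ind (∀ j, JudgOcc.val g x ((outputs Γ A).get j) = y j) = 1 :=
          ind_true fun j => (congrFun hgx _).trans (hy j)
        rw [if_pos hy, e, one_mul, hgx]
      · have e : ind (∀ j, JudgOcc.val g x ((outputs Γ A).get j) = y j) = 0 :=
          ind_false fun h => hy fun j => (congrFun hgx _).symm.trans (h j)
        rw [if_neg hy, e, zero_mul, zero_mul]
    · intro x' hx'
      rw [ind_false (p := ∀ j, a _ = _), zero_mul, mul_zero]
      exact fun h => hx' (JudgOcc.val_inj (hgx.trans (funext h))).2.symm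
    · intro g' hg'
      refine Finset.sum_eq_zero fun x' _ => ?_
      rw [ind_false (p := ∀ j, a _ = _), zero_mul, mul_zero]
      exact fun h => hg' (JudgOcc.val_inj (hgx.trans (funext h))).1.symm
  simp only [hx]
  rw [Finset.sum_comm]
  refine Finset.sum_congr rfl fun g _ => ?_
  rw [Finset.sum_comm]
  refine Finset.sum_congr rfl fun x _ => ?_
  rw [← Finset.mul_sum, ← π.total_eq g x]
  refine congrArg _ ?_
  exact congrArg (fun i : Fintype (Place π → Bool) => @Finset.sum _ _ _ (@Finset.univ _ i) _)
    (Subsingleton.elim _ _)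

end Machine

theorem regMap_sum (Γ : Ctx) (A : Ty) {X : Type} (s : Finset X) (k : X → ℂ)
    (D : X → VC Bool Γ → V Bool A → ℂ) (Q : Reg (inArity Γ A)) :
    regMap Γ A (fun g x => ∑ i ∈ s, k i * D i g x) Q = ∑ i ∈ s, k i • regMap Γ A (D i) Q := by
  funext y
  simp only [regMap, Finset.sum_apply, Pi.smul_apply, smul_eq_mul, Finset.mul_sum]
  symm
  rw [Finset.sum_comm]
  refine Finset.sum_congr rfl fun g _ => ?_
  rw [Finset.sum_comm]
  exact Finset.sum_congr rfl fun x _ => Finset.sum_congr rfl fun i _ => by ring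

theorem isSupFunction_regMap {Γ : Ctx} {A : Ty} {T : Sup G} (hT : SupHasType Γ T A) :
    IsSupFunction Γ A T (regMap Γ A fun g x => supDen Γ A g x T) := by
  refine ⟨fun M => regMap Γ A (tmDen Γ A M), fun M hM => ⟨hT M hM, fun π => ?_⟩, fun Q => ?_⟩
  · show IsFunctionOf π (regMap Γ A (tmDen Γ A M))
    rw [tmDen_eq π]
    exact π.isFunctionOf
  · exact regMap_sum Γ A T.support T (tmDen Γ A) Q

end QLam


/-- Soundness: if `Γ ⊢ T ≈ S : A`, then `⟦T⟧ = ⟦S⟧` (both functions exist, are unique and total,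
and are equal). -/
theorem mainTheorem1 (G : QLam.GateSet) (Γ : QLam.Ctx) (A : QLam.Ty) (T S : QLam.Sup G)
    (h : QLam.EqTh Γ A T S) :
    ∃ F : QLam.Reg (QLam.inArity Γ A) → QLam.Reg (QLam.outArity Γ A),
      QLam.IsSupFunction Γ A T F ∧ QLam.IsSupFunction Γ A S F := by
  obtain ⟨hT, hS, H⟩ := h.sound
  refine ⟨_, QLam.isSupFunction_regMap hT, ?_⟩
  simp only [H]
  exact QLam.isSupFunction_regMap hS
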